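/- **Setting.** Let $n\ge 2$ and $m\ge 1$ be integers and write $m=2k-1+\varepsilon$ with $k\ge 1$, $\varepsilon\in\{0,1\}$. For $a,b\in\{0,1\}$ let $P_i^{a,b}$ be the Jacobi polynomial $P_i^{(a+(n-3)/2,\;b+(n-3)/2)}$ normalized by $P_i^{a,b}(1)=1$, and let $P_i^{(n)}=P_i^{0,0}$ be the Gegenbauer polynomials. For a real polynomial $p$ let $p_i$ denote the coefficients of its expansion $p=\sum_i p_iP_i^{(n)}$. Let $t_i^{a,b}$ be the largest zero of $P_i^{a,b}$ for $i\ge1$, and $t_0^{1,1}:=-1$. Put $$D(n,m)=\binom{n+k-2+\varepsilon}{n-1}+\binom{n+k-2}{n-1},$$ $$L_m(n,s)=\binom{k+n-3+\varepsilon}{n-2}\left[\frac{2k+n-3+2\varepsilon}{n-1}-\frac{(1+s)^{\varepsilon}\bigl(P^{(n)}_{k-1+\varepsilon}(s)-P^{(n)}_{k+\varepsilon}(s)\bigr)}{(1-s)\bigl(\varepsilon P^{(n)}_{k}(s)+P^{(n)}_{k+\varepsilon}(s)\bigr)}\right],$$ the Levenshtein bound, which applies for $s\in[t_{k-1+\varepsilon}^{1,1-\varepsilon},\,t_k^{1,\varepsilon}]$,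 and let $$f_m^{(n,s)}(t)=(t-s)(t+1)^{\varepsilon}\Bigl(\sum_{i=0}^{k-1} r_i\,P_i^{1,\varepsilon}(t)P_i^{1,\varepsilon}(s)\Bigr)^2=\sum_{i=0}^m f_iP_i^{(n)}(t)$$ be the Levenshtein polynomial, where $1/r_i$ is the squared norm of $P_i^{1,\varepsilon}$ in $L^2$ of the probability measure on $[-1,1]$ proportional to $(1-t)^{1+(n-3)/2}(1+t)^{\varepsilon+(n-3)/2}\,dt$. Let $W=(w_1,\dots,w_N)$ with $w_i>0$ and $\sum_i w_i=1$, and put $N_W=1/\sum_i w_i^2$. For $s\in[-1,1)$ and a potential $h$ let $$\mathcal U^h(s,W)=\sup\sum_{i\ne j}w_iw_j\,h(x_i\cdot x_j),$$ where the supremum (in the extended reals, equal to $-\infty$ if there is no such tuple) is over all $N$-tuples $(x_1,\dots,x_N)$ of distinct points of the unit sphere $\mathbb S^{n-1}\subset\mathbb R^n$ with $\max_{i\ne j}x_i\cdot x_j=s$. **Theorem 4.2 (UUB for weighted codes).** Let $s\in[-1,1)$ with $s\in[t_{k-1+\varepsilon}^{1,1-\varepsilon},\,t_k^{1,\varepsilon}]$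 be such that $N_1:=L_m(n,s)$ satisfies $D(n,m)<N_1\le D(n,m+1)$. Let $h$ be real-valued and continuous on $[-1,1)$ and $m$ times differentiable on $(-1,1)$ with $h^{(m)}\ge0$ there. Then the multiset $T$ of the real roots of $f_m^{(n,s)}$, counted with multiplicity, consists of $m$ points of $[-1,s]$, and $$\mathcal U^h(s,W)\le-\lambda^*f_0\Bigl(1-\frac{N_1}{N_W}\Bigr)+(g_T)_0-\frac{g_T(1)}{N_W}.$$ Here $g_T$ is the Hermite interpolant of $h$ at $T$, i.e. the unique polynomial of degree less than $m$ with $g_T^{(j)}(\alpha)=h^{(j)}(\alpha)$ for every $\alpha\in T$ and every $j$ less than the multiplicity of $\alpha$ in $T$, and $$\lambda^*=\max\Bigl\{\frac{(g_T)_i}{f_i}\;:\;1\le i\le m,\ (g_T)_i>0\Bigr\},$$ with $\lambda^*=0$ if no $(g_T)_i$ with $1\le i\le m$ is positive. -/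

import Mathlib

open Polynomial

namespace WeightedCodes

noncomputable section

/-! ### Weighted spherical codes and their energy -/

/-- A weight vector: positive weights with total mass one. -/
def IsWeight {N : ℕ} (w : Fin N → ℝ) : Prop :=
  (∀ i, 0 < w i) ∧ ∑ i, w i = 1

/-- `s` is the maximal inner product of pairs of distinct points of the tuple `x`. -/
def IsMaxInner {n N : ℕ} (x : Fin N → Metric.sphere (0 : EuclideanSpace ℝ (Fin n)) 1)
    (s : ℝ) : Prop :=
  IsGreatest {u : ℝ | ∃ i j : Fin N, i ≠ j ∧
    u = inner ℝ (x i : EuclideanSpace ℝ (Fin n)) (x j)} s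

/-- The weighted `h`-energy: the sum over all ordered pairs `i ≠ j` of
`w i * w j * h (x i ⬝ x j)`. -/
def energy {n N : ℕ} (h : ℝ → ℝ) (x : Fin N → Metric.sphere (0 : EuclideanSpace ℝ (Fin n)) 1)
    (w : Fin N → ℝ) : ℝ :=
  ∑ i, ∑ j ∈ Finset.univ.erase i,
    w i * w j * h (inner ℝ (x i : EuclideanSpace ℝ (Fin n)) (x j))

/-- The maximum weighted `h`-energy: the supremum, in the extended reals, of the energies of all
`N`-tuples of distinct points of the unit sphere of `ℝⁿ` whose maximal inner product is `s`. -/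
def maxEnergy (n : ℕ) {N : ℕ} (h : ℝ → ℝ) (s : ℝ) (w : Fin N → ℝ) : EReal :=
  sSup {E : EReal | ∃ x : Fin N → Metric.sphere (0 : EuclideanSpace ℝ (Fin n)) 1,
    Function.Injective x ∧ IsMaxInner x s ∧ E = ((energy h x w : ℝ) : EReal)}

/-- The effective size `N_W = 1 / ∑ w_i²` of a weight vector. -/
def effSize {N : ℕ} (w : Fin N → ℝ) : ℝ := 1 / ∑ i, w i ^ 2

/-! ### Jacobi and Gegenbauer polynomials -/

/-- The Jacobi polynomial `P_k^{(α,β)}`, normalized to take the value `1` at `1`: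
`₂F₁(-k, k + α + β + 1; α + 1; (1 - t) / 2)`, where the factors `(-k)_j / j!` have been written
as `(-1)^j * choose k j`. -/
def jacobi (α β : ℝ) (k : ℕ) : ℝ[X] :=
  ∑ j ∈ Finset.range (k + 1),
    C ((k.choose j : ℝ) * (ascPochhammer ℝ j).eval (k + α + β + 1) /
      (ascPochhammer ℝ j).eval (α + 1)) * (C (1 / 2) * (X - 1)) ^ j

/-- The Jacobi polynomial with parameters `(a + (n-3)/2, b + (n-3)/2)`. -/
def adjacent (n a b k : ℕ) : ℝ[X] :=
  jacobi (a + ((n : ℝ) - 3) / 2) (b + ((n : ℝ) - 3) / 2) k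

/-- The Gegenbauer polynomial `P_k^{(n)}`, normalized to take the value `1` at `1`. -/
def gegenbauer (n k : ℕ) : ℝ[X] := adjacent n 0 0 k

/-- The largest zero `t_k^{a,b}` of `adjacent n a b k`, with the convention `t_0 = -1`. -/
def largestZero (n a b k : ℕ) : ℝ :=
  if k = 0 then -1 else sSup {t : ℝ | (adjacent n a b k).IsRoot t}

lemma jacobi_degree {α β : ℝ} (hα : -1 < α) (hαβ : -1 ≤ α + β) (k : ℕ) :
    (jacobi α β k).degree = k := by
  have hd : ∀ j : ℕ, ((C (1 / 2 : ℝ) * (X - 1)) ^ j).degree = (j : WithBot ℕ) := fun j => by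
    have h1 : (X - 1 : ℝ[X]).degree = 1 := by simpa using degree_X_sub_C (1 : ℝ)
    rw [degree_pow, degree_C_mul (by norm_num), h1]; simp
  have hlead : (k.choose k : ℝ) * (ascPochhammer ℝ k).eval (k + α + β + 1) /
      (ascPochhammer ℝ k).eval (α + 1) ≠ 0 := by
    have h2 : 0 < (ascPochhammer ℝ k).eval (α + 1) := ascPochhammer_pos k _ (by linarith)
    have h3 : (ascPochhammer ℝ k).eval (k + α + β + 1) ≠ 0 := by
      rcases Nat.eq_zero_or_pos k with rfl | hk
      · simp
      · have : (1 : ℝ) ≤ k := by exact_mod_cast hk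
        exact (ascPochhammer_pos k _ (by linarith)).ne'
    rw [Nat.choose_self]
    exact div_ne_zero (mul_ne_zero (by norm_num) h3) h2.ne'
  rw [jacobi, Finset.sum_range_succ, degree_add_eq_right_of_degree_lt] <;>
    rw [degree_C_mul hlead, hd]
  refine lt_of_le_of_lt (degree_sum_le _ _) ?_
  rw [Finset.sup_lt_iff (WithBot.bot_lt_coe _)]
  intro j hj
  rw [← smul_eq_C_mul]
  refine lt_of_le_of_lt (degree_smul_le _ _) ?_
  rw [hd]
  exact_mod_cast Finset.mem_range.mp hj

lemma gegenbauer_degree {n : ℕ} (hn : 2 ≤ n) (k : ℕ) : (gegenbauer n k).degree = k := by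
  have : (2 : ℝ) ≤ n := by exact_mod_cast hn
  exact jacobi_degree (by push_cast; linarith) (by push_cast; linarith) k

/-- The Gegenbauer polynomials form a basis of `ℝ[X]`. -/
def gegenbauerBasis {n : ℕ} (hn : 2 ≤ n) : Module.Basis ℕ ℝ ℝ[X] :=
  Sequence.basis ⟨gegenbauer n, gegenbauer_degree hn⟩
    fun i => isUnit_iff_ne_zero.mpr (leadingCoeff_ne_zero.mpr (Sequence.ne_zero _ i))

lemma gegenbauerBasis_apply {n : ℕ} (hn : 2 ≤ n) (i : ℕ) :
    gegenbauerBasis hn i = gegenbauer n i := by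
  simp [gegenbauerBasis]

/-- The coefficient `p_i` in the Gegenbauer expansion `p = ∑ p_i P_i^{(n)}`. -/
def gegenbauerCoeff {n : ℕ} (hn : 2 ≤ n) (p : ℝ[X]) (i : ℕ) : ℝ :=
  (gegenbauerBasis hn).repr p i

/-! ### The Levenshtein bound and the Levenshtein polynomial

A positive integer `m` is written as `m = 2k - 1 + ε` with `k ≥ 1` and `ε ∈ {0, 1}`. -/

/-- The integer `k` in `m = 2k - 1 + ε`. -/
def halfIdx (m : ℕ) : ℕ := (m + 1) / 2

/-- The parity `ε` in `m = 2k - 1 + ε`. -/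
def parity (m : ℕ) : ℕ := (m + 1) % 2

lemma halfIdx_parity (m : ℕ) : 2 * halfIdx m + parity m = m + 1 ∧ parity m ≤ 1 := by
  unfold halfIdx parity; omega

/-- The Delsarte-Goethals-Seidel bound `D(n, m)`. -/
def dgs (n m : ℕ) : ℕ :=
  (n + halfIdx m - 2 + parity m).choose (n - 1) + (n + halfIdx m - 2).choose (n - 1)

/-- The Levenshtein bound `L_m(n, s)`. -/
def levenshteinBound (n m : ℕ) (s : ℝ) : ℝ :=
  let k := halfIdx m
  let ε := parity m
  ((k + n - 3 + ε).choose (n - 2) : ℝ) *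
    ((2 * k + n - 3 + 2 * ε) / (n - 1) -
      (1 + s) ^ ε * ((gegenbauer n (k - 1 + ε)).eval s - (gegenbauer n (k + ε)).eval s) /
        ((1 - s) * (ε * (gegenbauer n k).eval s + (gegenbauer n (k + ε)).eval s)))

/-- The interval of those `s` for which the Levenshtein bound of index `m` is in force. -/
def levenshteinInterval (n m : ℕ) : Set ℝ :=
  Set.Icc (largestZero n 1 (1 - parity m) (halfIdx m - 1 + parity m))
    (largestZero n 1 (parity m) (halfIdx m))

/-- The reciprocal of the squared norm of `jacobi α β i` in `L²` of the probability measure on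
`[-1, 1]` proportional to `(1 - t)^α (1 + t)^β dt` (for `α, β > -1`, `α + β > -1`). -/
def jacobiInvNormSq (α β : ℝ) (i : ℕ) : ℝ :=
  (2 * i + α + β + 1) / (α + β + 1) *
    ((ascPochhammer ℝ i).eval (α + 1) * (ascPochhammer ℝ i).eval (α + β + 1)) /
      ((ascPochhammer ℝ i).eval (β + 1) * (i.factorial : ℝ))

/-- The reproducing (Christoffel-Darboux) kernel
`T(t, s) = ∑_{i < k} r_i P_i(t) P_i(s)`, as a polynomial in `t`, where `P_i` is
`adjacent n 1 ε i` and `r_i` is the reciprocal of its squared norm. -/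
def levenshteinKernel (n ε k : ℕ) (s : ℝ) : ℝ[X] :=
  ∑ i ∈ Finset.range k,
    C (jacobiInvNormSq (1 + ((n : ℝ) - 3) / 2) (ε + ((n : ℝ) - 3) / 2) i *
      (adjacent n 1 ε i).eval s) * adjacent n 1 ε i

/-- The Levenshtein polynomial `f_m^{(n,s)}(t) = (t - s) (t + 1)^ε T(t, s)²`. -/
def levenshteinPoly (n m : ℕ) (s : ℝ) : ℝ[X] :=
  (X - C s) * (X + 1) ^ parity m * levenshteinKernel n (parity m) (halfIdx m) s ^ 2

/-! ### Hermite interpolation -/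

/-- `p` is the Hermite interpolant of `h` at the multiset `T` of nodes: it has degree less than the
size of `T`, and at each node `a` it agrees with `h` together with the derivatives of order less
than the multiplicity of `a`. -/
def IsHermiteInterpolant (h : ℝ → ℝ) (T : Multiset ℝ) (p : ℝ[X]) : Prop :=
  p.degree < (T.card : WithBot ℕ) ∧
    ∀ a ∈ T, ∀ j < T.count a, (derivative^[j] p).eval a = iteratedDeriv j h a

lemma eq_zero_of_hermite {T : Multiset ℝ} {p : ℝ[X]} (hp : p.degree < (T.card : WithBot ℕ))
    (h0 : ∀ a ∈ T, ∀ j < T.count a, (derivative^[j] p).eval a = 0) : p = 0 := by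
  by_contra hne
  have hle : T ≤ p.roots := by
    rw [Multiset.le_iff_count]
    intro a
    rw [count_roots]
    by_cases ha : a ∈ T
    · have hc : 0 < T.count a := Multiset.count_pos.mpr ha
      have := (lt_rootMultiplicity_iff_isRoot_iterate_derivative (n := T.count a - 1) hne).mpr
        (fun j hj => h0 a ha j (by omega))
      omega
    · simp [Multiset.count_eq_zero_of_notMem ha]
  have h1 := Multiset.card_le_card hle
  have h2 := card_roots' p
  rw [degree_eq_natDegree hne] at hp
  have : p.natDegree < T.card := by exact_mod_cast hp
  omega

theorem existsUnique_hermite (h : ℝ → ℝ) (T : Multiset ℝ) :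
    ∃! p : ℝ[X], IsHermiteInterpolant h T p := by
  let ev : degreeLT ℝ T.card →ₗ[ℝ] ((Σ a : T.toFinset, Fin (T.count (a : ℝ))) → ℝ) :=
    LinearMap.pi fun q => (Polynomial.leval (q.1 : ℝ)) ∘ₗ ((derivative : ℝ[X] →ₗ[ℝ] ℝ[X]) ^ (q.2 : ℕ))
      ∘ₗ (degreeLT ℝ T.card).subtype
  have hev : ∀ p q, ev p q = (derivative^[(q.2 : ℕ)] (p : ℝ[X])).eval (q.1 : ℝ) := fun p q => by
    simp [ev, Module.End.pow_apply]
  have hinj : Function.Injective ev := by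
    rw [← LinearMap.ker_eq_bot, LinearMap.ker_eq_bot']
    intro p hp
    refine Subtype.ext (eq_zero_of_hermite (T := T) (mem_degreeLT.mp p.2) ?_)
    intro a ha j hj
    rw [← hev p ⟨⟨a, Multiset.mem_toFinset.mpr ha⟩, ⟨j, hj⟩⟩, hp]; rfl
  have hfin : Module.finrank ℝ (degreeLT ℝ T.card) =
      Module.finrank ℝ ((Σ a : T.toFinset, Fin (T.count (a : ℝ))) → ℝ) := by
    rw [(degreeLTEquiv ℝ T.card).finrank_eq]
    simp only [Module.finrank_fintype_fun_eq_card, Fintype.card_fin, Fintype.card_sigma]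
    rw [Finset.sum_coe_sort T.toFinset (fun a => T.count a), Multiset.toFinset_sum_count_eq]
  have : FiniteDimensional ℝ (degreeLT ℝ T.card) :=
    (degreeLTEquiv ℝ T.card).symm.finiteDimensional
  obtain ⟨p, hp⟩ := (LinearMap.injective_iff_surjective_of_finrank_eq_finrank hfin).mp hinj
    (fun q => iteratedDeriv (q.2 : ℕ) h (q.1 : ℝ))
  have hpT : IsHermiteInterpolant h T p := by
    refine ⟨mem_degreeLT.mp p.2, fun a ha j hj => ?_⟩
    rw [← hev p ⟨⟨a, Multiset.mem_toFinset.mpr ha⟩, ⟨j, hj⟩⟩, hp]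
  refine ⟨p, hpT, fun q hq => sub_eq_zero.mp (eq_zero_of_hermite (T := T) ?_ ?_)⟩
  · exact lt_of_le_of_lt (degree_sub_le _ _) (max_lt hq.1 hpT.1)
  · intro a ha j hj
    rw [iterate_derivative_sub, eval_sub, hq.2 a ha j hj, hpT.2 a ha j hj, sub_self]

/-- The Hermite interpolation polynomial of `h` at the multiset `T` of nodes. -/
def hermiteInterp (h : ℝ → ℝ) (T : Multiset ℝ) : ℝ[X] := (existsUnique_hermite h T).choose

lemma hermiteInterp_spec (h : ℝ → ℝ) (T : Multiset ℝ) :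
    IsHermiteInterpolant h T (hermiteInterp h T) := (existsUnique_hermite h T).choose_spec.1

/-- The polynomial `g_T`: the Hermite interpolant of `h` at the roots of the Levenshtein polynomial,
taken with their multiplicities. -/
def gT (n m : ℕ) (s : ℝ) (h : ℝ → ℝ) : ℝ[X] := hermiteInterp h (levenshteinPoly n m s).roots

/-- The set of the indices in `{1, ..., m}` of the positive Gegenbauer coefficients of `p`. -/
def posIndices {n : ℕ} (hn : 2 ≤ n) (m : ℕ) (p : ℝ[X]) : Finset ℕ :=
  {i ∈ Finset.Icc 1 m | 0 < gegenbauerCoeff hn p i}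

/-- The constant `λ* = max {(g_T)_i / f_i : i ∈ I(g_T)}`, and `0` if `I(g_T)` is empty. -/
def lambdaStar {n : ℕ} (hn : 2 ≤ n) (m : ℕ) (s : ℝ) (h : ℝ → ℝ) : ℝ :=
  if hI : (posIndices hn m (gT n m s h)).Nonempty then
    (posIndices hn m (gT n m s h)).sup' hI fun i =>
      gegenbauerCoeff hn (gT n m s h) i / gegenbauerCoeff hn (levenshteinPoly n m s) i
  else 0

end

end WeightedCodes

open WeightedCodes

/-! The bound is a linear programming bound with test polynomial F = g_T - λ* f, where f is the
Levenshtein polynomial. On [-1, s] one has f ≤ 0 and h ≤ g_T, hence h ≤ F, while λ* is chosen so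
that F_i ≤ 0 for i ≥ 1. Adding the diagonal terms F(1) ∑ w_i² to the off-diagonal F-energy gives a
full double sum, and this is at most F_0 because Gegenbauer polynomials are positive definite on the
sphere (`gegenbauer_posDef`, `energy_le_of_gegenbauerCoeff_nonpos`). The identity f(1) = f_0 L_m(n,
s) turns F_0 - F(1) / N_W into the asserted expression.

Four facts about f and h carry the argument. (1) Zeros of f. The kernel T in f = (t - s)(t + 1)^ε T²
has only real zeros (`jacobi_pencil_splits`), all in [-1, s) (`levenshteinKernel_ne_zero`). The node
-1 is at most simple: it could be multiple only if ε = 0 and s is a zero of P_{k-1}^{1,1}, but there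
L_m(n, s) = D(n, m), which the strict inequality D(n, m) < N_1 excludes
(`levenshteinValue_of_adjacent_eq_zero`). This matters because h is merely continuous at -1. (2) f_i
> 0 for i ≤ m (`gegenbauerCoeff_levenshtein_pos`). By Christoffel-Darboux, (t - s) T is a
combination of P_k^{1,ε} and P_{k-1}^{1,ε} with nonnegative coefficients for these s, the adjacent
polynomials have nonnegative Gegenbauer coefficients, and products of Gegenbauer polynomials expand
nonnegatively (`hyperbolic_nonneg`). (3) f(1) = f_0 L_m(n, s) (`levenshtein_eval_one`), from an
orthogonality computation of f_0. (4) h ≤ g_T on [-1, s] (`IsHermiteInterpolant.le_eval`), by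
repeated use of Rolle's theorem, since the nodal polynomial is also (t - s)(t + 1)^ε times a square.

No integration is used: the zeroth Gegenbauer coefficient replaces the mean, and everything about
Jacobi polynomials comes from contiguous relations between explicit coefficients. Positive
definiteness comes from the Fischer inner product, for which zonal harmonics are reproducing
kernels. -/

namespace WeightedCodes

noncomputable section

section

/-! ### Contiguous relations between Jacobi polynomials -/

/-- The coefficients of `jacobi α β k` with respect to the powers of `(X - 1) / 2`. -/
def jacobiCoeff (α β : ℝ) (k j : ℕ) : ℝ :=
  (k.choose j : ℝ) * (ascPochhammer ℝ j).eval (k + α + β + 1) / (ascPochhammer ℝ j).eval (α + 1)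

/-- The polynomial whose composition with `(X - 1) / 2` is `jacobi α β k`. -/
def jacobiShifted (α β : ℝ) (k : ℕ) : ℝ[X] :=
  ∑ j ∈ Finset.range (k + 1), C (jacobiCoeff α β k j) * X ^ j

lemma jacobi_eq_comp (α β : ℝ) (k : ℕ) :
    jacobi α β k = (jacobiShifted α β k).comp (C (1 / 2) * (X - 1)) := by
  simp [jacobi, jacobiShifted, jacobiCoeff, Polynomial.sum_comp]

lemma coeff_jacobiShifted (α β : ℝ) (k j : ℕ) :
    (jacobiShifted α β k).coeff j = jacobiCoeff α β k j := by
  rw [jacobiShifted, finsetSum_coeff]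
  simp only [coeff_C_mul, coeff_X_pow, mul_ite, mul_one, mul_zero, Finset.sum_ite_eq,
    Finset.mem_range]
  split_ifs with h
  · rfl
  · rw [jacobiCoeff, Nat.choose_eq_zero_of_lt (by omega)]; simp

lemma ascPochhammer_eval_succ_left (x : ℝ) (j : ℕ) :
    (ascPochhammer ℝ (j + 1)).eval x = x * (ascPochhammer ℝ j).eval (x + 1) := by
  rw [ascPochhammer_succ_left]; simp

lemma ascPochhammer_eval_mul_add (x : ℝ) (j : ℕ) :
    (ascPochhammer ℝ j).eval x * (x + j) = x * (ascPochhammer ℝ j).eval (x + 1) := by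
  rw [← ascPochhammer_succ_eval, ascPochhammer_eval_succ_left]

lemma cast_choose_succ_right (k j : ℕ) :
    (k.choose (j + 1) : ℝ) = k.choose j * (k - j) / (j + 1) := by
  have h := Nat.choose_succ_right_eq k j
  have hj : (j : ℝ) + 1 ≠ 0 := by positivity
  rw [eq_div_iff hj]
  rcases le_or_gt j k with hle | hlt
  · have : ((k.choose (j + 1) * (j + 1) : ℕ) : ℝ) = ((k.choose j * (k - j) : ℕ) : ℝ) := by rw [h]
    push_cast [Nat.cast_sub hle] at this
    exact this
  · rw [Nat.choose_eq_zero_of_lt (by omega : k < j), Nat.choose_eq_zero_of_lt (by omega)]; simp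

lemma cast_succ_choose_succ (k j : ℕ) :
    ((k + 1).choose (j + 1) : ℝ) = k.choose j * (k + 1) / (j + 1) := by
  have h := Nat.add_one_mul_choose_eq k j
  have hj : (j : ℝ) + 1 ≠ 0 := by positivity
  rw [eq_div_iff hj]
  have : (((k + 1) * k.choose j : ℕ) : ℝ) = (((k + 1).choose (j + 1) * (j + 1) : ℕ) : ℝ) := by
    rw [h]
  push_cast at this
  linarith

lemma cast_mul_pred_choose (k j : ℕ) :
    (k : ℝ) * ((k - 1).choose j : ℝ) = (k - j) * k.choose j := by
  rcases k with _ | k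
  · rcases j with _ | j <;> simp
  · have h := Nat.choose_mul_succ_eq k j
    rcases le_or_gt j (k + 1) with hle | hlt
    · have : ((k.choose j * (k + 1) : ℕ) : ℝ) = (((k + 1).choose j * (k + 1 - j) : ℕ) : ℝ) := by
        rw [h]
      push_cast [Nat.cast_sub hle] at this
      simp only [Nat.add_sub_cancel]
      push_cast
      linarith
    · simp only [Nat.add_sub_cancel]
      rw [Nat.choose_eq_zero_of_lt (by omega : k < j), Nat.choose_eq_zero_of_lt hlt]; simp

lemma jacobi_zero (α β : ℝ) : jacobi α β 0 = 1 := by simp [jacobi]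

lemma jacobi_eval_one (α β : ℝ) (k : ℕ) : (jacobi α β k).eval 1 = 1 := by
  rw [jacobi_eq_comp, eval_comp]
  simp only [eval_mul, eval_C, eval_sub, eval_X, eval_one, sub_self, mul_zero]
  rw [← coeff_zero_eq_eval_zero, coeff_jacobiShifted, jacobiCoeff]
  simp

/-- Lowering the second parameter. -/
lemma jacobi_lower_right {α : ℝ} (β : ℝ) (k : ℕ) :
    C (2 * k + α + β + 1) * jacobi α β k =
      C (k + α + β + 1) * jacobi α (β + 1) k + C (k : ℝ) * jacobi α (β + 1) (k - 1) := by
  have key : C (2 * k + α + β + 1) * jacobiShifted α β k = C (k + α + β + 1) *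
      jacobiShifted α (β + 1) k + C (k : ℝ) * jacobiShifted α (β + 1) (k - 1) := by
    ext j
    simp only [coeff_add, coeff_C_mul, coeff_jacobiShifted, jacobiCoeff]
    have h1 := cast_mul_pred_choose k j
    have h2 := ascPochhammer_eval_mul_add (k + α + β + 1) j
    have e1 : (k : ℝ) + α + (β + 1) + 1 = k + α + β + 1 + 1 := by ring
    have e2 : (k : ℝ) * ((k - 1).choose j : ℝ) * (ascPochhammer ℝ j).eval
        (((k - 1 : ℕ) : ℝ) + α + (β + 1) + 1) =
        (k - j) * k.choose j * (ascPochhammer ℝ j).eval (k + α + β + 1) := by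
      rcases k with _ | k
      · rcases j with _ | j <;> simp
      · rw [h1]; congr 2; simp only [Nat.add_sub_cancel]; push_cast; ring
    rw [e1, mul_div_assoc', mul_div_assoc', mul_div_assoc', ← add_div, ← mul_assoc (k : ℝ), e2]
    congr 1
    linear_combination (k.choose j : ℝ) * h2
  have := congrArg (fun p : ℝ[X] => p.comp (C (1 / 2) * (X - 1))) key
  simpa only [add_comp, mul_comp, C_comp, ← jacobi_eq_comp] using this

/-- Lowering the first parameter. -/
lemma jacobi_lower_left {α : ℝ} (hα : -1 < α) (β : ℝ) (k : ℕ) :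
    C ((2 * k + α + β + 1) * (α + 1)) * jacobi α β k =
      C ((k + α + β + 1) * (k + α + 1)) * jacobi (α + 1) β k -
        C ((k + β) * k) * jacobi (α + 1) β (k - 1) := by
  have key : C ((2 * k + α + β + 1) * (α + 1)) * jacobiShifted α β k =
      C ((k + α + β + 1) * (k + α + 1)) * jacobiShifted (α + 1) β k -
        C ((k + β) * k) * jacobiShifted (α + 1) β (k - 1) := by
    ext j
    simp only [coeff_sub, coeff_C_mul, coeff_jacobiShifted, jacobiCoeff]
    have h1 := cast_mul_pred_choose k j
    have h2 := ascPochhammer_eval_mul_add (k + α + β + 1) j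
    have h3 := ascPochhammer_eval_mul_add (α + 1) j
    have p1 : (ascPochhammer ℝ j).eval (α + 1) ≠ 0 := (ascPochhammer_pos j _ (by linarith)).ne'
    have p2 : (ascPochhammer ℝ j).eval (α + 1 + 1) ≠ 0 :=
      (ascPochhammer_pos j _ (by linarith)).ne'
    have e1 : (k : ℝ) + (α + 1) + β + 1 = k + α + β + 1 + 1 := by ring
    have e2 : (k : ℝ) * ((k - 1).choose j : ℝ) * (ascPochhammer ℝ j).eval
        (((k - 1 : ℕ) : ℝ) + (α + 1) + β + 1) =
        (k - j) * k.choose j * (ascPochhammer ℝ j).eval (k + α + β + 1) := by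
      rcases k with _ | k
      · rcases j with _ | j <;> simp
      · rw [h1]; congr 2; simp only [Nat.add_sub_cancel]; push_cast; ring
    rw [e1]
    have e3 : (k + β) * k * (((k - 1).choose j : ℝ) * (ascPochhammer ℝ j).eval
        (((k - 1 : ℕ) : ℝ) + (α + 1) + β + 1) / (ascPochhammer ℝ j).eval (α + 1 + 1)) =
        (k + β) * ((k - j) * k.choose j * (ascPochhammer ℝ j).eval (k + α + β + 1)) /
          (ascPochhammer ℝ j).eval (α + 1 + 1) := by
      rw [← e2]; ring
    rw [e3]
    field_simp
    generalize (ascPochhammer ℝ j).eval (α + 1) = a at *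
    generalize (ascPochhammer ℝ j).eval (α + 1 + 1) = b at *
    generalize (ascPochhammer ℝ j).eval (k + α + β + 1) = c at *
    generalize (ascPochhammer ℝ j).eval (k + α + β + 1 + 1) = d at *
    generalize (k.choose j : ℝ) = e at *
    linear_combination (-(2 * k + α + β + 1) * c * e) * h3 + (a * e * (k + α + 1)) * h2
  have := congrArg (fun p : ℝ[X] => p.comp (C (1 / 2) * (X - 1))) key
  simpa only [add_comp, sub_comp, mul_comp, C_comp, ← jacobi_eq_comp] using this

/-- Raising the second parameter. -/
lemma jacobi_raise_right {α : ℝ} (hα : -1 < α) (β : ℝ) (k : ℕ) :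
    C (2 * k + α + β + 2) * ((X + 1) * jacobi α (β + 1) k) =
      C (2 * (k + 1 + α)) * jacobi α β (k + 1) + C (2 * (k + β + 1)) * jacobi α β k := by
  have key : C (2 * k + α + β + 2) * ((X + 1) * jacobiShifted α (β + 1) k) =
      C (k + 1 + α) * jacobiShifted α β (k + 1) + C (k + β + 1) * jacobiShifted α β k := by
    ext j
    have hX : ∀ (p : ℝ[X]) (i : ℕ), ((X + 1) * p).coeff (i + 1) = p.coeff i + p.coeff (i + 1) := by
      intro p i; rw [add_mul, one_mul, coeff_add, coeff_X_mul]
    rw [coeff_add, coeff_C_mul, coeff_C_mul, coeff_C_mul]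
    rcases j with _ | j
    · simp [coeff_jacobiShifted, jacobiCoeff, add_mul]
      ring
    · have p1 : (ascPochhammer ℝ j).eval (α + 1) ≠ 0 := (ascPochhammer_pos j _ (by linarith)).ne'
      have p2 : α + 1 + j ≠ 0 := by
        have : (0 : ℝ) ≤ j := by positivity
        linarith
      have e1 : (k : ℝ) + α + (β + 1) + 1 = k + α + β + 1 + 1 := by ring
      have e2 : ((k + 1 : ℕ) : ℝ) + α + β + 1 = k + α + β + 1 + 1 := by push_cast; ring
      rw [hX]
      simp only [coeff_jacobiShifted, jacobiCoeff, cast_choose_succ_right k,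
        cast_succ_choose_succ, e1, e2]
      rw [ascPochhammer_eval_succ_left (k + α + β + 1), ascPochhammer_succ_eval,
        ascPochhammer_succ_eval]
      field_simp
      ring
  -- Substituting (X - 1) / 2 for X turns the factor X + 1 into (X + 1) / 2; the factor 2 clears
  -- this.
  have := congrArg (fun p : ℝ[X] => 2 * p.comp (C (1 / 2) * (X - 1))) key
  simp only [add_comp, mul_comp, C_comp, ← jacobi_eq_comp, X_comp, one_comp] at this
  have hC : (2 : ℝ[X]) * C (1 / 2) = 1 := by
    rw [← C_ofNat, ← C_mul]; norm_num
  have h2 : (C (2 : ℝ) : ℝ[X]) = 2 := C_ofNat 2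
  rw [C_mul (a := (2 : ℝ)) (b := k + 1 + α), C_mul (a := (2 : ℝ)) (b := k + β + 1), h2]
  linear_combination this - C (2 * k + α + β + 2) * jacobi α (β + 1) k * (X - 1) * hC

/-- Raising the first parameter. -/
lemma jacobi_raise_left {α : ℝ} (hα : -1 < α) (β : ℝ) (k : ℕ) :
    C (2 * k + α + β + 2) * ((1 - X) * jacobi (α + 1) β k) =
      C (2 * (α + 1)) * (jacobi α β k - jacobi α β (k + 1)) := by
  have key : C (2 * k + α + β + 2) * (X * jacobiShifted (α + 1) β k) =
      C (α + 1) * (jacobiShifted α β (k + 1) - jacobiShifted α β k) := by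
    ext j
    rw [coeff_C_mul, coeff_C_mul, coeff_sub]
    rcases j with _ | j
    · simp [coeff_jacobiShifted, jacobiCoeff]
    · have p1 : (ascPochhammer ℝ j).eval (α + 1 + 1) ≠ 0 :=
        (ascPochhammer_pos j _ (by linarith)).ne'
      have p2 : α + 1 ≠ 0 := by linarith
      have e1 : (k : ℝ) + (α + 1) + β + 1 = k + α + β + 1 + 1 := by ring
      have e2 : ((k + 1 : ℕ) : ℝ) + α + β + 1 = k + α + β + 1 + 1 := by push_cast; ring
      rw [coeff_X_mul]
      simp only [coeff_jacobiShifted, jacobiCoeff, cast_choose_succ_right k,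
        cast_succ_choose_succ, e1, e2]
      rw [ascPochhammer_eval_succ_left (k + α + β + 1), ascPochhammer_eval_succ_left (α + 1),
        ascPochhammer_succ_eval]
      field_simp
      ring
  have := congrArg (fun p : ℝ[X] => 2 * p.comp (C (1 / 2) * (X - 1))) key
  simp only [sub_comp, mul_comp, C_comp, ← jacobi_eq_comp, X_comp] at this
  have hC : (2 : ℝ[X]) * C (1 / 2) = 1 := by
    rw [← C_ofNat, ← C_mul]; norm_num
  have h2 : (C (2 : ℝ) : ℝ[X]) = 2 := C_ofNat 2
  rw [C_mul (a := (2 : ℝ)) (b := α + 1), h2]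
  linear_combination -this + C (2 * k + α + β + 2) * jacobi (α + 1) β k * (X - 1) * hC

lemma eq_C_inv_mul {a : ℝ} (ha : a ≠ 0) {p q : ℝ[X]} (h : C a * p = q) : p = C a⁻¹ * q := by
  rw [← h, ← mul_assoc, ← C_mul, inv_mul_cancel₀ ha, C_1, one_mul]

/-- The coefficient of `P_{k+1}` in `(1 + t) P_k` for the Jacobi polynomials. -/
def jacobiUp (α β : ℝ) (k : ℕ) : ℝ :=
  2 * (k + α + β + 1) * (k + 1 + α) / ((2 * k + α + β + 1) * (2 * k + α + β + 2))

/-- The coefficient of `P_{k-1}` in `(1 + t) P_k` for the Jacobi polynomials. -/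
def jacobiDown (α β : ℝ) (k : ℕ) : ℝ :=
  2 * k * (k + β) / ((2 * k + α + β + 1) * (2 * k + α + β))

/-- The coefficient of `P_k` in `(1 + t) P_k` for the Jacobi polynomials. -/
def jacobiDiag (α β : ℝ) (k : ℕ) : ℝ :=
  2 * (k + α + β + 1) * (k + β + 1) / ((2 * k + α + β + 1) * (2 * k + α + β + 2)) +
    2 * k * (k + α) / ((2 * k + α + β + 1) * (2 * k + α + β))

/-- The three-term recurrence of the Jacobi polynomials. -/
lemma jacobi_recurrence {α β : ℝ} (hα : -1 < α) {k : ℕ} (hk : -1 < 2 * k + α + β)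
    (hk' : k = 0 ∨ 0 < 2 * k + α + β) :
    (X + 1) * jacobi α β k = C (jacobiUp α β k) * jacobi α β (k + 1) +
      C (jacobiDiag α β k) * jacobi α β k + C (jacobiDown α β k) * jacobi α β (k - 1) := by
  -- Write P_k through polynomials with second parameter β + 1, then multiply those by X + 1, which
  -- brings the parameter back to β and yields the indices k + 1, k, k - 1.
  have h2 := eq_C_inv_mul (by linarith) (jacobi_lower_right (α := α) β k)
  have h4 := eq_C_inv_mul (by linarith) (jacobi_raise_right hα β k)
  have d1 : 2 * (k : ℝ) + α + β + 1 ≠ 0 := by linarith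
  have d2 : 2 * (k : ℝ) + α + β + 2 ≠ 0 := by linarith
  rcases k with _ | k
  · have z : jacobiDown α β 0 = 0 := by simp [jacobiDown]
    rw [jacobi_zero] at h2 h4 ⊢
    rw [z]
    have c1 : C (jacobiUp α β 0) =
        C (2 * ((0 : ℕ) : ℝ) + α + β + 2)⁻¹ * C (2 * (((0 : ℕ) : ℝ) + 1 + α)) := by
      rw [← C_mul, jacobiUp]; congr 1; push_cast at d1 d2 ⊢; field_simp; ring
    have c2 : C (jacobiDiag α β 0) =
        C (2 * ((0 : ℕ) : ℝ) + α + β + 2)⁻¹ * C (2 * (((0 : ℕ) : ℝ) + β + 1)) := by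
      rw [← C_mul, jacobiDiag]; congr 1; push_cast at d1 d2 ⊢
      rw [mul_zero] at d1 d2 ⊢
      rw [zero_mul, zero_div, add_zero, inv_mul_eq_div, div_eq_div_iff (mul_ne_zero d1 d2) d2]
      ring
    rw [c1, c2]
    simp only [jacobi_zero] at h4
    rw [C_0]
    linear_combination h4
  · have h5 := eq_C_inv_mul (by push_cast at hk hk'; have := hk'.resolve_left (by simp); linarith) (jacobi_raise_right hα β k)
    simp only [Nat.add_sub_cancel] at h2 ⊢
    have hpos : 0 < 2 * ((k + 1 : ℕ) : ℝ) + α + β := by simpa using hk'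
    have d3 : 2 * (k : ℝ) + α + β + 2 ≠ 0 := by push_cast at hpos; linarith
    have d4 : 2 * ((k : ℝ) + 1) + α + β ≠ 0 := by push_cast at hpos; linarith
    push_cast at *
    have c1 : C (jacobiUp α β (k + 1)) = C (2 * ((k : ℝ) + 1) + α + β + 1)⁻¹ *
        C ((k : ℝ) + 1 + α + β + 1) * C (2 * ((k : ℝ) + 1) + α + β + 2)⁻¹ *
          C (2 * ((k : ℝ) + 1 + 1 + α)) := by
      simp only [← C_mul, jacobiUp]; congr 1; push_cast; field_simp
    have c2 : C (jacobiDiag α β (k + 1)) = C (2 * ((k : ℝ) + 1) + α + β + 1)⁻¹ *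
        C ((k : ℝ) + 1 + α + β + 1) * C (2 * ((k : ℝ) + 1) + α + β + 2)⁻¹ *
          C (2 * ((k : ℝ) + 1 + β + 1)) + C (2 * ((k : ℝ) + 1) + α + β + 1)⁻¹ *
          C ((k : ℝ) + 1) * C (2 * (k : ℝ) + α + β + 2)⁻¹ * C (2 * ((k : ℝ) + 1 + α)) := by
      simp only [← C_mul, ← C_add, jacobiDiag]; congr 1; push_cast
      have : 2 * (k : ℝ) + α + β + 2 = 2 * ((k : ℝ) + 1) + α + β := by ring
      rw [this]; field_simp
    have c3 : C (jacobiDown α β (k + 1)) = C (2 * ((k : ℝ) + 1) + α + β + 1)⁻¹ *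
          C ((k : ℝ) + 1) * C (2 * (k : ℝ) + α + β + 2)⁻¹ * C (2 * ((k : ℝ) + β + 1)) := by
      simp only [← C_mul, jacobiDown]; congr 1; push_cast
      have : 2 * (k : ℝ) + α + β + 2 = 2 * ((k : ℝ) + 1) + α + β := by ring
      rw [this]; field_simp; ring
    rw [c1, c2, c3]
    linear_combination (X + 1) * h2 + C (2 * ((k : ℝ) + 1) + α + β + 1)⁻¹ *
        C ((k : ℝ) + 1 + α + β + 1) * h4 + C (2 * ((k : ℝ) + 1) + α + β + 1)⁻¹ *
          C ((k : ℝ) + 1) * h5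

/-- The coefficient of `P_{k-1}` in `t P_k` for the ultraspherical polynomials `P_k`. -/
def gegDown (ν : ℝ) (k : ℕ) : ℝ := k / (2 * k + 2 * ν + 1)

/-- The three-term recurrence of the ultraspherical polynomials. -/
lemma ultraspherical_recurrence {ν : ℝ} (hν : -1 / 2 ≤ ν) (k : ℕ) :
    X * jacobi ν ν k = C (1 - gegDown ν k) * jacobi ν ν (k + 1) +
      C (gegDown ν k) * jacobi ν ν (k - 1) := by
  -- In dimension 2 one has ν = -1/2, and the denominators of `jacobi_recurrence` vanish at k = 0,
  -- so this case is treated directly. There `gegDown ν 0 = 0` holds also as 0 / 0.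
  rcases k with _ | k
  · have h4 := eq_C_inv_mul (by push_cast; linarith) (jacobi_raise_right (by linarith) ν 0 (α := ν))
    simp only [jacobi_zero] at h4 ⊢
    have c1 : C (2 * ((0 : ℕ) : ℝ) + ν + ν + 2)⁻¹ * C (2 * (((0 : ℕ) : ℝ) + 1 + ν)) =
        (1 : ℝ[X]) := by
      rw [← C_mul, ← C_1]; congr 1; push_cast
      have : 2 * 0 + ν + ν + 2 ≠ 0 := by linarith
      field_simp; ring
    have c2 : C (2 * ((0 : ℕ) : ℝ) + ν + ν + 2)⁻¹ * C (2 * (((0 : ℕ) : ℝ) + ν + 1)) =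
        (1 : ℝ[X]) := by
      rw [← c1]; congr 3; ring
    have z : gegDown ν 0 = 0 := by simp [gegDown]
    rw [z, sub_zero, C_0, C_1]
    linear_combination h4 + jacobi ν ν 1 * c1 + c2
  · have hk : (0 : ℝ) ≤ k := by positivity
    have h := jacobi_recurrence (α := ν) (β := ν) (k := k + 1) (by linarith)
      (by push_cast; linarith) (Or.inr (by push_cast; linarith))
    have d1 : 2 * ((k : ℝ) + 1) + ν + ν + 1 ≠ 0 := by linarith
    have d2 : 2 * ((k : ℝ) + 1) + ν + ν ≠ 0 := by linarith
    have d3 : 2 * ((k : ℝ) + 1) + ν + ν + 2 ≠ 0 := by linarith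
    have d4 : 2 * ((k : ℝ) + 1) + 2 * ν + 1 ≠ 0 := by linarith
    have c1 : jacobiUp ν ν (k + 1) = 1 - gegDown ν (k + 1) := by
      simp only [jacobiUp, gegDown]; push_cast
      rw [one_sub_div d4, div_eq_div_iff (mul_ne_zero d1 d3) d4]; ring
    -- The diagonal entry of multiplication by t + 1 is only the contribution of the 1:
    -- multiplication by t has no diagonal term when the parameters agree.
    have c2 : jacobiDiag ν ν (k + 1) = 1 := by
      simp only [jacobiDiag]; push_cast
      rw [div_add_div _ _ (mul_ne_zero d1 d3) (mul_ne_zero d1 d2), div_eq_one_iff_eq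
        (mul_ne_zero (mul_ne_zero d1 d3) (mul_ne_zero d1 d2))]
      ring
    have c3 : jacobiDown ν ν (k + 1) = gegDown ν (k + 1) := by
      simp only [jacobiDown, gegDown]; push_cast
      rw [div_eq_div_iff (mul_ne_zero d1 d2) d4]; ring
    rw [c1, c2, c3, C_1] at h
    linear_combination h

end

section

/-! ### The Christoffel-Darboux formula and its consequences -/

/-- The Christoffel-Darboux formula for sequences with a three-term recurrence. -/
lemma christoffel_darboux {K : Type*} [CommRing K] {u g d r p q : ℕ → K} {x y : K}
    (hr : ∀ i, r i * u i = r (i + 1) * d (i + 1)) (hd : d 0 = 0)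
    (hp : ∀ i, (x + 1) * p i = u i * p (i + 1) + g i * p i + d i * p (i - 1))
    (hq : ∀ i, (y + 1) * q i = u i * q (i + 1) + g i * q i + d i * q (i - 1)) (k : ℕ) :
    (x - y) * ∑ i ∈ Finset.range (k + 1), r i * p i * q i =
      r k * u k * (p (k + 1) * q k - p k * q (k + 1)) := by
  induction k with
  | zero =>
    have h1 := hp 0
    have h2 := hq 0
    rw [hd] at h1 h2
    simp only [zero_add, Finset.range_one, Finset.sum_singleton]
    linear_combination r 0 * q 0 * h1 - r 0 * p 0 * h2
  | succ k ih =>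
    rw [Finset.sum_range_succ, mul_add, ih]
    have h1 := hp (k + 1)
    have h2 := hq (k + 1)
    simp only [Nat.add_sub_cancel] at h1 h2
    -- The diagonal terms g cancel, and `hr` matches the new lower boundary term with the old upper
    -- one, so the sum telescopes.
    linear_combination r (k + 1) * q (k + 1) * h1 - r (k + 1) * p (k + 1) * h2 +
      (p (k + 1) * q k - p k * q (k + 1)) * hr k

lemma jacobiInvNormSq_pos {α β : ℝ} (hα : -1 < α) (hβ : -1 < β) (hσ : 0 ≤ α + β) (k : ℕ) :
    0 < jacobiInvNormSq α β k := by
  have hk : (0 : ℝ) ≤ k := by positivity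
  have h1 : 0 < (2 * k + α + β + 1) / (α + β + 1) := div_pos (by linarith) (by linarith)
  have h2 := ascPochhammer_pos k (α + 1) (by linarith)
  have h3 := ascPochhammer_pos k (α + β + 1) (by linarith)
  have h4 := ascPochhammer_pos k (β + 1) (by linarith)
  unfold jacobiInvNormSq
  positivity

lemma jacobiUp_pos {α β : ℝ} (hα : -1 < α) (hσ : 0 ≤ α + β) (k : ℕ) : 0 < jacobiUp α β k := by
  have hk : (0 : ℝ) ≤ k := by positivity
  unfold jacobiUp
  apply div_pos
  · exact mul_pos (by linarith) (by linarith)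
  · exact mul_pos (by linarith) (by linarith)

lemma jacobiDown_succ_pos {α β : ℝ} (hβ : -1 < β) (hσ : 0 ≤ α + β) (k : ℕ) :
    0 < jacobiDown α β (k + 1) := by
  have hk : (0 : ℝ) ≤ k := by positivity
  unfold jacobiDown
  push_cast
  apply div_pos
  · exact mul_pos (by linarith) (by linarith)
  · exact mul_pos (by linarith) (by linarith)

lemma jacobiDown_zero (α β : ℝ) : jacobiDown α β 0 = 0 := by simp [jacobiDown]

/-- This expresses that multiplication by t + 1 is symmetric for the Jacobi weight. Together with
positivity it is all that the argument uses about the norming constants. -/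
lemma jacobiInvNormSq_mul_up {α β : ℝ} (hβ : -1 < β) (hσ : 0 ≤ α + β) (k : ℕ) :
    jacobiInvNormSq α β k * jacobiUp α β k =
      jacobiInvNormSq α β (k + 1) * jacobiDown α β (k + 1) := by
  have hk : (0 : ℝ) ≤ k := by positivity
  have h4 := (ascPochhammer_pos k (β + 1) (by linarith)).ne'
  have d0 : α + β + 1 ≠ 0 := by linarith
  have d1 : 2 * (k : ℝ) + α + β + 1 ≠ 0 := by linarith
  have d2 : 2 * (k : ℝ) + α + β + 2 ≠ 0 := by linarith
  have d3 : 2 * (k : ℝ) + α + β + 3 ≠ 0 := by linarith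
  have d4 : β + 1 + k ≠ 0 := by linarith
  have e1 : 2 * ((k : ℝ) + 1) + α + β + 1 = 2 * k + α + β + 3 := by ring
  have e2 : 2 * ((k : ℝ) + 1) + α + β = 2 * k + α + β + 2 := by ring
  have e3 : (k : ℝ) + 1 + β = β + 1 + k := by ring
  have hf : (k.factorial : ℝ) ≠ 0 := by positivity
  have hk1 : (k : ℝ) + 1 ≠ 0 := by positivity
  unfold jacobiInvNormSq jacobiUp jacobiDown
  rw [Nat.factorial_succ, ascPochhammer_succ_eval, ascPochhammer_succ_eval,
    ascPochhammer_succ_eval]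
  push_cast
  rw [e1, e2, e3]
  field_simp
  ring

lemma jacobi_recurrence_aeval {K : Type*} [CommRing K] [Algebra ℝ K] {α β : ℝ} (hα : -1 < α)
    (hσ : 0 ≤ α + β) (z : K) (k : ℕ) :
    (z + 1) * aeval z (jacobi α β k) =
      algebraMap ℝ K (jacobiUp α β k) * aeval z (jacobi α β (k + 1)) +
      algebraMap ℝ K (jacobiDiag α β k) * aeval z (jacobi α β k) +
      algebraMap ℝ K (jacobiDown α β k) * aeval z (jacobi α β (k - 1)) := by
  have hk : (0 : ℝ) ≤ k := by positivity
  have h := congrArg (aeval z) (jacobi_recurrence (β := β) (k := k) hα (by linarith) (by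
    rcases k with _ | k
    · exact Or.inl rfl
    · refine Or.inr ?_
      push_cast at hk ⊢
      linarith))
  simpa only [map_add, map_mul, aeval_X, aeval_C, map_one] using h

/-- A general algebra is allowed because the formula is needed at real points, at a pair of
conjugate complex points, and in `ℝ[X]` with x = `X` and y a constant. -/
lemma jacobi_christoffel_darboux {K : Type*} [CommRing K] [Algebra ℝ K] {α β : ℝ} (hα : -1 < α)
    (hβ : -1 < β) (hσ : 0 ≤ α + β) (x y : K) (k : ℕ) :
    (x - y) * ∑ i ∈ Finset.range (k + 1), algebraMap ℝ K (jacobiInvNormSq α β i) *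
        aeval x (jacobi α β i) * aeval y (jacobi α β i) =
      algebraMap ℝ K (jacobiInvNormSq α β k) * algebraMap ℝ K (jacobiUp α β k) *
        (aeval x (jacobi α β (k + 1)) * aeval y (jacobi α β k) -
          aeval x (jacobi α β k) * aeval y (jacobi α β (k + 1))) :=
  christoffel_darboux (u := fun i => algebraMap ℝ K (jacobiUp α β i))
    (d := fun i => algebraMap ℝ K (jacobiDown α β i))
    (g := fun i => algebraMap ℝ K (jacobiDiag α β i))
    (r := fun i => algebraMap ℝ K (jacobiInvNormSq α β i))
    (fun i => by simp only [← map_mul, jacobiInvNormSq_mul_up hβ hσ])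
    (by simp [jacobiDown_zero]) (fun i => jacobi_recurrence_aeval hα hσ x i)
    (fun i => jacobi_recurrence_aeval hα hσ y i) k

/-- A real polynomial without nonreal zeros splits over `ℝ`. -/
lemma splits_of_forall_im_eq_zero {p : ℝ[X]} (h : ∀ z : ℂ, aeval z p = 0 → z.im = 0) :
    p.Splits := by
  rcases eq_or_ne p 0 with rfl | hp
  · simp
  refine Splits.of_splits_map (algebraMap ℝ ℂ) (IsAlgClosed.splits _) fun z hz => ?_
  rw [mem_roots_map hp] at hz
  have := h z hz
  exact ⟨z.re, by apply Complex.ext <;> simp [this]⟩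

/-- Real linear combinations of consecutive Jacobi polynomials have only real zeros. -/
lemma jacobi_pencil_splits {α β : ℝ} (hα : -1 < α) (hβ : -1 < β) (hσ : 0 ≤ α + β) (k : ℕ)
    {a b : ℝ} (hab : a ≠ 0 ∨ b ≠ 0) :
    (C a * jacobi α β (k + 1) + C b * jacobi α β k).Splits := by
  refine splits_of_forall_im_eq_zero fun z hz => ?_
  have hz' := congrArg (starRingEnd ℂ) hz
  have hconj : ∀ p : ℝ[X], (starRingEnd ℂ) (aeval z p) = aeval ((starRingEnd ℂ) z) p := by
    intro p
    exact (aeval_conj p z).symm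
  rw [hconj, map_zero] at hz'
  simp only [map_add, map_mul, aeval_C] at hz hz'
  -- At a zero z of the combination the vectors (P_{k+1}, P_k) at z and at its conjugate are
  -- annihilated by the same real (a, b), so the determinant vanishes. The formula then reads (z -
  -- z̄) ∑ r_i |P_i(z)|² = 0, and the term i = 0 of the sum is positive.
  have cd := jacobi_christoffel_darboux hα hβ hσ z ((starRingEnd ℂ) z) k
  have hdet : aeval z (jacobi α β (k + 1)) * aeval ((starRingEnd ℂ) z) (jacobi α β k) -
      aeval z (jacobi α β k) * aeval ((starRingEnd ℂ) z) (jacobi α β (k + 1)) = 0 := by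
    rcases hab with ha | hb
    · have ha' : algebraMap ℝ ℂ a ≠ 0 := by simpa using ha
      apply mul_left_cancel₀ ha'
      linear_combination aeval ((starRingEnd ℂ) z) (jacobi α β k) * hz -
        aeval z (jacobi α β k) * hz'
    · have hb' : algebraMap ℝ ℂ b ≠ 0 := by simpa using hb
      apply mul_left_cancel₀ hb'
      linear_combination aeval z (jacobi α β (k + 1)) * hz' -
        aeval ((starRingEnd ℂ) z) (jacobi α β (k + 1)) * hz
  rw [hdet, mul_zero] at cd
  rcases mul_eq_zero.mp cd with h | h
  · have := congrArg Complex.im h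
    simp at this
    linarith
  · exfalso
    have h' : ∑ i ∈ Finset.range (k + 1), jacobiInvNormSq α β i *
        Complex.normSq (aeval z (jacobi α β i)) = 0 := by
      have e : ((∑ i ∈ Finset.range (k + 1), jacobiInvNormSq α β i *
        Complex.normSq (aeval z (jacobi α β i)) : ℝ) : ℂ) = 0 := by
        rw [← h]
        push_cast
        refine Finset.sum_congr rfl fun i _ => ?_
        rw [← hconj, mul_assoc, Complex.mul_conj]
        simp
      exact_mod_cast e
    have hnn : ∀ i ∈ Finset.range (k + 1), 0 ≤ jacobiInvNormSq α β i *
        Complex.normSq (aeval z (jacobi α β i)) := fun i _ =>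
      mul_nonneg (jacobiInvNormSq_pos hα hβ hσ i).le (Complex.normSq_nonneg _)
    have h0 := (Finset.sum_eq_zero_iff_of_nonneg hnn).mp h' 0 (by simp)
    rw [jacobi_zero, map_one, map_one, mul_one] at h0
    exact (jacobiInvNormSq_pos hα hβ hσ 0).ne' h0

lemma jacobi_christoffel_darboux_real {α β : ℝ} (hα : -1 < α)
    (hβ : -1 < β) (hσ : 0 ≤ α + β) (x y : ℝ) (k : ℕ) :
    (x - y) * ∑ i ∈ Finset.range (k + 1), jacobiInvNormSq α β i *
        (jacobi α β i).eval x * (jacobi α β i).eval y =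
      jacobiInvNormSq α β k * jacobiUp α β k *
        ((jacobi α β (k + 1)).eval x * (jacobi α β k).eval y -
          (jacobi α β k).eval x * (jacobi α β (k + 1)).eval y) := by
  simpa using jacobi_christoffel_darboux hα hβ hσ x y k

lemma jacobi_recurrence_eval {α β : ℝ} (hα : -1 < α) (hσ : 0 ≤ α + β) (x : ℝ) (k : ℕ) :
    (x + 1) * (jacobi α β k).eval x = jacobiUp α β k * (jacobi α β (k + 1)).eval x +
      jacobiDiag α β k * (jacobi α β k).eval x + jacobiDown α β k * (jacobi α β (k - 1)).eval x := by
  simpa using jacobi_recurrence_aeval hα hσ x k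

/-- A polynomial that is `1` at `1` and is nonnegative on `[s, ∞)` but not positive there has a
largest zero in `[s, ∞)`. -/
lemma exists_largest_zero {p : ℝ[X]} (hp : 0 < p.eval 1) {s : ℝ}
    (hlc : ∀ t, 1 ≤ t → 0 < p.eval t) (hnot : ¬ ∀ t, s ≤ t → 0 < p.eval t) :
    ∃ x, s ≤ x ∧ p.eval x = 0 ∧ ∀ t, x < t → 0 < p.eval t := by
  push Not at hnot
  obtain ⟨t₀, ht₀, hpt₀⟩ := hnot
  have hp0 : p ≠ 0 := by rintro rfl; simp at hp
  have ht1 : t₀ < 1 := by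
    by_contra h
    exact absurd (hlc t₀ (not_lt.mp h)) (not_lt.mpr hpt₀)
  have hroot : ∀ t, t < 1 → p.eval t ≤ 0 → ∃ x ∈ Set.Icc t 1, p.eval x = 0 := by
    intro t ht hpt
    exact intermediate_value_Icc ht.le p.continuous.continuousOn ⟨hpt, hp.le⟩
  obtain ⟨x₀, hx₀, hpx₀⟩ := hroot t₀ ht1 hpt₀
  have hne : p.roots.toFinset.Nonempty := ⟨x₀, by simp [hp0, hpx₀]⟩
  refine ⟨p.roots.toFinset.max' hne, ?_, ?_, ?_⟩
  · exact ht₀.trans (hx₀.1.trans (Finset.le_max' _ _ (by simp [hp0, hpx₀])))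
  · have := Finset.max'_mem _ hne
    simpa [hp0] using this
  · intro t ht
    by_contra hc
    rcases lt_or_ge t 1 with h1 | h1
    · obtain ⟨x, hx, hpx⟩ := hroot t h1 (not_lt.mp hc)
      have := Finset.le_max' p.roots.toFinset x (by simp [hp0, hpx])
      linarith [hx.1]
    · exact hc (hlc t h1)

/-- In powers of (t - 1) / 2 all coefficients are nonnegative and the constant term is 1. -/
lemma jacobi_pos_of_one_le {α β : ℝ} (hα : -1 < α) (hσ : -1 ≤ α + β) (k : ℕ) {t : ℝ}
    (ht : 1 ≤ t) : 0 < (jacobi α β k).eval t := by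
  rw [jacobi, eval_finsetSum, Finset.sum_range_succ']
  simp only [eval_mul, eval_C, eval_pow, eval_sub, eval_X, eval_one]
  refine add_pos_of_nonneg_of_pos (Finset.sum_nonneg fun j hj => ?_) (by simp)
  have hjk : j + 1 ≤ k := by simpa using Finset.mem_range.mp hj
  have hk : (1 : ℝ) ≤ k := by exact_mod_cast (by omega : 1 ≤ k)
  have h1 := ascPochhammer_pos (j + 1) ((k : ℝ) + α + β + 1) (by linarith)
  have h2 := ascPochhammer_pos (j + 1) (α + 1) (by linarith)
  have h3 : 0 ≤ 1 / 2 * (t - 1) := by linarith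
  positivity

/-- If `P_{k+1}` is nonnegative to the right of `s`, then the previous polynomials are positive
there. -/
lemma jacobi_pos_of_succ_nonneg {α β : ℝ} (hα : -1 < α) (hβ : -1 < β) (hσ : 0 ≤ α + β) (k : ℕ) :
    ∀ {s : ℝ}, s < 1 → (∀ t, s ≤ t → 0 ≤ (jacobi α β (k + 1)).eval t) →
      ∀ t, s ≤ t → 0 < (jacobi α β k).eval t := by
  induction k with
  | zero => intro s _ _ t _; simp [jacobi_zero]
  | succ k ih =>
    intro s hs h
    by_contra hnot
    -- At the largest zero x of P_{k+1} the recurrence reads 0 = u P_{k+2}(x) + d P_k(x) with u, d >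
    -- 0. The first term is nonnegative by assumption and P_k(x) > 0 by induction applied on [x, ∞),
    -- a contradiction.
    obtain ⟨x, hsx, hx, hpos⟩ := exists_largest_zero (by simp [jacobi_eval_one])
      (fun t ht => jacobi_pos_of_one_le hα (by linarith) _ ht) hnot
    have hx1 : x < 1 := by
      by_contra hc
      exact (jacobi_pos_of_one_le hα (by linarith) (k + 1) (not_lt.mp hc)).ne' hx
    have h1 := ih hx1 (fun t ht => by
      rcases ht.eq_or_lt with rfl | hlt
      · exact hx.ge
      · exact (hpos t hlt).le) x le_rfl
    have h2 := jacobi_recurrence_eval hα hσ x (k + 1)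
    rw [hx, Nat.add_sub_cancel] at h2
    have h3 := mul_nonneg (jacobiUp_pos hα hσ (k + 1)).le (h x hsx)
    have h4 := mul_pos (jacobiDown_succ_pos hβ hσ k) h1
    linarith

lemma jacobi_pos_of_le {α β : ℝ} (hα : -1 < α) (hβ : -1 < β) (hσ : 0 ≤ α + β) {s : ℝ}
    (hs : s < 1) {k j : ℕ} (hjk : j ≤ k) (h : ∀ t, s ≤ t → 0 < (jacobi α β k).eval t) :
    ∀ t, s ≤ t → 0 < (jacobi α β j).eval t := by
  induction k with
  | zero => obtain rfl : j = 0 := by omega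
            exact h
  | succ k ih =>
    rcases hjk.eq_or_lt with rfl | hlt
    · exact h
    · exact ih (by omega) (jacobi_pos_of_succ_nonneg hα hβ hσ k hs fun t ht => (h t ht).le)

/-- If `P_k` is positive on `[s, ∞)` and `s` is at most the largest zero of `P_{k+1}`, then
`P_{k+1}(s) ≤ 0`. -/
lemma jacobi_succ_nonpos {α β : ℝ} (hα : -1 < α) (hβ : -1 < β) (hσ : 0 ≤ α + β) {s : ℝ}
    (hs : s < 1) {k : ℕ} (h : ∀ t, s ≤ t → 0 < (jacobi α β k).eval t)
    (hle : s ≤ sSup {t : ℝ | (jacobi α β (k + 1)).IsRoot t}) :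
    (jacobi α β (k + 1)).eval s ≤ 0 := by
  set p := jacobi α β (k + 1) with hp
  have hdeg : p.degree = (k + 1 : ℕ) := jacobi_degree hα (by linarith) (k + 1)
  have hp0 : p ≠ 0 := by
    intro h0
    have := jacobi_eval_one α β (k + 1)
    rw [← hp, h0] at this
    simp at this
  have hfin : {t : ℝ | p.IsRoot t} = (p.roots.toFinset : Set ℝ) := by
    ext t; simp [hp0]
  have hsplit : p.Splits := by
    have := jacobi_pencil_splits hα hβ hσ k (a := 1) (b := 0) (Or.inl one_ne_zero)
    simpa using this
  have hne : {t : ℝ | p.IsRoot t}.Nonempty := by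
    obtain ⟨x, hx⟩ := hsplit.exists_eval_eq_zero (by rw [hdeg]; exact_mod_cast Nat.succ_ne_zero k)
    exact ⟨x, hx⟩
  have hmem : sSup {t : ℝ | p.IsRoot t} ∈ {t : ℝ | p.IsRoot t} := by
    refine hne.csSup_mem ?_
    rw [hfin]; exact Finset.finite_toSet _
  set t := sSup {t : ℝ | p.IsRoot t} with ht
  have hroot : p.eval t = 0 := hmem
  rcases hle.eq_or_lt with he | hlt
  · rw [he, hroot]
  -- With t the largest zero of P_{k+1}, the kernel sum at (t, s) is positive, and the right side
  -- reduces to a positive multiple of -P_k(t) P_{k+1}(s).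
  · have cd := jacobi_christoffel_darboux_real hα hβ hσ t s k
    rw [← hp, hroot] at cd
    have hsum : 0 < ∑ i ∈ Finset.range (k + 1), jacobiInvNormSq α β i *
        (jacobi α β i).eval t * (jacobi α β i).eval s := by
      refine Finset.sum_pos (fun i hi => ?_) (by simp)
      have hi' := jacobi_pos_of_le hα hβ hσ hs (by simpa [Nat.lt_succ_iff] using hi) h
      exact mul_pos (mul_pos (jacobiInvNormSq_pos hα hβ hσ i) (hi' t hlt.le)) (hi' s le_rfl)
    have h1 := mul_pos (sub_pos.mpr hlt) hsum
    rw [cd] at h1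
    have h2 := mul_pos (jacobiInvNormSq_pos hα hβ hσ k) (jacobiUp_pos hα hσ k)
    have h3 := (pos_iff_pos_of_mul_pos h1).mp h2
    have h4 := h t hlt.le
    by_contra hc
    have := mul_pos h4 (not_le.mp hc)
    linarith

end

section

/-! ### Signs of the adjacent polynomials -/

lemma nonneg_of_pos_right {p : ℝ[X]} {s : ℝ} (h : ∀ t, s < t → 0 < p.eval t) :
    ∀ t, s ≤ t → 0 ≤ p.eval t := by
  intro t ht
  refine ge_of_tendsto (p.continuous.continuousAt.tendsto.mono_left nhdsWithin_le_nhds :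
    Filter.Tendsto (fun x => p.eval x) (nhdsWithin t (Set.Ioi t)) (nhds (p.eval t))) ?_
  filter_upwards [self_mem_nhdsWithin] with x hx
  exact (h x (lt_of_le_of_lt ht hx)).le

lemma jacobi_lower_right_eval (α β : ℝ) (k : ℕ) (t : ℝ) :
    (2 * k + α + β + 1) * (jacobi α β k).eval t =
      (k + α + β + 1) * (jacobi α (β + 1) k).eval t +
        k * (jacobi α (β + 1) (k - 1)).eval t := by
  have := congrArg (eval t) (jacobi_lower_right (α := α) β k)
  simpa only [eval_add, eval_mul, eval_C] using this

lemma jacobi_lower_left_eval {α : ℝ} (hα : -1 < α) (β : ℝ) (k : ℕ) (t : ℝ) :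
    (2 * k + α + β + 1) * (α + 1) * (jacobi α β k).eval t =
      (k + α + β + 1) * (k + α + 1) * (jacobi (α + 1) β k).eval t -
        (k + β) * k * (jacobi (α + 1) β (k - 1)).eval t := by
  have := congrArg (eval t) (jacobi_lower_left hα β k)
  simpa only [eval_sub, eval_mul, eval_C] using this

lemma jacobi_raise_right_eval {α : ℝ} (hα : -1 < α) (β : ℝ) (k : ℕ) (t : ℝ) :
    (2 * k + α + β + 2) * ((t + 1) * (jacobi α (β + 1) k).eval t) =
      2 * (k + 1 + α) * (jacobi α β (k + 1)).eval t +
        2 * (k + β + 1) * (jacobi α β k).eval t := by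
  have := congrArg (eval t) (jacobi_raise_right hα β k)
  simpa only [eval_add, eval_mul, eval_C, eval_X, eval_one] using this

lemma jacobi_raise_left_eval {α : ℝ} (hα : -1 < α) (β : ℝ) (k : ℕ) (t : ℝ) :
    (2 * k + α + β + 2) * ((1 - t) * (jacobi (α + 1) β k).eval t) =
      2 * (α + 1) * ((jacobi α β k).eval t - (jacobi α β (k + 1)).eval t) := by
  have := congrArg (eval t) (jacobi_raise_left hα β k)
  simpa only [eval_sub, eval_mul, eval_C, eval_X, eval_one] using this

variable {ν : ℝ}

lemma gegDown_lt_one (hν : -1 / 2 ≤ ν) (k : ℕ) : gegDown ν k < 1 := by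
  unfold gegDown
  rcases k with _ | k
  · simp
  · have hk : (0 : ℝ) ≤ k := by positivity
    push_cast
    rw [div_lt_one (by linarith)]
    linarith

lemma ultraspherical_recurrence_eval (hν : -1 / 2 ≤ ν) (k : ℕ) (t : ℝ) :
    t * (jacobi ν ν k).eval t = (1 - gegDown ν k) * (jacobi ν ν (k + 1)).eval t +
      gegDown ν k * (jacobi ν ν (k - 1)).eval t := by
  have := congrArg (eval t) (ultraspherical_recurrence hν k)
  simpa only [eval_add, eval_mul, eval_C, eval_X] using this

/-- The recurrence for multiplication by t has no diagonal term, so it propagates the parity from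
P_0 = 1. -/
lemma ultraspherical_eval_neg (hν : -1 / 2 ≤ ν) (k : ℕ) (t : ℝ) :
    (jacobi ν ν k).eval (-t) = (-1) ^ k * (jacobi ν ν k).eval t := by
  induction k using Nat.strong_induction_on with
  | _ k ih =>
    rcases k with _ | k
    · simp [jacobi_zero]
    have h1 := ultraspherical_recurrence_eval hν k t
    have h2 := ultraspherical_recurrence_eval hν k (-t)
    have h0 := gegDown_lt_one hν k
    apply mul_left_cancel₀ (sub_pos.mpr h0).ne'
    rw [ih k (by omega)] at h2
    rcases k with _ | k
    · have z : gegDown ν 0 = 0 := by simp [gegDown]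
      rw [z] at h1 h2 ⊢
      simp only [zero_add, pow_zero, pow_one] at *
      linear_combination -h1 - h2
    · rw [Nat.add_sub_cancel] at h1 h2
      rw [ih k (by omega)] at h2
      rw [pow_succ] at h2
      rw [pow_succ, pow_succ]
      linear_combination (-1) ^ k * h1 - h2

lemma jacobi_succ_succ_sign (hν : -1 / 2 ≤ ν) (k : ℕ) {t : ℝ} (ht : t ≤ -1) :
    0 < (-1) ^ k * (jacobi (ν + 1) (ν + 1) k).eval t := by
  rw [← ultraspherical_eval_neg (by linarith)]
  exact jacobi_pos_of_one_le (by linarith) (by linarith) k (by linarith)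

/-- By `jacobi_raise_right`, a positive multiple of P_{k+1}^{1,0} equals a positive multiple of (t +
1) P_k^{1,1} minus one of P_k^{1,0}; for t ≤ -1 both contributions have the sign (-1)^{k+1} or
vanish, the second being nonzero. -/
lemma jacobi_succ_self_sign (hν : -1 / 2 ≤ ν) (k : ℕ) {t : ℝ} (ht : t ≤ -1) :
    0 < (-1) ^ k * (jacobi (ν + 1) ν k).eval t := by
  induction k with
  | zero => simp [jacobi_zero]
  | succ k ih =>
    have hk : (0 : ℝ) ≤ k := by positivity
    have h1 := jacobi_raise_right_eval (α := ν + 1) (by linarith) ν k t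
    have h2 := jacobi_succ_succ_sign hν k ht
    have h3 : 0 ≤ (2 * (k : ℝ) + (ν + 1) + ν + 2) * (-t - 1) :=
      mul_nonneg (by linarith) (by linarith)
    have h4 : 0 < 2 * ((k : ℝ) + ν + 1) := by linarith
    have h5 : 0 < 2 * ((k : ℝ) + 1 + (ν + 1)) := by linarith
    have h6 := mul_nonneg h3 h2.le
    have h7 := mul_pos h4 ih
    refine pos_of_mul_pos_right (a := 2 * ((k : ℝ) + 1 + (ν + 1))) ?_ h5.le
    have h8 : 2 * ((k : ℝ) + 1 + (ν + 1)) * ((-1) ^ (k + 1) * (jacobi (ν + 1) ν (k + 1)).eval t) =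
        (2 * (k : ℝ) + (ν + 1) + ν + 2) * (-t - 1) *
          ((-1) ^ k * (jacobi (ν + 1) (ν + 1) k).eval t) +
        2 * ((k : ℝ) + ν + 1) * ((-1) ^ k * (jacobi (ν + 1) ν k).eval t) := by
      rw [pow_succ]
      linear_combination (-1) ^ k * h1
    rw [h8]
    linarith

/-- P_k^{1,0} is a positive combination of P_k^{1,1} and P_{k-1}^{1,1}, and the latter is positive
by `jacobi_pos_of_succ_nonneg`. This handles the left end of the Levenshtein interval when ε = 0. -/
lemma jacobi_succ_self_pos (hν : -1 / 2 ≤ ν) {s : ℝ} (hs : s < 1) (k : ℕ)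
    (h : ∀ t, s < t → 0 < (jacobi (ν + 1) (ν + 1) k).eval t) :
    ∀ t, s ≤ t → 0 < (jacobi (ν + 1) ν k).eval t := by
  intro t ht
  rcases k with _ | k
  · simp [jacobi_zero]
  have hk : (0 : ℝ) ≤ k := by positivity
  have h0 := nonneg_of_pos_right h
  have h1 := jacobi_pos_of_succ_nonneg (by linarith) (by linarith) (by linarith) k hs h0 t ht
  have h2 := jacobi_lower_right_eval (ν + 1) ν (k + 1) t
  rw [Nat.add_sub_cancel] at h2
  push_cast at h2
  refine pos_of_mul_pos_right (a := 2 * ((k : ℝ) + 1) + (ν + 1) + ν + 1) ?_ (by linarith)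
  rw [h2]
  exact add_pos_of_nonneg_of_pos (mul_nonneg (by linarith) (h0 t ht)) (mul_pos (by linarith) h1)

/-- (t + 1) P_k^{1,1} is a positive combination of P_{k+1}^{1,0} and P_k^{1,0}, hence positive on
[s, ∞); since it vanishes at t = -1, this also forces s > -1. This handles the left end when ε = 1.
-/
lemma jacobi_succ_succ_pos (hν : -1 / 2 ≤ ν) {s : ℝ} (hs : s < 1) (hs' : -1 ≤ s) (k : ℕ)
    (h : ∀ t, s < t → 0 < (jacobi (ν + 1) ν (k + 1)).eval t) :
    -1 < s ∧ ∀ t, s ≤ t → 0 < (jacobi (ν + 1) (ν + 1) k).eval t := by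
  have h0 := nonneg_of_pos_right h
  have hk : (0 : ℝ) ≤ k := by positivity
  have key : ∀ t, s ≤ t → 0 < (t + 1) * (jacobi (ν + 1) (ν + 1) k).eval t := by
    intro t ht
    have h1 := jacobi_pos_of_succ_nonneg (by linarith) (by linarith) (by linarith) k hs h0 t ht
    have h2 := jacobi_raise_right_eval (α := ν + 1) (by linarith) ν k t
    refine pos_of_mul_pos_right (a := 2 * (k : ℝ) + (ν + 1) + ν + 2) ?_ (by linarith)
    rw [h2]
    exact add_pos_of_nonneg_of_pos (mul_nonneg (by linarith) (h0 t ht))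
      (mul_pos (by linarith) h1)
  have hs1 : -1 < s := by
    rcases hs'.eq_or_lt with rfl | h1
    · have := key (-1) le_rfl
      simp at this
    · exact h1
  exact ⟨hs1, fun t ht => pos_of_mul_pos_right (key t ht) (by linarith)⟩

/-- If the kernel vanishes at (t, s), then Christoffel-Darboux makes (P_{k+1}, P_k) at t and at s
proportional, so u(t) P_k(s) = P_k(t) u(s) for every combination u = c P_{k+1} + d P_k. The sign
hypotheses give the two sides opposite signs, so both u(s) and u(t) would be zero. The combination
is free, to be chosen with known signs. -/
lemma jacobi_kernel_ne_zero {α β : ℝ} (hα : -1 < α) (hβ : -1 < β) (hσ : 0 ≤ α + β) {k : ℕ}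
    {s t : ℝ} {c d : ℝ} (hPs : 0 < (jacobi α β k).eval s)
    (hPt : 0 < (-1) ^ k * (jacobi α β k).eval t)
    (hus : 0 ≤ c * (jacobi α β (k + 1)).eval s + d * (jacobi α β k).eval s)
    (hut : (-1) ^ k * (c * (jacobi α β (k + 1)).eval t + d * (jacobi α β k).eval t) ≤ 0)
    (hne : c * (jacobi α β (k + 1)).eval s + d * (jacobi α β k).eval s ≠ 0 ∨
      c * (jacobi α β (k + 1)).eval t + d * (jacobi α β k).eval t ≠ 0) :
    ∑ i ∈ Finset.range (k + 1), jacobiInvNormSq α β i *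
        (jacobi α β i).eval t * (jacobi α β i).eval s ≠ 0 := by
  intro h0
  have cd := jacobi_christoffel_darboux_real hα hβ hσ t s k
  rw [h0, mul_zero] at cd
  have h1 := mul_pos (jacobiInvNormSq_pos hα hβ hσ k) (jacobiUp_pos hα hσ k)
  have h2 := (mul_eq_zero.mp cd.symm).resolve_left h1.ne'
  set us := c * (jacobi α β (k + 1)).eval s + d * (jacobi α β k).eval s with hus_def
  set ut := c * (jacobi α β (k + 1)).eval t + d * (jacobi α β k).eval t with hut_def
  have h3 : (-1) ^ k * ut * (jacobi α β k).eval s = (-1) ^ k * (jacobi α β k).eval t * us := by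
    rw [hus_def, hut_def]
    linear_combination (-1) ^ k * c * h2
  have h4 : (-1) ^ k * (jacobi α β k).eval t * us = 0 :=
    le_antisymm (h3 ▸ mul_nonpos_of_nonpos_of_nonneg hut hPs.le) (mul_nonneg hPt.le hus)
  have h5 : us = 0 := (mul_eq_zero.mp h4).resolve_left hPt.ne'
  rw [h4] at h3
  have h6 : ut = 0 := by
    have := (mul_eq_zero.mp h3).resolve_right hPs.ne'
    exact (mul_eq_zero.mp this).resolve_left (pow_ne_zero _ (by norm_num))
  exact hne.elim (fun h => h h5) (fun h => h h6)

/-! ### The adjacent polynomials on the Levenshtein interval -/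

/-- The common parameter `(n - 3) / 2` of the Gegenbauer polynomials in dimension `n`. -/
def gegParam (n : ℕ) : ℝ := ((n : ℝ) - 3) / 2

lemma gegParam_ge {n : ℕ} (hn : 2 ≤ n) : -1 / 2 ≤ gegParam n := by
  have : (2 : ℝ) ≤ n := by exact_mod_cast hn
  unfold gegParam; linarith

lemma adjacent_eq (n a b k : ℕ) :
    adjacent n a b k = jacobi (gegParam n + a) (gegParam n + b) k := by
  rw [adjacent, gegParam, add_comm, add_comm (b : ℝ)]

lemma gegenbauer_eq (n k : ℕ) : gegenbauer n k = jacobi (gegParam n) (gegParam n) k := by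
  simp [gegenbauer, adjacent_eq]

lemma le_largestZero {n a b k : ℕ} (hn : 2 ≤ n) (hk : k ≠ 0) {t : ℝ}
    (ht : (adjacent n a b k).eval t = 0) : t ≤ largestZero n a b k := by
  have hν := gegParam_ge hn
  have hp0 : adjacent n a b k ≠ 0 := by
    intro h0
    have := jacobi_eval_one (gegParam n + a) (gegParam n + b) k
    rw [← adjacent_eq, h0] at this
    simp at this
  rw [largestZero, if_neg hk]
  refine le_csSup ?_ ht
  have hfin : {t : ℝ | (adjacent n a b k).IsRoot t} = ((adjacent n a b k).roots.toFinset : Set ℝ) := by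
    ext t; simp [hp0]
  rw [hfin]
  exact (Finset.finite_toSet _).bddAbove

lemma adjacent_pos_of_largestZero_lt {n a b k : ℕ} (hn : 2 ≤ n) {s : ℝ}
    (hs : largestZero n a b k ≤ s) :
    ∀ t, s < t → 0 < (adjacent n a b k).eval t := by
  intro t ht
  rcases eq_or_ne k 0 with rfl | hk
  · simp [adjacent_eq, jacobi_zero]
  have hν := gegParam_ge hn
  have ha : (0 : ℝ) ≤ a := by positivity
  have hb : (0 : ℝ) ≤ b := by positivity
  have hpos : ∀ x, 1 ≤ x → 0 < (adjacent n a b k).eval x := fun x hx => by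
    rw [adjacent_eq]
    exact jacobi_pos_of_one_le (by linarith) (by linarith) k hx
  by_contra hc
  rcases le_or_gt 1 t with h1 | h1
  · exact hc (hpos t h1)
  obtain ⟨x, hx, hpx⟩ := intermediate_value_Icc h1.le
    (adjacent n a b k).continuous.continuousOn ⟨not_lt.mp hc, (hpos 1 le_rfl).le⟩
  have := le_largestZero hn hk hpx
  linarith [hx.1]

lemma adjacent_one_sign {n : ℕ} (hn : 2 ≤ n) {ε : ℕ} (hε : ε ≤ 1) (k : ℕ) {t : ℝ} (ht : t ≤ -1) :
    0 < (-1) ^ k * (adjacent n 1 ε k).eval t := by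
  have hν := gegParam_ge hn
  rw [adjacent_eq]
  interval_cases ε
  · simpa using jacobi_succ_self_sign hν k ht
  · simpa using jacobi_succ_succ_sign hν k ht

/-- The left endpoint is a zero of a polynomial from the other adjacent family; the contiguous
relations transfer positivity to the family that defines the kernel. Here k stands for `halfIdx m -
1`. -/
lemma adjacent_pos_of_mem {n : ℕ} (hn : 2 ≤ n) {ε : ℕ} (hε : ε ≤ 1) {k : ℕ} {s : ℝ}
    (hs : s ∈ Set.Ico (-1 : ℝ) 1) (hl : largestZero n 1 (1 - ε) (k + ε) ≤ s) :
    (∀ t, s ≤ t → 0 < (adjacent n 1 ε k).eval t) ∧ (ε = 1 → -1 < s) := by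
  have hν := gegParam_ge hn
  have h := adjacent_pos_of_largestZero_lt hn hl
  interval_cases ε
  · simp only [adjacent_eq, Nat.sub_zero, Nat.cast_one, Nat.cast_zero, add_zero] at h ⊢
    exact ⟨jacobi_succ_self_pos hν hs.2 k h, by simp⟩
  · simp only [adjacent_eq, Nat.sub_self, Nat.cast_one, Nat.cast_zero, add_zero] at h ⊢
    have := jacobi_succ_succ_pos hν hs.2 hs.1 k h
    exact ⟨this.2, fun _ => this.1⟩

lemma adjacent_succ_nonpos {n : ℕ} (hn : 2 ≤ n) {ε : ℕ} {k : ℕ} {s : ℝ}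
    (hs : s < 1) (hpos : ∀ t, s ≤ t → 0 < (adjacent n 1 ε k).eval t)
    (hu : s ≤ largestZero n 1 ε (k + 1)) : (adjacent n 1 ε (k + 1)).eval s ≤ 0 := by
  have hν := gegParam_ge hn
  have hb : (0 : ℝ) ≤ ε := by positivity
  rw [largestZero, if_neg (by omega)] at hu
  simp only [adjacent_eq] at hpos hu ⊢
  push_cast at *
  exact jacobi_succ_nonpos (by linarith) (by linarith) (by linarith) hs hpos hu

end

section

/-! ### The zeros of the Levenshtein polynomial -/

lemma levenshteinKernel_eval (n ε k : ℕ) (s t : ℝ) :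
    (levenshteinKernel n ε k s).eval t = ∑ i ∈ Finset.range k,
      jacobiInvNormSq (gegParam n + 1) (gegParam n + ε) i *
        (adjacent n 1 ε i).eval t * (adjacent n 1 ε i).eval s := by
  rw [levenshteinKernel, eval_finsetSum]
  refine Finset.sum_congr rfl fun i _ => ?_
  rw [eval_mul, eval_C, gegParam, add_comm _ (1 : ℝ), add_comm _ (ε : ℝ)]
  ring

/-- The factor in the Christoffel-Darboux formula for `adjacent n 1 ε`. -/
def kernelFactor (n ε k : ℕ) : ℝ :=
  jacobiInvNormSq (gegParam n + 1) (gegParam n + ε) k *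
    jacobiUp (gegParam n + 1) (gegParam n + ε) k

variable {n ε k : ℕ} {s : ℝ}

lemma adjacentInvNormSq_pos (hn : 2 ≤ n) (ε i : ℕ) :
    0 < jacobiInvNormSq (gegParam n + 1) (gegParam n + ε) i := by
  have hν := gegParam_ge hn
  have hb : (0 : ℝ) ≤ ε := by positivity
  exact jacobiInvNormSq_pos (by linarith) (by linarith) (by linarith) i

lemma kernelFactor_pos (hn : 2 ≤ n) (ε k : ℕ) : 0 < kernelFactor n ε k := by
  have hν := gegParam_ge hn
  have hb : (0 : ℝ) ≤ ε := by positivity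
  exact mul_pos (adjacentInvNormSq_pos hn ε k) (jacobiUp_pos (by linarith) (by linarith) k)

/-- The Christoffel-Darboux formula for the Levenshtein kernel. -/
lemma X_sub_C_mul_levenshteinKernel (hn : 2 ≤ n) (ε k : ℕ) (s : ℝ) :
    (X - C s) * levenshteinKernel n ε (k + 1) s = C (kernelFactor n ε k) *
      (C ((adjacent n 1 ε k).eval s) * adjacent n 1 ε (k + 1) -
        C ((adjacent n 1 ε (k + 1)).eval s) * adjacent n 1 ε k) := by
  have hν := gegParam_ge hn
  have hb : (0 : ℝ) ≤ ε := by positivity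
  -- The general formula is applied in the ring `ℝ[X]`, with second point the constant polynomial s.
  have h := jacobi_christoffel_darboux (α := gegParam n + 1) (β := gegParam n + ε)
    (by linarith) (by linarith) (by linarith) (X : ℝ[X]) (C s) k
  have e : ∀ p : ℝ[X], aeval (C s) p = C (p.eval s) := fun p => by
    rw [aeval_def, algebraMap_eq, eval₂_at_apply]
  simp only [aeval_X_left_apply, algebraMap_eq, e] at h
  have hT : levenshteinKernel n ε (k + 1) s = ∑ i ∈ Finset.range (k + 1),
      C (jacobiInvNormSq (gegParam n + 1) (gegParam n + ε) i) *
        jacobi (gegParam n + 1) (gegParam n + ε) i *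
          C ((jacobi (gegParam n + 1) (gegParam n + ε) i).eval s) := by
    refine Finset.sum_congr rfl fun i _ => ?_
    rw [adjacent_eq, gegParam, add_comm _ (1 : ℝ), add_comm _ (ε : ℝ), C_mul, Nat.cast_one]
    simp only [add_comm]
    ring
  rw [hT, h, kernelFactor, C_mul]
  simp only [adjacent_eq, Nat.cast_one]
  ring

/-- (X - s) T is a real combination of consecutive Jacobi polynomials, hence splits, and T is a
divisor of it. -/
lemma levenshteinKernel_splits (hn : 2 ≤ n) (hpos : 0 < (adjacent n 1 ε k).eval s) :
    (levenshteinKernel n ε (k + 1) s).Splits := by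
  have hν := gegParam_ge hn
  have hb : (0 : ℝ) ≤ ε := by positivity
  have h := jacobi_pencil_splits (α := gegParam n + 1) (β := gegParam n + ε)
    (by linarith) (by linarith) (by linarith) k
    (a := kernelFactor n ε k * (adjacent n 1 ε k).eval s)
    (b := - (kernelFactor n ε k * (adjacent n 1 ε (k + 1)).eval s))
    (Or.inl (mul_pos (kernelFactor_pos hn ε k) hpos).ne')
  have e : C (kernelFactor n ε k * (adjacent n 1 ε k).eval s) *
      jacobi (gegParam n + 1) (gegParam n + ε) (k + 1) +
      C (- (kernelFactor n ε k * (adjacent n 1 ε (k + 1)).eval s)) *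
        jacobi (gegParam n + 1) (gegParam n + ε) k =
      (X - C s) * levenshteinKernel n ε (k + 1) s := by
    rw [X_sub_C_mul_levenshteinKernel hn]
    simp only [C_neg, C_mul, adjacent_eq, Nat.cast_one]
    ring
  rw [e] at h
  have hT : levenshteinKernel n ε (k + 1) s ≠ 0 := by
    intro h0
    have h1 := levenshteinKernel_eval n ε (k + 1) s s
    rw [h0, eval_zero] at h1
    have h2 : 0 < ∑ i ∈ Finset.range (k + 1),
      jacobiInvNormSq (gegParam n + 1) (gegParam n + ε) i *
        (adjacent n 1 ε i).eval s * (adjacent n 1 ε i).eval s := by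
      refine Finset.sum_pos' (fun i _ => ?_) ⟨k, by simp, ?_⟩
      · rw [mul_assoc]
        exact mul_nonneg (adjacentInvNormSq_pos hn ε i).le (mul_self_nonneg _)
      · have := adjacentInvNormSq_pos hn ε k
        positivity
    linarith
  exact h.of_dvd (mul_ne_zero (X_sub_C_ne_zero s) hT) (dvd_mul_left _ _)

lemma adjacent_degree (hn : 2 ≤ n) (a b i : ℕ) : (adjacent n a b i).degree = i := by
  have hν := gegParam_ge hn
  have ha : (0 : ℝ) ≤ a := by positivity
  have hb : (0 : ℝ) ≤ b := by positivity
  rw [adjacent_eq]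
  exact jacobi_degree (by linarith) (by linarith) i

lemma levenshteinKernel_degree (hn : 2 ≤ n) (hpos : 0 < (adjacent n 1 ε k).eval s) :
    (levenshteinKernel n ε (k + 1) s).degree = k := by
  have hr : jacobiInvNormSq (1 + ((n : ℝ) - 3) / 2) (ε + ((n : ℝ) - 3) / 2) k *
      (adjacent n 1 ε k).eval s ≠ 0 := by
    have := adjacentInvNormSq_pos hn ε k
    rw [gegParam, add_comm _ (1 : ℝ), add_comm _ (ε : ℝ)] at this
    exact (mul_pos this hpos).ne'
  rw [levenshteinKernel, Finset.sum_range_succ, degree_add_eq_right_of_degree_lt] <;>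
    rw [degree_C_mul hr, adjacent_degree hn]
  refine lt_of_le_of_lt (degree_sum_le _ _) ?_
  rw [Finset.sup_lt_iff (WithBot.bot_lt_coe _)]
  intro j hj
  rw [← smul_eq_C_mul]
  refine lt_of_le_of_lt (degree_smul_le _ _) ?_
  rw [adjacent_degree hn]
  exact_mod_cast Finset.mem_range.mp hj

lemma adjacent_pos_of_le (hn : 2 ≤ n) (hs : s < 1)
    (hpos : ∀ t, s ≤ t → 0 < (adjacent n 1 ε k).eval t) {i : ℕ} (hi : i ≤ k) :
    ∀ t, s ≤ t → 0 < (adjacent n 1 ε i).eval t := by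
  have hν := gegParam_ge hn
  have hb : (0 : ℝ) ≤ ε := by positivity
  simp only [adjacent_eq, Nat.cast_one] at hpos ⊢
  exact jacobi_pos_of_le (by linarith) (by linarith) (by linarith) hs hi hpos

lemma levenshteinKernel_pos (hn : 2 ≤ n) (hs : s < 1)
    (hpos : ∀ t, s ≤ t → 0 < (adjacent n 1 ε k).eval t) {t : ℝ} (ht : s ≤ t) :
    0 < (levenshteinKernel n ε (k + 1) s).eval t := by
  rw [levenshteinKernel_eval]
  refine Finset.sum_pos (fun i hi => ?_) (by simp)
  have h := adjacent_pos_of_le hn hs hpos (Nat.lt_succ_iff.mp (Finset.mem_range.mp hi))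
  exact mul_pos (mul_pos (adjacentInvNormSq_pos hn ε i) (h t ht)) (h s le_rfl)

/-- The zeros of the Levenshtein kernel lie in `[-1, s)`, and `-1` is not a zero unless `s` is the
left end of the Levenshtein interval. -/
lemma levenshteinKernel_ne_zero (hn : 2 ≤ n) (hε : ε ≤ 1) (hs : s ∈ Set.Ico (-1 : ℝ) 1)
    (hl : largestZero n 1 (1 - ε) (k + ε) ≤ s) {t : ℝ} (ht : t ≤ -1)
    (hne : t < -1 ∨ (ε = 0 → (adjacent n 1 1 k).eval s ≠ 0)) :
    (levenshteinKernel n ε (k + 1) s).eval t ≠ 0 := by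
  have hν := gegParam_ge hn
  have hk : (0 : ℝ) ≤ k := by positivity
  have hpos := (adjacent_pos_of_mem hn hε hs hl).1
  have hsign := adjacent_one_sign hn hε k ht
  have hnn := nonneg_of_pos_right (adjacent_pos_of_largestZero_lt hn hl) s le_rfl
  rcases le_or_gt s t with hst | hst
  · exact (levenshteinKernel_pos hn hs.2 hpos hst).ne'
  have hP := hpos s le_rfl
  rw [levenshteinKernel_eval]
  interval_cases ε
  · simp only [adjacent_eq, Nat.sub_zero, Nat.cast_one, Nat.cast_zero, add_zero] at *
    set ν := gegParam n with hν_def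
    have us := jacobi_raise_right_eval (α := ν + 1) (by linarith) ν k s
    have ut := jacobi_raise_right_eval (α := ν + 1) (by linarith) ν k t
    have hJ := jacobi_succ_succ_sign hν k ht
    have c0 : 0 < 2 * (k : ℝ) + (ν + 1) + ν + 2 := by linarith
    -- For ε = 0 the chosen combination is a positive multiple of (t + 1) P_k^{1,1}, by the raising
    -- relation.
    refine jacobi_kernel_ne_zero (by linarith) (by linarith) (by linarith)
      (c := 2 * (k + 1 + (ν + 1))) (d := 2 * (k + ν + 1)) hP hsign ?_ ?_ ?_
    · rw [← us]
      exact mul_nonneg c0.le (mul_nonneg (by linarith [hs.1]) hnn)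
    · rw [← ut]
      have h1 := mul_nonneg c0.le (mul_nonneg (by linarith : 0 ≤ -(t + 1)) hJ.le)
      linarith
    · rw [← us, ← ut]
      -- For t < -1 the combination is nonzero at t. At t = -1 it vanishes there, so it has to be
      -- nonzero at s, and this is what excludes the zeros of P_k^{1,1}.
      rcases ht.lt_or_eq with h | h
      · refine Or.inr (mul_ne_zero c0.ne' (mul_ne_zero (by linarith) ?_))
        exact fun h0 => by rw [h0, mul_zero] at hJ; exact hJ.false
      · exact Or.inl (mul_ne_zero c0.ne' (mul_ne_zero (by linarith)
          (hne.resolve_left h.not_lt trivial)))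
  · simp only [adjacent_eq, Nat.sub_self, Nat.cast_one, Nat.cast_zero, add_zero] at *
    set ν := gegParam n with hν_def
    have us := jacobi_lower_right_eval (ν + 1) ν (k + 1) s
    have ut := jacobi_lower_right_eval (ν + 1) ν (k + 1) t
    have hJ := jacobi_succ_self_sign hν (k + 1) ht
    rw [Nat.add_sub_cancel] at us ut
    push_cast at us ut
    have c0 : 0 < 2 * ((k : ℝ) + 1) + (ν + 1) + ν + 1 := by linarith
    -- For ε = 1 the chosen combination is a positive multiple of P_{k+1}^{1,0}, by the lowering
    -- relation; it is nonzero at every t ≤ -1.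
    refine jacobi_kernel_ne_zero (by linarith) (by linarith) (by linarith)
      (c := (k : ℝ) + 1 + (ν + 1) + ν + 1) (d := k + 1) hP hsign ?_ ?_ ?_
    · rw [← us]
      exact mul_nonneg c0.le hnn
    · rw [← ut]
      have h1 := mul_pos c0 hJ
      rw [pow_succ] at h1
      linarith
    · rw [← ut]
      refine Or.inr (mul_ne_zero c0.ne' ?_)
      exact fun h0 => by rw [h0, mul_zero] at hJ; exact hJ.false

lemma mem_roots_levenshteinKernel (hn : 2 ≤ n) (hε : ε ≤ 1) (hs : s ∈ Set.Ico (-1 : ℝ) 1)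
    (hl : largestZero n 1 (1 - ε) (k + ε) ≤ s) {t : ℝ}
    (ht : t ∈ (levenshteinKernel n ε (k + 1) s).roots) : t ∈ Set.Ico (-1 : ℝ) s := by
  have h0 := isRoot_of_mem_roots ht
  constructor
  · by_contra hc
    exact levenshteinKernel_ne_zero hn hε hs hl (not_le.mp hc).le (Or.inl (not_le.mp hc)) h0
  · by_contra hc
    exact (levenshteinKernel_pos hn hs.2 (adjacent_pos_of_mem hn hε hs hl).1
      (not_lt.mp hc)).ne' h0

lemma roots_X_sub_C_mul (T : ℝ[X]) (hT : T ≠ 0) (s : ℝ) (ε : ℕ) :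
    ((X - C s) * (X + 1) ^ ε * T ^ 2).roots = {s} + ε • {-1} + 2 • T.roots := by
  have hX : (X + 1 : ℝ[X]) = X - C (-1) := by simp
  have h1 : (X - C s : ℝ[X]) ≠ 0 := X_sub_C_ne_zero s
  have h2 : ((X + 1 : ℝ[X]) ^ ε) ≠ 0 := by rw [hX]; exact pow_ne_zero _ (X_sub_C_ne_zero _)
  rw [roots_mul (mul_ne_zero (mul_ne_zero h1 h2) (pow_ne_zero _ hT)), roots_mul (mul_ne_zero h1 h2),
    roots_pow, roots_pow, hX, roots_X_sub_C, roots_X_sub_C]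

end

section

/-! ### Gegenbauer coefficients -/

variable {n : ℕ}

lemma gegenbauerCoeff_add (hn : 2 ≤ n) (p q : ℝ[X]) (i : ℕ) :
    gegenbauerCoeff hn (p + q) i = gegenbauerCoeff hn p i + gegenbauerCoeff hn q i := by
  simp [gegenbauerCoeff]

lemma gegenbauerCoeff_sub (hn : 2 ≤ n) (p q : ℝ[X]) (i : ℕ) :
    gegenbauerCoeff hn (p - q) i = gegenbauerCoeff hn p i - gegenbauerCoeff hn q i := by
  simp [gegenbauerCoeff]

lemma gegenbauerCoeff_C_mul (hn : 2 ≤ n) (c : ℝ) (p : ℝ[X]) (i : ℕ) :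
    gegenbauerCoeff hn (C c * p) i = c * gegenbauerCoeff hn p i := by
  rw [← smul_eq_C_mul]; simp [gegenbauerCoeff]

lemma gegenbauerCoeff_sum (hn : 2 ≤ n) {ι : Type*} (S : Finset ι) (p : ι → ℝ[X]) (i : ℕ) :
    gegenbauerCoeff hn (∑ j ∈ S, p j) i = ∑ j ∈ S, gegenbauerCoeff hn (p j) i := by
  simp [gegenbauerCoeff]

lemma gegenbauerCoeff_gegenbauer (hn : 2 ≤ n) (i j : ℕ) :
    gegenbauerCoeff hn (gegenbauer n j) i = if j = i then 1 else 0 := by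
  rw [gegenbauerCoeff, ← gegenbauerBasis_apply hn, Module.Basis.repr_self, Finsupp.single_apply]

lemma X_mul_gegenbauer (hn : 2 ≤ n) (k : ℕ) :
    X * gegenbauer n k = C (1 - gegDown (gegParam n) k) * gegenbauer n (k + 1) +
      C (gegDown (gegParam n) k) * gegenbauer n (k - 1) := by
  simp only [gegenbauer_eq]
  exact ultraspherical_recurrence (gegParam_ge hn) k

/-- Multiplication by X moves an index by one, so d steps starting from j > d cannot reach 0. -/
lemma gegenbauerCoeff_X_pow_mul (hn : 2 ≤ n) (d : ℕ) :
    ∀ j, d < j → gegenbauerCoeff hn (X ^ d * gegenbauer n j) 0 = 0 := by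
  induction d with
  | zero =>
    intro j hj
    rw [pow_zero, one_mul, gegenbauerCoeff_gegenbauer, if_neg (by omega)]
  | succ d ih =>
    intro j hj
    have e : X ^ (d + 1) * gegenbauer n j = C (1 - gegDown (gegParam n) j) *
        (X ^ d * gegenbauer n (j + 1)) +
        C (gegDown (gegParam n) j) * (X ^ d * gegenbauer n (j - 1)) := by
      rw [pow_succ, mul_assoc, X_mul_gegenbauer hn]; ring
    rw [e, gegenbauerCoeff_add, gegenbauerCoeff_C_mul, gegenbauerCoeff_C_mul,
      ih _ (by omega), ih _ (by omega)]
    simp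

/-- Orthogonality of the Gegenbauer polynomials, in terms of the zeroth coefficient. -/
lemma gegenbauerCoeff_zero_mul (hn : 2 ≤ n) {q : ℝ[X]} {j : ℕ} (hq : q.degree < j) :
    gegenbauerCoeff hn (q * gegenbauer n j) 0 = 0 := by
  rcases eq_or_ne q 0 with rfl | hq0
  · simp [gegenbauerCoeff]
  rw [q.as_sum_range_C_mul_X_pow, Finset.sum_mul, gegenbauerCoeff_sum]
  refine Finset.sum_eq_zero fun d hd => ?_
  have h1 : q.natDegree < j := (natDegree_lt_iff_degree_lt hq0).mpr hq
  rw [mul_assoc, gegenbauerCoeff_C_mul, gegenbauerCoeff_X_pow_mul hn d j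
    (by have := Finset.mem_range.mp hd; omega), mul_zero]

/-! ### The value of the Levenshtein polynomial at `1` -/

/-- Multiplied by the weight `(1 - t)(1 + t)^ε`, the adjacent polynomial of degree `j` is a multiple
of the difference of two Gegenbauer polynomials. -/
lemma exists_weight_mul_adjacent (hn : 2 ≤ n) {ε : ℕ} (hε : ε ≤ 1) (j : ℕ) :
    ∃ d : ℝ, (1 - X) * (X + 1) ^ ε * adjacent n 1 ε j =
      C d * (gegenbauer n j - gegenbauer n (j + 1 + ε)) := by
  have hν := gegParam_ge hn
  have hj : (0 : ℝ) ≤ j := by positivity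
  simp only [gegenbauer_eq, adjacent_eq]
  set ν := gegParam n
  interval_cases ε
  · have h := eq_C_inv_mul (by linarith) (jacobi_raise_left (α := ν) (by linarith) ν j)
    refine ⟨(2 * (j : ℝ) + ν + ν + 2)⁻¹ * (2 * (ν + 1)), ?_⟩
    rw [C_mul]
    simp only [Nat.cast_one, Nat.cast_zero, add_zero, pow_zero, mul_one]
    linear_combination h
  · have h := eq_C_inv_mul (by linarith) (jacobi_raise_left (α := ν) (by linarith) (ν + 1) j)
    -- With equal parameters both coefficients of the raising relation are 1, so the difference of
    -- these expressions at j and j + 1 telescopes to P_j - P_{j+2}.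
    have hr : ∀ i : ℕ, (X + 1) * jacobi ν (ν + 1) i = jacobi ν ν (i + 1) + jacobi ν ν i := by
      intro i
      have hi : (0 : ℝ) ≤ i := by positivity
      have h1 := eq_C_inv_mul (by linarith) (jacobi_raise_right (α := ν) (by linarith) ν i)
      have c : C (2 * (i : ℝ) + ν + ν + 2)⁻¹ * C (2 * ((i : ℝ) + 1 + ν)) = (1 : ℝ[X]) := by
        rw [← C_mul, ← C_1]; congr 1
        rw [inv_mul_eq_one₀ (by linarith)]; ring
      have e : 2 * ((i : ℝ) + ν + 1) = 2 * (i + 1 + ν) := by ring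
      rw [e] at h1
      linear_combination h1 + (jacobi ν ν (i + 1) + jacobi ν ν i) * c
    refine ⟨(2 * (j : ℝ) + ν + (ν + 1) + 2)⁻¹ * (2 * (ν + 1)), ?_⟩
    rw [C_mul]
    simp only [Nat.cast_one, pow_one]
    linear_combination (X + 1) * h + C (2 * (j : ℝ) + ν + (ν + 1) + 2)⁻¹ * C (2 * (ν + 1)) *
      (hr j - hr (j + 1))

/-- The mean of `(1 + t)^ε` times the adjacent polynomial of degree `j`. -/
def adjacentMean (hn : 2 ≤ n) (ε j : ℕ) : ℝ :=
  gegenbauerCoeff hn ((X + 1) ^ ε * adjacent n 1 ε j) 0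

lemma gegenbauerCoeff_one (hn : 2 ≤ n) : gegenbauerCoeff hn 1 0 = 1 := by
  have h := gegenbauerCoeff_gegenbauer hn 0 0
  rwa [gegenbauer_eq, jacobi_zero, if_pos rfl] at h

/-- The zeroth coefficient of `jacobi_lower_left`, whose left side is a multiple of a Gegenbauer
polynomial of positive degree and so has mean zero. -/
lemma adjacentMean_zero_succ (hn : 2 ≤ n) (j : ℕ) :
    ((j : ℝ) + 1 + 2 * gegParam n + 1) * (j + 1 + gegParam n + 1) * adjacentMean hn 0 (j + 1) =
      (j + 1 + gegParam n) * (j + 1) * adjacentMean hn 0 j := by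
  have hν := gegParam_ge hn
  have h := jacobi_lower_left (α := gegParam n) (by linarith) (gegParam n) (j + 1)
  have h1 := congrArg (fun p => gegenbauerCoeff hn p 0) h
  simp only [gegenbauerCoeff_sub, gegenbauerCoeff_C_mul, ← gegenbauer_eq,
    gegenbauerCoeff_gegenbauer, Nat.add_sub_cancel] at h1
  rw [if_neg (by omega)] at h1
  simp only [adjacentMean, adjacent_eq, pow_zero, one_mul, Nat.cast_one, Nat.cast_zero, add_zero]
  push_cast at h1 ⊢
  linear_combination -h1

lemma adjacentMean_zero (hn : 2 ≤ n) : adjacentMean hn 0 0 = 1 := by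
  simp [adjacentMean, adjacent_eq, jacobi_zero, gegenbauerCoeff_one]

lemma adjacentMean_one (hn : 2 ≤ n) (j : ℕ) :
    (2 * (j : ℝ) + 2 * gegParam n + 3) * adjacentMean hn 1 j =
      2 * (j + 2 + gegParam n) * adjacentMean hn 0 (j + 1) +
        2 * (j + gegParam n + 1) * adjacentMean hn 0 j := by
  have hν := gegParam_ge hn
  have h := jacobi_raise_right (α := gegParam n + 1) (by linarith) (gegParam n) j
  have h1 := congrArg (fun p => gegenbauerCoeff hn p 0) h
  simp only [gegenbauerCoeff_add, gegenbauerCoeff_C_mul] at h1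
  simp only [adjacentMean, adjacent_eq, pow_zero, one_mul, Nat.cast_one, Nat.cast_zero, add_zero,
    pow_one]
  linear_combination h1

/-- The recursion `adjacentMean_zero_succ` solved in closed form. The factor multiplying the mean
is, for j = k + ε, the s-free part of the Levenshtein bound in dimension n + 2. -/
lemma adjacentMean_mul (n : ℕ) (hn : 2 ≤ n + 2) (j : ℕ) :
    adjacentMean hn 0 j * (((n + j).choose n : ℝ) * ((2 * j + n + 1) / (n + 1))) = 1 := by
  induction j with
  | zero =>
    rw [adjacentMean_zero]
    have : (n : ℝ) + 1 ≠ 0 := by positivity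
    simp [this]
  | succ j ih =>
    have h := adjacentMean_zero_succ hn j
    have hν : gegParam (n + 2) = ((n : ℝ) - 1) / 2 := by simp only [gegParam]; push_cast; ring
    rw [hν] at h
    have hc : ((n + (j + 1)).choose n : ℝ) = (n + j).choose n * (n + j + 1) / (j + 1) := by
      have := Nat.choose_mul_succ_eq (n + j) n
      have e : n + j + 1 - n = j + 1 := by omega
      rw [e] at this
      rw [eq_div_iff (by positivity)]
      have h2 : (((n + j).choose n * (n + j + 1) : ℕ) : ℝ) =
        (((n + j + 1).choose n * (j + 1) : ℕ) : ℝ) := by rw [this]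
      push_cast at h2
      rw [← add_assoc]
      linarith
    rw [hc]
    refine Eq.trans ?_ ih
    push_cast
    have h1 : ((n : ℝ) + j + 1) * (2 * j + n + 3) * adjacentMean hn 0 (j + 1) =
        (2 * j + n + 1) * (j + 1) * adjacentMean hn 0 j := by linear_combination 2 * h
    have hj : (j : ℝ) + 1 ≠ 0 := by positivity
    have hn1 : (n : ℝ) + 1 ≠ 0 := by positivity
    generalize ((n + j).choose n : ℝ) = A
    generalize adjacentMean hn 0 (j + 1) = I at *
    generalize adjacentMean hn 0 j = J at *
    rw [div_mul_div_comm, mul_div_assoc', mul_div_assoc', mul_div_assoc',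
      div_eq_div_iff (mul_ne_zero hj hn1) hn1]
    linear_combination A * (n + 1) * h1

/-- The zeroth Gegenbauer coefficient of the Levenshtein polynomial, via orthogonality. -/
lemma gegenbauerCoeff_zero_levenshtein (hn : 2 ≤ n) {ε k : ℕ} (hε : ε ≤ 1) {s : ℝ}
    (hpos : 0 < (adjacent n 1 ε k).eval s) :
    gegenbauerCoeff hn ((X - C s) * (X + 1) ^ ε * levenshteinKernel n ε (k + 1) s ^ 2) 0 =
      (levenshteinKernel n ε (k + 1) s).eval 1 * (kernelFactor n ε k *
        ((adjacent n 1 ε k).eval s * adjacentMean hn ε (k + 1) -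
          (adjacent n 1 ε (k + 1)).eval s * adjacentMean hn ε k)) := by
  set T := levenshteinKernel n ε (k + 1) s with hT
  have hdeg : T.degree = k := levenshteinKernel_degree hn hpos
  have cd := X_sub_C_mul_levenshteinKernel hn ε k s
  rw [← hT] at cd
  set q := T /ₘ (X - C 1) with hq
  -- Split one factor of T² at the point 1 and apply Christoffel-Darboux to (X - s) times the other.
  -- The part with q carries the weight (1 - X)(X + 1)^ε times adjacent polynomials of degree k and
  -- k + 1, that is, differences of Gegenbauer polynomials of index at least k; as deg q < k, it has
  -- mean zero. Only T(1) times the mean of the other factors remains.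
  have hTq : T = C (T.eval 1) + (X - C 1) * q := by
    rw [← modByMonic_X_sub_C_eq_C_eval, modByMonic_add_div]
  have hqdeg : q.degree < k := by
    have hT0 : T ≠ 0 := by
      intro h0; rw [h0, degree_zero] at hdeg; exact WithBot.bot_ne_natCast _ hdeg
    rw [← hdeg]
    refine degree_divByMonic_lt T (X - C 1) hT0 ?_
    rw [degree_X_sub_C]; exact zero_lt_one
  obtain ⟨d₀, h₀⟩ := exists_weight_mul_adjacent hn hε k
  obtain ⟨d₁, h₁⟩ := exists_weight_mul_adjacent hn hε (k + 1)
  have e : (X - C s) * (X + 1) ^ ε * T ^ 2 =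
      C (T.eval 1 * kernelFactor n ε k * (adjacent n 1 ε k).eval s) *
        ((X + 1) ^ ε * adjacent n 1 ε (k + 1)) -
      C (T.eval 1 * kernelFactor n ε k * (adjacent n 1 ε (k + 1)).eval s) *
        ((X + 1) ^ ε * adjacent n 1 ε k) -
      C (kernelFactor n ε k * (adjacent n 1 ε k).eval s * d₁) *
        (q * gegenbauer n (k + 1) - q * gegenbauer n (k + 1 + 1 + ε)) +
      C (kernelFactor n ε k * (adjacent n 1 ε (k + 1)).eval s * d₀) *
        (q * gegenbauer n k - q * gegenbauer n (k + 1 + ε)) := by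
    have e1 : (X - C s) * (X + 1) ^ ε * T ^ 2 = C (T.eval 1) * (X + 1) ^ ε * ((X - C s) * T) -
        q * ((1 - X) * (X + 1) ^ ε) * ((X - C s) * T) := by
      have : T ^ 2 = T * (C (T.eval 1) + (X - C 1) * q) := by rw [← hTq]; ring
      rw [this, C_1]; ring
    rw [e1, cd]
    simp only [C_mul]
    linear_combination (-q * C (kernelFactor n ε k) * C ((adjacent n 1 ε k).eval s)) * h₁ +
      (q * C (kernelFactor n ε k) * C ((adjacent n 1 ε (k + 1)).eval s)) * h₀
  have ho : ∀ j, k ≤ j → gegenbauerCoeff hn (q * gegenbauer n j) 0 = 0 := fun j hj =>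
    gegenbauerCoeff_zero_mul hn (hqdeg.trans_le (by exact_mod_cast hj))
  rw [e, gegenbauerCoeff_add, gegenbauerCoeff_sub, gegenbauerCoeff_sub, gegenbauerCoeff_C_mul,
    gegenbauerCoeff_C_mul, gegenbauerCoeff_C_mul, gegenbauerCoeff_C_mul, gegenbauerCoeff_sub,
    gegenbauerCoeff_sub, ho _ (by omega), ho _ (by omega), ho _ (by omega), ho _ (by omega)]
  simp only [adjacentMean]
  ring

/-! ### The Levenshtein bound as the quotient f(1) / f_0 -/

/-- The Levenshtein bound in terms of `k = halfIdx m - 1` and `ε = parity m`, in dimension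
`n + 2`. -/
def levenshteinValue (n ε k : ℕ) (s : ℝ) : ℝ :=
  ((n + (k + ε)).choose n : ℝ) * ((2 * ((k + ε : ℕ) : ℝ) + n + 1) / (n + 1) -
      (1 + s) ^ ε * ((gegenbauer (n + 2) (k + ε)).eval s -
        (gegenbauer (n + 2) (k + 1 + ε)).eval s) /
        ((1 - s) * (ε * (gegenbauer (n + 2) (k + 1)).eval s +
          (gegenbauer (n + 2) (k + 1 + ε)).eval s)))

lemma levenshteinBound_eq {n m k : ℕ} (hk : halfIdx m = k + 1) (s : ℝ) :
    levenshteinBound (n + 2) m s = levenshteinValue n (parity m) k s := by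
  simp only [levenshteinBound, levenshteinValue, hk]
  have e1 : k + 1 + (n + 2) - 3 + parity m = n + (k + parity m) := by omega
  rw [e1, Nat.add_sub_cancel, Nat.add_sub_cancel]
  push_cast
  have e2 : (n : ℝ) + 2 - 1 = n + 1 := by ring
  have e3 : 2 * ((k : ℝ) + 1) + (n + 2) - 3 + 2 * (parity m : ℝ) =
    2 * (k + parity m) + n + 1 := by ring
  rw [e2, e3]

lemma gegenbauer_raise_left_eval (hn : 2 ≤ n) (k : ℕ) (s : ℝ) :
    (k + gegParam n + 1) * ((1 - s) * (jacobi (gegParam n + 1) (gegParam n) k).eval s) =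
      (gegParam n + 1) * ((gegenbauer n k).eval s - (gegenbauer n (k + 1)).eval s) := by
  have hν := gegParam_ge hn
  have := jacobi_raise_left_eval (α := gegParam n) (by linarith) (gegParam n) k s
  simp only [gegenbauer_eq]
  linear_combination this / 2

/-- The denominator in the Levenshtein bound is negative on the Levenshtein interval. -/
lemma gegenbauer_neg_of_even (hn : 2 ≤ n) {k : ℕ} {s : ℝ}
    (hpos : 0 < (adjacent n 1 0 k).eval s) (hnp : (adjacent n 1 0 (k + 1)).eval s ≤ 0) :
    (gegenbauer n (k + 1)).eval s < 0 := by
  have hν := gegParam_ge hn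
  have hk : (0 : ℝ) ≤ k := by positivity
  simp only [adjacent_eq, gegenbauer_eq, Nat.cast_one, Nat.cast_zero, add_zero] at *
  have h := jacobi_lower_left_eval (α := gegParam n) (by linarith) (gegParam n) (k + 1) s
  rw [Nat.add_sub_cancel] at h
  push_cast at h
  have h1 := mul_nonneg (mul_nonneg
    (by linarith : 0 ≤ (k : ℝ) + 1 + gegParam n + gegParam n + 1)
    (by linarith : 0 ≤ (k : ℝ) + 1 + gegParam n + 1)) (neg_nonneg.mpr hnp)
  have h2 := mul_pos (mul_pos (by linarith : 0 < (k : ℝ) + 1 + gegParam n)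
    (by linarith : 0 < (k : ℝ) + 1)) hpos
  have h3 : 0 < (2 * ((k : ℝ) + 1) + gegParam n + gegParam n + 1) * (gegParam n + 1) :=
    mul_pos (by linarith) (by linarith)
  by_contra hc
  have := mul_nonneg h3.le (not_lt.mp hc)
  linarith

/-- For ε = 1 the denominator of the bound contains the sum of two consecutive Gegenbauer
polynomials, which is (s + 1) P_{k+1}^{0,1}(s). The lowering relation writes this Jacobi value as a
nonpositive term minus a positive one. -/
lemma jacobi_self_succ_neg (hn : 2 ≤ n) {k : ℕ} {s : ℝ}
    (hpos : 0 < (adjacent n 1 1 k).eval s) (hnp : (adjacent n 1 1 (k + 1)).eval s ≤ 0) :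
    (jacobi (gegParam n) (gegParam n + 1) (k + 1)).eval s < 0 := by
  have hν := gegParam_ge hn
  have hk : (0 : ℝ) ≤ k := by positivity
  simp only [adjacent_eq, Nat.cast_one] at *
  have h := jacobi_lower_left_eval (α := gegParam n) (by linarith) (gegParam n + 1) (k + 1) s
  rw [Nat.add_sub_cancel] at h
  push_cast at h
  have h1 := mul_nonneg (mul_nonneg
    (by linarith : 0 ≤ (k : ℝ) + 1 + gegParam n + (gegParam n + 1) + 1)
    (by linarith : 0 ≤ (k : ℝ) + 1 + gegParam n + 1)) (neg_nonneg.mpr hnp)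
  have h2 := mul_pos (mul_pos (by linarith : 0 < (k : ℝ) + 1 + (gegParam n + 1))
    (by linarith : 0 < (k : ℝ) + 1)) hpos
  have h3 : 0 < (2 * ((k : ℝ) + 1) + gegParam n + (gegParam n + 1) + 1) * (gegParam n + 1) :=
    mul_pos (by linarith) (by linarith)
  by_contra hc
  have := mul_nonneg h3.le (not_lt.mp hc)
  linarith

/-- Eliminating one of the two means between `adjacentMean_one` and `adjacentMean_zero_succ`. Used
at k and at k + 1, it makes both means for ε = 1 explicit multiples of the same mean for ε = 0. -/
lemma adjacentMean_one_eq (hn : 2 ≤ n) (k : ℕ) :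
    ((k : ℝ) + 1) * adjacentMean hn 1 k =
        2 * (k + 2 + gegParam n) * adjacentMean hn 0 (k + 1) ∧
      ((k : ℝ) + 2 * gegParam n + 2) * adjacentMean hn 1 k =
        2 * (k + gegParam n + 1) * adjacentMean hn 0 k := by
  have hν := gegParam_ge hn
  have hk : (0 : ℝ) ≤ k := by positivity
  have h0 := adjacentMean_zero_succ hn k
  have h1 := adjacentMean_one hn k
  have hD : 2 * (k : ℝ) + 2 * gegParam n + 3 ≠ 0 := by linarith
  constructor
  · apply mul_left_cancel₀ hD
    linear_combination (k + 1 : ℝ) * h1 - 2 * h0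
  · apply mul_left_cancel₀ hD
    linear_combination (k + 2 * gegParam n + 2) * h1 + 2 * h0

/-- This is f_0 L = f(1) for ε = 0 after removing the common factor T(1) κ, with κ the
`kernelFactor`: the left bracket comes from `gegenbauerCoeff_zero_levenshtein`, the right side from
Christoffel-Darboux at t = 1. -/
lemma levenshteinValue_zero_mul (n : ℕ) (hn : 2 ≤ n + 2) {k : ℕ} {s : ℝ} (hs : s < 1)
    (hpos : 0 < (adjacent (n + 2) 1 0 k).eval s)
    (hnp : (adjacent (n + 2) 1 0 (k + 1)).eval s ≤ 0) :
    ((adjacent (n + 2) 1 0 k).eval s * adjacentMean hn 0 (k + 1) -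
        (adjacent (n + 2) 1 0 (k + 1)).eval s * adjacentMean hn 0 k) * levenshteinValue n 0 k s =
      (adjacent (n + 2) 1 0 k).eval s - (adjacent (n + 2) 1 0 (k + 1)).eval s := by
  have hG := gegenbauer_neg_of_even hn hpos hnp
  have hk : (0 : ℝ) ≤ k := by positivity
  have hn0 : (0 : ℝ) ≤ n := by positivity
  have hν : gegParam (n + 2) = ((n : ℝ) - 1) / 2 := by simp only [gegParam]; push_cast; ring
  have hr := gegenbauer_raise_left_eval hn k s
  have hl := jacobi_lower_left_eval (α := gegParam (n + 2)) (by rw [hν]; linarith)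
    (gegParam (n + 2)) (k + 1) s
  have hI := adjacentMean_zero_succ hn k
  have hS := adjacentMean_mul n hn k
  rw [← gegenbauer_eq] at hl
  simp only [adjacent_eq, levenshteinValue, Nat.cast_one, Nat.cast_zero, add_zero, zero_mul,
    zero_add, pow_zero, one_mul, Nat.add_sub_cancel] at *
  rw [hν] at hr hl hI ⊢
  push_cast at hl
  have h1s : 1 - s ≠ 0 := by linarith
  have hn1 : (n : ℝ) + 1 ≠ 0 := by positivity
  generalize (jacobi (((n : ℝ) - 1) / 2 + 1) (((n : ℝ) - 1) / 2) k).eval s = P at *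
  generalize (jacobi (((n : ℝ) - 1) / 2 + 1) (((n : ℝ) - 1) / 2) (k + 1)).eval s = Q at *
  generalize (gegenbauer (n + 2) (k + 1)).eval s = G at *
  generalize (gegenbauer (n + 2) k).eval s = G₀ at *
  generalize adjacentMean hn 0 k = I at *
  generalize adjacentMean hn 0 (k + 1) = J at *
  generalize ((n + k).choose n : ℝ) = A at *
  have hg : G₀ - G = (2 * k + n + 1) / (n + 1) * ((1 - s) * P) := by
    rw [div_mul_eq_mul_div, eq_div_iff hn1]
    linear_combination -2 * hr
  rw [hg]
  generalize hB : (2 * (k : ℝ) + n + 1) / (n + 1) = B at *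
  -- The bound collapses to A B (G - P) / G, where A B is the reciprocal of the mean I by `hS`. The
  -- lowering relation gives G in terms of P and Q with the same weights x, y that relate the means
  -- I and J, so the rest is linear algebra.
  have e : A * (B - B * ((1 - s) * P) / ((1 - s) * G)) = A * B * (G - P) / G := by
    have := hG.ne
    field_simp
  set y : ℝ := ((k : ℝ) + n + 1) * (2 * k + n + 3) with hy
  set x : ℝ := (2 * (k : ℝ) + n + 1) * (k + 1) with hx
  have hJ : y * J = x * I := by rw [hy, hx]; linear_combination 2 * hI
  have hGe : (y - x) * G = y * Q - x * P := by rw [hy, hx]; linear_combination 2 * hl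
  have hy0 : y ≠ 0 := by positivity
  rw [e, mul_div_assoc', div_eq_iff hG.ne]
  apply mul_left_cancel₀ hy0
  linear_combination P * (A * B) * (G - P) * hJ + (P * x - Q * y) * (G - P) * hS - P * hGe

/-- The analogue of `levenshteinValue_zero_mul` for ε = 1; the factor 2 is the value of 1 + t at t =
1. -/
lemma levenshteinValue_one_mul (n : ℕ) (hn : 2 ≤ n + 2) {k : ℕ} {s : ℝ} (hs : s < 1) (hs' : -1 < s)
    (hpos : 0 < (adjacent (n + 2) 1 1 k).eval s)
    (hnp : (adjacent (n + 2) 1 1 (k + 1)).eval s ≤ 0) :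
    ((adjacent (n + 2) 1 1 k).eval s * adjacentMean hn 1 (k + 1) -
        (adjacent (n + 2) 1 1 (k + 1)).eval s * adjacentMean hn 1 k) * levenshteinValue n 1 k s =
      2 * ((adjacent (n + 2) 1 1 k).eval s - (adjacent (n + 2) 1 1 (k + 1)).eval s) := by
  have hV := jacobi_self_succ_neg hn hpos hnp
  have hk : (0 : ℝ) ≤ k := by positivity
  have hn0 : (0 : ℝ) ≤ n := by positivity
  have hν : gegParam (n + 2) = ((n : ℝ) - 1) / 2 := by simp only [gegParam]; push_cast; ring
  have hα : -1 < gegParam (n + 2) := by rw [hν]; linarith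
  have hr := gegenbauer_raise_left_eval hn (k + 1) s
  have hv := jacobi_raise_right_eval hα (gegParam (n + 2)) (k + 1) s
  have hl := jacobi_lower_left_eval hα (gegParam (n + 2) + 1) (k + 1) s
  have hu := jacobi_lower_right_eval (gegParam (n + 2) + 1) (gegParam (n + 2)) (k + 1) s
  have hM := (adjacentMean_one_eq hn k).1
  have hM' := (adjacentMean_one_eq hn (k + 1)).2
  have hS := adjacentMean_mul n hn (k + 1)
  simp only [← gegenbauer_eq] at hv
  simp only [adjacent_eq, levenshteinValue, Nat.cast_one, pow_one, one_mul,
    Nat.add_sub_cancel] at *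
  rw [hν] at hr hv hl hu hM hM' hV hpos hnp ⊢
  push_cast at hl hu hM hM' hS hr hv ⊢
  have h1s : 1 - s ≠ 0 := by linarith
  have h2s : s + 1 ≠ 0 := by linarith
  have hn1 : (n : ℝ) + 1 ≠ 0 := by positivity
  generalize (jacobi (((n : ℝ) - 1) / 2 + 1) (((n : ℝ) - 1) / 2 + 1) k).eval s = Q at *
  generalize (jacobi (((n : ℝ) - 1) / 2 + 1) (((n : ℝ) - 1) / 2 + 1) (k + 1)).eval s = Q' at *
  generalize (jacobi (((n : ℝ) - 1) / 2) (((n : ℝ) - 1) / 2 + 1) (k + 1)).eval s = V at *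
  generalize (jacobi (((n : ℝ) - 1) / 2 + 1) (((n : ℝ) - 1) / 2) (k + 1)).eval s = U at *
  generalize (gegenbauer (n + 2) (k + 1)).eval s = G₁ at *
  generalize (gegenbauer (n + 2) (k + 1 + 1)).eval s = G₂ at *
  generalize adjacentMean hn 0 (k + 1) = I at *
  generalize adjacentMean hn 1 k = M at *
  generalize adjacentMean hn 1 (k + 1) = M' at *
  generalize ((n + (k + 1)).choose n : ℝ) = A at *
  have hg : G₁ - G₂ = (2 * (k + 1) + n + 1) / (n + 1) * ((1 - s) * U) := by
    rw [div_mul_eq_mul_div, eq_div_iff hn1]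
    linear_combination -2 * hr
  -- This cancels the factor 1 + s in the numerator of the bound, which is legitimate because s >
  -- -1.
  have hg' : G₁ + G₂ = (s + 1) * V := by
    have h0 : 2 * (k : ℝ) + n + 3 ≠ 0 := by positivity
    apply mul_left_cancel₀ h0
    linear_combination -hv
  rw [hg, hg', add_comm 1 s]
  generalize hB : (2 * ((k : ℝ) + 1) + n + 1) / (n + 1) = B at *
  have e : A * (B - (s + 1) * (B * ((1 - s) * U)) / ((1 - s) * ((s + 1) * V))) =
      A * B * (V - U) / V := by
    have := hV.ne
    field_simp
  set p : ℝ := (k : ℝ) + n + 2 with hp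
  set q : ℝ := (k : ℝ) + 1 with hq
  have hV' : (p - q) * V = p * Q' - q * Q := by
    have h0 : 2 * (k : ℝ) + n + 3 ≠ 0 := by positivity
    apply mul_left_cancel₀ h0
    rw [hp, hq]; linear_combination 2 * hl
  have hU' : (p + q) * U = p * Q' + q * Q := by rw [hp, hq]; linear_combination hu
  have h1 : p * M' = (p + q) * I := by rw [hp, hq]; linear_combination hM'
  have h2 : q * M = (p + q) * I := by rw [hp, hq]; linear_combination hM
  have hpq : p * q ≠ 0 := by positivity
  rw [e, mul_div_assoc', div_eq_iff hV.ne]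
  apply mul_left_cancel₀ hpq
  linear_combination q * Q * (A * B) * (V - U) * h1 - p * Q' * (A * B) * (V - U) * h2 +
    (p + q) * (q * Q - p * Q') * (V - U) * hS + (p + q) * (V - U) * hV' +
    V * (-(p + q) * hV' + (p - q) * hU')

end

section

/-! ### Nonnegativity of the linearization coefficients -/

/-- Solutions of the discrete boundary value problem satisfied by the (rescaled) linearization
coefficients: the value at `(a, b + 1)` is obtained from values on two diagonals below it. -/
lemma hyperbolic_nonneg {al : ℕ → ℝ} (hal0 : al 0 = 0) (hal : Monotone al)
    (hpos : ∀ i, 0 < al (i + 1)) (hhalf : ∀ i, al i ≤ 1 / 2) {v : ℕ → ℕ → ℝ}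
    (hrec0 : ∀ a, al (a + 2) * v (a + 2) 0 + (1 - al a) * v a 0 = al 1 * v (a + 1) 1)
    (hrec : ∀ a b, al (a + 2) * v (a + 2) (b + 1) + (1 - al a) * v a (b + 1) =
      al (b + 2) * v (a + 1) (b + 2) + (1 - al b) * v (a + 1) b)
    (hv0 : ∀ a, 0 ≤ v a 0) : ∀ b a, b ≤ a → 0 ≤ v a b := by
  -- Weighted sums along the two sides, below the apex (d + m + 1, m + 1), of the triangle with base
  -- vertices (d, 0) and (d + 2m + 2, 0). The weights are nonnegative: on the first side since `al ≤
  -- 1 / 2`, on the second since `al` is monotone and j ≤ e - j there.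
  let Lf : ℕ → ℕ → ℝ := fun d m => ∑ j ∈ Finset.range (m + 1), (1 - al (d + j) - al j) * v (d + j) j
  let Rf : ℕ → ℕ → ℝ := fun e m =>
    ∑ j ∈ Finset.range (m + 1), (al (e - j) - al j) * v (e - j) j
  -- The recurrence summed over the triangle. The induction is inclusion-exclusion: the triangle of
  -- height m + 2 is covered by two of height m + 1, which overlap in a smaller one.
  have key : ∀ m d, al (m + 1) * v (d + m + 1) (m + 1) = Lf d m + Rf (d + 2 * m + 2) m := by
    intro m
    induction m using Nat.strong_induction_on with
    | _ m ih =>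
      intro d
      rcases m with _ | m
      · simp only [Lf, Rf, zero_add, Finset.range_one, Finset.sum_singleton, add_zero, mul_zero,
          Nat.sub_zero, hal0, sub_zero]
        linarith [hrec0 d]
      · have i1 := ih m (by omega) d
        have i2 := ih m (by omega) (d + 2)
        have eL : ∀ d, Lf d (m + 1) = Lf d m +
            (1 - al (d + (m + 1)) - al (m + 1)) * v (d + (m + 1)) (m + 1) :=
          fun d => Finset.sum_range_succ _ _
        have eR : ∀ e, Rf e (m + 1) = Rf e m +
            (al (e - (m + 1)) - al (m + 1)) * v (e - (m + 1)) (m + 1) :=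
          fun d => Finset.sum_range_succ _ _
        have h := hrec (d + m + 1) m
        rw [eL, eR]
        have e1 : d + 2 * (m + 1) + 2 - (m + 1) = d + m + 3 := by omega
        have e2 : d + (m + 1) = d + m + 1 := by omega
        have e3 : d + 2 + 2 * m + 2 = d + 2 * (m + 1) + 2 := by omega
        have e4 : d + 2 + m + 1 = d + m + 3 := by omega
        rw [e3, e4] at i2
        rw [e1, e2]
        -- The two sums run along the sides of the overlap and share its apex (d + m + 2, m).
        have key2 : Lf (d + 2) m + Rf (d + 2 * m + 2) m = (1 - al m) * v (d + m + 2) m := by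
          rcases m with _ | m
          · simp only [Lf, Rf, zero_add, Finset.range_one, Finset.sum_singleton, add_zero, mul_zero,
              Nat.sub_zero, hal0, sub_zero]
            ring
          · have i3 := ih m (by omega) (d + 2)
            have eL' : Lf (d + 2) (m + 1) = Lf (d + 2) m +
                (1 - al (d + 2 + (m + 1)) - al (m + 1)) * v (d + 2 + (m + 1)) (m + 1) :=
              Finset.sum_range_succ _ _
            have eR' : Rf (d + 2 * (m + 1) + 2) (m + 1) = Rf (d + 2 * (m + 1) + 2) m +
                (al (d + 2 * (m + 1) + 2 - (m + 1)) - al (m + 1)) *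
                  v (d + 2 * (m + 1) + 2 - (m + 1)) (m + 1) :=
              Finset.sum_range_succ _ _
            have f1 : d + 2 * (m + 1) + 2 - (m + 1) = d + m + 3 := by omega
            have f2 : d + 2 + (m + 1) = d + m + 3 := by omega
            have f3 : d + 2 + 2 * m + 2 = d + 2 * (m + 1) + 2 := by omega
            have f4 : d + 2 + m + 1 = d + m + 3 := by omega
            have f5 : d + (m + 1) + 2 = d + m + 3 := by omega
            rw [f3, f4] at i3
            rw [eL', eR', f1, f2, f5]
            linear_combination -i3
        have g1 : d + m + 1 + 2 = d + m + 3 := by omega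
        have g2 : d + m + 1 + 1 = d + m + 2 := by omega
        rw [g1, g2] at h
        rw [g2]
        linear_combination -h + i1 + i2 + key2
  intro b
  induction b using Nat.strong_induction_on with
  | _ b ih =>
    intro a hab
    rcases b with _ | m
    · exact hv0 a
    obtain ⟨d, rfl⟩ : ∃ d, a = d + m + 1 := ⟨a - m - 1, by omega⟩
    have h := key m d
    refine nonneg_of_mul_nonneg_right (?_ : 0 ≤ al (m + 1) * v (d + m + 1) (m + 1)) (hpos m)
    rw [h]
    refine add_nonneg (Finset.sum_nonneg fun j hj => ?_) (Finset.sum_nonneg fun j hj => ?_)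
    · have hj' := Finset.mem_range.mp hj
      exact mul_nonneg (by linarith [hhalf (d + j), hhalf j]) (ih j (by omega) _ (by omega))
    · have hj' := Finset.mem_range.mp hj
      exact mul_nonneg (sub_nonneg.mpr (hal (by omega))) (ih j (by omega) _ (by omega))

variable {n : ℕ}

lemma gegDown_zero (ν : ℝ) : gegDown ν 0 = 0 := by simp [gegDown]

lemma gegDown_succ_pos {ν : ℝ} (hν : -1 / 2 ≤ ν) (k : ℕ) : 0 < gegDown ν (k + 1) := by
  have hk : (0 : ℝ) ≤ k := by positivity
  unfold gegDown
  push_cast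
  exact div_pos (by linarith) (by linarith)

lemma gegDown_le_half {ν : ℝ} (hν : -1 / 2 ≤ ν) (k : ℕ) : gegDown ν k ≤ 1 / 2 := by
  rcases k with _ | k
  · rw [gegDown_zero]; norm_num
  have hk : (0 : ℝ) ≤ k := by positivity
  unfold gegDown
  push_cast
  rw [div_le_div_iff₀ (by linarith) (by norm_num)]
  linarith

/-- Monotonicity and the bound 1/2 are what `hyperbolic_nonneg` requires; both rest on 2ν + 1 ≥ 0.
-/
lemma gegDown_monotone {ν : ℝ} (hν : -1 / 2 ≤ ν) : Monotone (gegDown ν) := by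
  refine monotone_nat_of_le_succ fun k => ?_
  rcases k with _ | k
  · rw [gegDown_zero]; exact (gegDown_succ_pos hν 0).le
  have hk : (0 : ℝ) ≤ k := by positivity
  unfold gegDown
  push_cast
  rw [div_le_div_iff₀ (by linarith) (by linarith)]
  nlinarith

/-- The weights that symmetrize the three-term recurrence of the Gegenbauer polynomials. -/
def gegWeight (ν : ℝ) : ℕ → ℝ
  | 0 => 1
  | k + 1 => gegWeight ν k * (1 - gegDown ν k) / gegDown ν (k + 1)

lemma gegWeight_pos {ν : ℝ} (hν : -1 / 2 ≤ ν) (k : ℕ) : 0 < gegWeight ν k := by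
  induction k with
  | zero => exact one_pos
  | succ k ih =>
    exact div_pos (mul_pos ih (sub_pos.mpr (gegDown_lt_one hν k))) (gegDown_succ_pos hν k)

lemma gegWeight_succ_mul {ν : ℝ} (hν : -1 / 2 ≤ ν) (k : ℕ) :
    gegDown ν (k + 1) * gegWeight ν (k + 1) = gegWeight ν k * (1 - gegDown ν k) := by
  rw [gegWeight, mul_div_cancel₀ _ (gegDown_succ_pos hν k).ne']

/-- The hypothesis `hu` says that the recurrence operator gives the same result in either index.
Multiplying u(a, b) by the symmetrizing weights of a and b turns it into the boundary value problem
of `hyperbolic_nonneg`, and dividing by positive weights preserves the sign. -/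
lemma linearization_nonneg {ν : ℝ} (hν : -1 / 2 ≤ ν) {u : ℕ → ℕ → ℝ}
    (hu : ∀ a b, (1 - gegDown ν a) * u (a + 1) b + gegDown ν a * u (a - 1) b =
      (1 - gegDown ν b) * u a (b + 1) + gegDown ν b * u a (b - 1))
    (hu0 : ∀ a, 0 ≤ u a 0) {a b : ℕ} (hab : b ≤ a) : 0 ≤ u a b := by
  have h0 : gegDown ν 0 = 0 := gegDown_zero ν
  have key : ∀ b a, b ≤ a → 0 ≤ gegWeight ν a * gegWeight ν b * u a b := by
    refine hyperbolic_nonneg (al := gegDown ν) h0 (gegDown_monotone hν) (gegDown_succ_pos hν)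
      (gegDown_le_half hν) (v := fun a b => gegWeight ν a * gegWeight ν b * u a b) ?_ ?_ ?_
    · intro a
      have h := hu (a + 1) 0
      have w1 := gegWeight_succ_mul hν a
      have w2 := gegWeight_succ_mul hν (a + 1)
      have w3 := gegWeight_succ_mul hν 0
      rw [h0] at h w3
      simp only [Nat.add_sub_cancel, zero_add] at h w1 w2 w3 ⊢
      linear_combination gegWeight ν (a + 1) * gegWeight ν 0 * h +
        gegWeight ν 0 * u (a + 2) 0 * w2 - gegWeight ν 0 * u a 0 * w1 -
        gegWeight ν (a + 1) * u (a + 1) 1 * w3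
    · intro a b
      have h := hu (a + 1) (b + 1)
      have w1 := gegWeight_succ_mul hν a
      have w2 := gegWeight_succ_mul hν (a + 1)
      have w3 := gegWeight_succ_mul hν b
      have w4 := gegWeight_succ_mul hν (b + 1)
      simp only [Nat.add_sub_cancel] at h w1 w2 w3 w4 ⊢
      linear_combination gegWeight ν (a + 1) * gegWeight ν (b + 1) * h +
        gegWeight ν (b + 1) * u (a + 2) (b + 1) * w2 - gegWeight ν (b + 1) * u a (b + 1) * w1 -
        gegWeight ν (a + 1) * u (a + 1) (b + 2) * w4 + gegWeight ν (a + 1) * u (a + 1) b * w3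
    · intro a
      exact mul_nonneg (mul_pos (gegWeight_pos hν a) (gegWeight_pos hν 0)).le (hu0 a)
  exact nonneg_of_mul_nonneg_right (key b a hab)
    (mul_pos (gegWeight_pos hν a) (gegWeight_pos hν b))

/-- The product of two Gegenbauer polynomials has nonnegative Gegenbauer coefficients. -/
lemma gegenbauerCoeff_mul_gegenbauer_nonneg (hn : 2 ≤ n) (a b i : ℕ) :
    0 ≤ gegenbauerCoeff hn (gegenbauer n a * gegenbauer n b) i := by
  have h : ∀ a b, b ≤ a → 0 ≤ gegenbauerCoeff hn (gegenbauer n a * gegenbauer n b) i := by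
    intro a b hab
    refine linearization_nonneg (gegParam_ge hn)
      (u := fun a b => gegenbauerCoeff hn (gegenbauer n a * gegenbauer n b) i) ?_ ?_ hab
    · intro a b
      -- Both sides are the coefficient of X P_a P_b, with X absorbed into one factor or the other.
      simp only [← gegenbauerCoeff_C_mul, ← gegenbauerCoeff_add]
      refine congrArg (fun p => gegenbauerCoeff hn p i) ?_
      linear_combination gegenbauer n a * X_mul_gegenbauer hn b -
        gegenbauer n b * X_mul_gegenbauer hn a
    · intro a
      rw [gegenbauer_eq n 0, jacobi_zero, mul_one, gegenbauerCoeff_gegenbauer]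
      split_ifs <;> norm_num
  rcases le_total b a with hab | hab
  · exact h a b hab
  · rw [mul_comm]; exact h b a hab

lemma sum_gegenbauerCoeff_mul (hn : 2 ≤ n) (p : ℝ[X]) :
    p = ∑ i ∈ ((gegenbauerBasis hn).repr p).support, C (gegenbauerCoeff hn p i) *
      gegenbauer n i := by
  conv_lhs => rw [← (gegenbauerBasis hn).linearCombination_repr p]
  rw [Finsupp.linearCombination_apply, Finsupp.sum]
  refine Finset.sum_congr rfl fun i _ => ?_
  rw [gegenbauerBasis_apply, smul_eq_C_mul]
  rfl

lemma gegenbauerCoeff_mul_nonneg (hn : 2 ≤ n) {p q : ℝ[X]}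
    (hp : ∀ i, 0 ≤ gegenbauerCoeff hn p i) (hq : ∀ i, 0 ≤ gegenbauerCoeff hn q i) (i : ℕ) :
    0 ≤ gegenbauerCoeff hn (p * q) i := by
  rw [sum_gegenbauerCoeff_mul hn p, sum_gegenbauerCoeff_mul hn q, Finset.sum_mul_sum,
    gegenbauerCoeff_sum]
  refine Finset.sum_nonneg fun a _ => ?_
  rw [gegenbauerCoeff_sum]
  refine Finset.sum_nonneg fun b _ => ?_
  have e : C (gegenbauerCoeff hn p a) * gegenbauer n a *
      (C (gegenbauerCoeff hn q b) * gegenbauer n b) =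
      C (gegenbauerCoeff hn p a * gegenbauerCoeff hn q b) *
        (gegenbauer n a * gegenbauer n b) := by
    rw [C_mul]; ring
  rw [e, gegenbauerCoeff_C_mul]
  exact mul_nonneg (mul_nonneg (hp a) (hq b)) (gegenbauerCoeff_mul_gegenbauer_nonneg hn a b i)

/-! ### Positivity of the coefficients of the Levenshtein polynomial -/

lemma gegenbauer_coeff_pos (hn : 2 ≤ n) (d : ℕ) : 0 < (gegenbauer n d).coeff d := by
  induction d with
  | zero => simp [gegenbauer_eq, jacobi_zero]
  | succ d ih =>
    have h := congrArg (fun p : ℝ[X] => p.coeff (d + 1)) (X_mul_gegenbauer hn d)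
    simp only [coeff_X_mul, coeff_add, coeff_C_mul] at h
    have h0 : (gegenbauer n (d - 1)).coeff (d + 1) = 0 := by
      refine coeff_eq_zero_of_degree_lt ?_
      rw [gegenbauer_degree hn]
      exact_mod_cast (by omega : d - 1 < d + 1)
    rw [h0, mul_zero, add_zero] at h
    rw [h] at ih
    exact pos_of_mul_pos_right ih (sub_pos.mpr (gegDown_lt_one (gegParam_ge hn) d)).le

lemma degree_sub_gegenbauer_lt (hn : 2 ≤ n) {p : ℝ[X]} {d : ℕ} (hp : p.degree < (d + 1 : ℕ)) :
    (p - C (p.coeff d / (gegenbauer n d).coeff d) * gegenbauer n d).degree < d := by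
  rw [degree_lt_iff_coeff_zero] at hp ⊢
  intro m hm
  rw [coeff_sub, coeff_C_mul]
  rcases hm.eq_or_lt with rfl | hlt
  · rw [div_mul_cancel₀ _ (gegenbauer_coeff_pos hn d).ne', sub_self]
  · have h0 : (gegenbauer n d).coeff m = 0 := by
      refine coeff_eq_zero_of_degree_lt ?_
      rw [gegenbauer_degree hn]
      exact_mod_cast hlt
    rw [hp m hlt, h0, mul_zero, sub_zero]

lemma gegenbauerCoeff_eq_zero (hn : 2 ≤ n) (d : ℕ) : ∀ {p : ℝ[X]}, p.degree < d →
    ∀ i, d ≤ i → gegenbauerCoeff hn p i = 0 := by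
  induction d with
  | zero =>
    intro p hp i _
    have : p = 0 := by
      exact degree_eq_bot.mp (Nat.WithBot.lt_zero_iff.mp (by exact_mod_cast hp))
    simp [this, gegenbauerCoeff]
  | succ d ih =>
    intro p hp i hi
    have h := ih (degree_sub_gegenbauer_lt hn hp) i (by omega)
    rw [gegenbauerCoeff_sub, gegenbauerCoeff_C_mul, gegenbauerCoeff_gegenbauer,
      if_neg (by omega)] at h
    linarith

lemma gegenbauerCoeff_top (hn : 2 ≤ n) {p : ℝ[X]} {d : ℕ} (hp : p.degree < (d + 1 : ℕ)) :
    gegenbauerCoeff hn p d = p.coeff d / (gegenbauer n d).coeff d := by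
  have h := gegenbauerCoeff_eq_zero hn d (degree_sub_gegenbauer_lt hn hp) d le_rfl
  rw [gegenbauerCoeff_sub, gegenbauerCoeff_C_mul, gegenbauerCoeff_gegenbauer, if_pos rfl] at h
  linarith

/-- The top coefficient is a quotient of leading coefficients, and these multiply. It supplies
strict positivity where the expansion of products only gives nonnegativity. -/
lemma gegenbauerCoeff_top_mul_pos (hn : 2 ≤ n) {p q : ℝ[X]} {a b : ℕ} (hp : p.degree = a)
    (hq : q.degree = b) (hpa : 0 < gegenbauerCoeff hn p a) (hqb : 0 < gegenbauerCoeff hn q b) :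
    0 < gegenbauerCoeff hn (p * q) (a + b) := by
  rw [gegenbauerCoeff_top hn (by rw [hp]; exact_mod_cast a.lt_succ_self)] at hpa
  rw [gegenbauerCoeff_top hn (by rw [hq]; exact_mod_cast b.lt_succ_self)] at hqb
  rw [gegenbauerCoeff_top hn (by rw [degree_mul, hp, hq]; exact_mod_cast (a + b).lt_succ_self)]
  have h1 := (div_pos_iff_of_pos_right (gegenbauer_coeff_pos hn a)).mp hpa
  have h2 := (div_pos_iff_of_pos_right (gegenbauer_coeff_pos hn b)).mp hqb
  refine div_pos ?_ (gegenbauer_coeff_pos hn _)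
  have n1 := natDegree_eq_of_degree_eq_some hp
  have n2 := natDegree_eq_of_degree_eq_some hq
  rw [← n1, ← n2, coeff_mul_degree_add_degree, leadingCoeff, leadingCoeff, n1, n2]
  exact mul_pos h1 h2

/-- The adjacent polynomials with parameters `(1, 0)` have positive Gegenbauer coefficients. -/
lemma gegenbauerCoeff_adjacent_one_zero (hn : 2 ≤ n) (j : ℕ) :
    ∀ i, 0 ≤ gegenbauerCoeff hn (adjacent n 1 0 j) i ∧
      (i ≤ j → 0 < gegenbauerCoeff hn (adjacent n 1 0 j) i) := by
  have hν := gegParam_ge hn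
  induction j with
  | zero =>
    intro i
    have : adjacent n 1 0 0 = gegenbauer n 0 := by
      rw [gegenbauer_eq, adjacent_eq, jacobi_zero, jacobi_zero]
    rw [this, gegenbauerCoeff_gegenbauer]
    constructor
    · split_ifs <;> norm_num
    · intro hi; rw [if_pos (by omega)]; exact one_pos
  | succ j ih =>
    intro i
    have hj : (0 : ℝ) ≤ j := by positivity
    -- Solved for its first term, the lowering relation makes P_{j+1}^{1,0} a positive combination
    -- of the Gegenbauer polynomial of degree j + 1 and P_j^{1,0}.
    have h := congrArg (fun p => gegenbauerCoeff hn p i)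
      (jacobi_lower_left (α := gegParam n) (by linarith) (gegParam n) (j + 1))
    simp only [gegenbauerCoeff_sub, gegenbauerCoeff_C_mul, ← gegenbauer_eq,
      Nat.add_sub_cancel] at h
    have e : ∀ l, jacobi (gegParam n + 1) (gegParam n) l = adjacent n 1 0 l := by
      intro l; simp [adjacent_eq]
    rw [e, e, gegenbauerCoeff_gegenbauer] at h
    push_cast at h
    have c1 : 0 < ((j : ℝ) + 1 + gegParam n + gegParam n + 1) * (j + 1 + gegParam n + 1) :=
      mul_pos (by linarith) (by linarith)
    have c2 : 0 < ((j : ℝ) + 1 + gegParam n) * (j + 1) := mul_pos (by linarith) (by linarith)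
    have c3 : 0 < (2 * ((j : ℝ) + 1) + gegParam n + gegParam n + 1) * (gegParam n + 1) :=
      mul_pos (by linarith) (by linarith)
    have h1 := mul_nonneg c2.le (ih i).1
    constructor
    · refine nonneg_of_mul_nonneg_right (?_ : (0 : ℝ) ≤ _ * _) c1
      split_ifs at h <;> linarith
    · intro hi
      refine pos_of_mul_pos_right (?_ : (0 : ℝ) < _ * _) c1.le
      rcases hi.eq_or_lt with rfl | hlt
      · rw [if_pos rfl] at h
        linarith
      · have h2 := mul_pos c2 ((ih i).2 (by omega))
        rw [if_neg (by omega)] at h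
        linarith

/-- Lowering both parameters in turn; the terms of degree j cancel. Solved for P_{j+1}^{1,1}, it is
a recursion with nonnegative coefficients in steps of two. -/
lemma gegenbauer_eq_sub_adjacent (hn : 2 ≤ n) (j : ℕ) :
    C (2 * (gegParam n + 1) * (2 * (j + 1) + 2 * gegParam n + 1)) * gegenbauer n (j + 1) =
      C ((j + 2 * gegParam n + 2) * (j + 2 * gegParam n + 3)) * adjacent n 1 1 (j + 1) -
        C ((j + 1) * j : ℝ) * adjacent n 1 1 (j - 1) := by
  have hν := gegParam_ge hn
  have hj : (0 : ℝ) ≤ j := by positivity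
  simp only [gegenbauer_eq, adjacent_eq, Nat.cast_one]
  set ν := gegParam n
  have h1 := jacobi_lower_right (α := ν) ν (j + 1)
  have h2 : ∀ i : ℕ, C (2 * (ν + 1)) * jacobi ν (ν + 1) i =
      C (i + 2 * ν + 2) * jacobi (ν + 1) (ν + 1) i -
        C (i : ℝ) * jacobi (ν + 1) (ν + 1) (i - 1) := by
    intro i
    have hi : (0 : ℝ) ≤ i := by positivity
    have h := jacobi_lower_left (α := ν) (by linarith) (ν + 1) i
    have hne : (C (i + ν + 1) : ℝ[X]) ≠ 0 := C_ne_zero.mpr (by linarith)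
    apply mul_left_cancel₀ hne
    rw [mul_sub, ← mul_assoc, ← mul_assoc, ← mul_assoc, ← C_mul, ← C_mul, ← C_mul]
    have e1 : ((i : ℝ) + ν + 1) * (2 * (ν + 1)) = (2 * i + ν + (ν + 1) + 1) * (ν + 1) := by ring
    have e2 : ((i : ℝ) + ν + 1) * (i + 2 * ν + 2) = (i + ν + (ν + 1) + 1) * (i + ν + 1) := by ring
    have e3 : ((i : ℝ) + ν + 1) * i = (i + (ν + 1)) * i := by ring
    rw [e1, e2, e3, h]
  have h3 := h2 (j + 1)
  have h4 := h2 j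
  simp only [Nat.add_sub_cancel] at h1 h3
  push_cast at h1 h3
  have a1 : C (2 * (ν + 1) * (2 * ((j : ℝ) + 1) + 2 * ν + 1)) =
      C (2 * (ν + 1)) * C (2 * ((j : ℝ) + 1) + ν + ν + 1) := by rw [← C_mul]; congr 1; ring
  have a2 : C (((j : ℝ) + 2 * ν + 2) * (j + 2 * ν + 3)) =
      C ((j : ℝ) + 1 + ν + ν + 1) * C ((j : ℝ) + 1 + 2 * ν + 2) := by rw [← C_mul]; congr 1; ring
  have a3 : C (((j : ℝ) + 1) * j) = C ((j : ℝ) + 1) * C (j : ℝ) := by rw [← C_mul]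
  have a4 : C ((j : ℝ) + 1 + ν + ν + 1) = C ((j : ℝ) + 2 * ν + 2) := by congr 1; ring
  rw [a1, a2, a3]
  linear_combination C (2 * (ν + 1)) * h1 + C ((j : ℝ) + 1 + ν + ν + 1) * h3 +
    C ((j : ℝ) + 1) * h4 - C ((j : ℝ) + 1) * jacobi (ν + 1) (ν + 1) j * a4

/-- The adjacent polynomials with parameters `(1, 1)` have nonnegative Gegenbauer coefficients. -/
lemma gegenbauerCoeff_adjacent_one_one (hn : 2 ≤ n) (j : ℕ) :
    (∀ i, 0 ≤ gegenbauerCoeff hn (adjacent n 1 1 j) i) ∧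
      0 < gegenbauerCoeff hn (adjacent n 1 1 j) j := by
  have hν := gegParam_ge hn
  induction j using Nat.strong_induction_on with
  | _ j ih =>
    rcases j with _ | j
    · have : adjacent n 1 1 0 = gegenbauer n 0 := by
        rw [gegenbauer_eq, adjacent_eq, jacobi_zero, jacobi_zero]
      rw [this]
      simp only [gegenbauerCoeff_gegenbauer]
      exact ⟨fun i => by split_ifs <;> norm_num, by simp⟩
    · have hj : (0 : ℝ) ≤ j := by positivity
      have h : ∀ i, _ := fun i => congrArg (fun p => gegenbauerCoeff hn p i)
        (gegenbauer_eq_sub_adjacent hn j)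
      simp only [gegenbauerCoeff_sub, gegenbauerCoeff_C_mul, gegenbauerCoeff_gegenbauer] at h
      have c1 : 0 < ((j : ℝ) + 2 * gegParam n + 2) * (j + 2 * gegParam n + 3) :=
        mul_pos (by linarith) (by linarith)
      have c2 : 0 ≤ ((j : ℝ) + 1) * j := by positivity
      have c3 : 0 < 2 * (gegParam n + 1) * (2 * ((j : ℝ) + 1) + 2 * gegParam n + 1) :=
        mul_pos (by linarith) (by linarith)
      -- For j = 0 the truncated index j - 1 is harmless, because its coefficient (j + 1) j is zero.
      have h1 := fun i => mul_nonneg c2 ((ih (j - 1) (by omega)).1 i)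
      constructor
      · intro i
        refine nonneg_of_mul_nonneg_right (?_ : (0 : ℝ) ≤ _ * _) c1
        have h2 := h i
        have h3 := h1 i
        split_ifs at h2 <;> linarith
      · refine pos_of_mul_pos_right (?_ : (0 : ℝ) < _ * _) c1.le
        have h2 := h (j + 1)
        have h3 := h1 (j + 1)
        rw [if_pos rfl] at h2
        linarith

lemma gegenbauerCoeff_adjacent (hn : 2 ≤ n) {ε : ℕ} (hε : ε ≤ 1) (j : ℕ) :
    (∀ i, 0 ≤ gegenbauerCoeff hn (adjacent n 1 ε j) i) ∧
      0 < gegenbauerCoeff hn (adjacent n 1 ε j) j := by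
  interval_cases ε
  · have h := gegenbauerCoeff_adjacent_one_zero hn j
    exact ⟨fun i => (h i).1, (h j).2 le_rfl⟩
  · exact gegenbauerCoeff_adjacent_one_one hn j

/-- For ε = 1 the product (X + 1) P_j^{1,1} is a positive combination of P_{j+1}^{1,0} and
P_j^{1,0}. The factor X + 1 thus gives strict positivity in all degrees, which P_j^{1,1} alone lacks
by parity. -/
lemma gegenbauerCoeff_weight_adjacent (hn : 2 ≤ n) {ε : ℕ} (hε : ε ≤ 1) (j i : ℕ) :
    0 ≤ gegenbauerCoeff hn ((X + 1) ^ ε * adjacent n 1 ε j) i ∧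
      (i ≤ j + ε → 0 < gegenbauerCoeff hn ((X + 1) ^ ε * adjacent n 1 ε j) i) := by
  have hν := gegParam_ge hn
  interval_cases ε
  · simpa using gegenbauerCoeff_adjacent_one_zero hn j i
  · have hj : (0 : ℝ) ≤ j := by positivity
    have h := congrArg (fun p => gegenbauerCoeff hn p i)
      (jacobi_raise_right (α := gegParam n + 1) (by linarith) (gegParam n) j)
    have e : ∀ l, jacobi (gegParam n + 1) (gegParam n) l = adjacent n 1 0 l := by
      intro l; simp [adjacent_eq]
    have e' : jacobi (gegParam n + 1) (gegParam n + 1) j = adjacent n 1 1 j := by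
      simp [adjacent_eq]
    simp only [gegenbauerCoeff_add, gegenbauerCoeff_C_mul, e, e'] at h
    rw [pow_one]
    have h1 := gegenbauerCoeff_adjacent_one_zero hn (j + 1) i
    have h2 := gegenbauerCoeff_adjacent_one_zero hn j i
    have c1 : 0 < 2 * (j : ℝ) + (gegParam n + 1) + gegParam n + 2 := by linarith
    have c2 : 0 < 2 * ((j : ℝ) + 1 + (gegParam n + 1)) := by linarith
    have c3 : 0 < 2 * ((j : ℝ) + gegParam n + 1) := by linarith
    have h3 := mul_nonneg c3.le h2.1
    constructor
    · refine nonneg_of_mul_nonneg_right (?_ : (0 : ℝ) ≤ _ * _) c1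
      have := mul_nonneg c2.le h1.1
      linarith
    · intro hi
      refine pos_of_mul_pos_right (?_ : (0 : ℝ) < _ * _) c1.le
      have := mul_pos c2 (h1.2 hi)
      linarith

/-- The Gegenbauer coefficients of the Levenshtein polynomial are positive. -/
lemma gegenbauerCoeff_levenshtein_pos (hn : 2 ≤ n) {ε k : ℕ} (hε : ε ≤ 1) {s : ℝ} (hs : s < 1)
    (hpos : ∀ t, s ≤ t → 0 < (adjacent n 1 ε k).eval t)
    (hnp : (adjacent n 1 ε (k + 1)).eval s ≤ 0) {i : ℕ} (hi : i ≤ 2 * k + 1 + ε) :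
    0 < gegenbauerCoeff hn
      ((X - C s) * (X + 1) ^ ε * levenshteinKernel n ε (k + 1) s ^ 2) i := by
  set κ := kernelFactor n ε k with hκ
  have hκ0 : 0 < κ := kernelFactor_pos hn ε k
  let r : ℕ → ℝ := fun j => jacobiInvNormSq (1 + ((n : ℝ) - 3) / 2) (ε + ((n : ℝ) - 3) / 2) j *
      (adjacent n 1 ε j).eval s
  have hr : ∀ j ∈ Finset.range (k + 1), 0 < r j := by
    intro j hj
    have h1 := adjacentInvNormSq_pos hn ε j
    rw [gegParam, add_comm _ (1 : ℝ), add_comm _ (ε : ℝ)] at h1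
    exact mul_pos h1 (adjacent_pos_of_le hn hs hpos
      (Nat.lt_succ_iff.mp (Finset.mem_range.mp hj)) s le_rfl)
  -- Christoffel-Darboux replaces (X - s) T by a combination whose coefficients P_k(s) and
  -- -P_{k+1}(s) are positive and nonnegative; the other factor T is a positive combination of the
  -- P_j with j ≤ k.
  have e : (X - C s) * (X + 1) ^ ε * levenshteinKernel n ε (k + 1) s ^ 2 =
      C κ * ∑ j ∈ Finset.range (k + 1), C (r j) *
        (C ((adjacent n 1 ε k).eval s) *
            ((X + 1) ^ ε * adjacent n 1 ε (k + 1) * adjacent n 1 ε j) +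
          C (-(adjacent n 1 ε (k + 1)).eval s) *
            ((X + 1) ^ ε * adjacent n 1 ε k * adjacent n 1 ε j)) := by
    have cd := X_sub_C_mul_levenshteinKernel hn ε k s
    have e1 : (X - C s) * (X + 1) ^ ε * levenshteinKernel n ε (k + 1) s ^ 2 =
        ((X - C s) * levenshteinKernel n ε (k + 1) s) * (X + 1) ^ ε *
          levenshteinKernel n ε (k + 1) s := by ring
    rw [e1, cd, levenshteinKernel, Finset.mul_sum, Finset.mul_sum]
    refine Finset.sum_congr rfl fun j _ => ?_
    simp only [C_neg, ← hκ, r]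
    ring
  have hP := hpos s le_rfl
  have w := gegenbauerCoeff_weight_adjacent hn hε
  have hnn : ∀ l j i, 0 ≤ gegenbauerCoeff hn
      ((X + 1) ^ ε * adjacent n 1 ε l * adjacent n 1 ε j) i := fun l j i =>
    gegenbauerCoeff_mul_nonneg hn (fun i => (w l i).1)
      (gegenbauerCoeff_adjacent hn hε j).1 i
  rw [e, gegenbauerCoeff_C_mul, gegenbauerCoeff_sum]
  refine mul_pos hκ0 ?_
  have hterm : ∀ j ∈ Finset.range (k + 1), 0 ≤ (adjacent n 1 ε k).eval s * gegenbauerCoeff hn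
      ((X + 1) ^ ε * adjacent n 1 ε (k + 1) * adjacent n 1 ε j) i ∧
      0 ≤ -(adjacent n 1 ε (k + 1)).eval s * gegenbauerCoeff hn
      ((X + 1) ^ ε * adjacent n 1 ε k * adjacent n 1 ε j) i := fun j _ =>
    ⟨mul_nonneg hP.le (hnn _ _ _), mul_nonneg (neg_nonneg.mpr hnp) (hnn _ _ _)⟩
  obtain ⟨j, hj, hpj⟩ : ∃ j ∈ Finset.range (k + 1), 0 < gegenbauerCoeff hn
      ((X + 1) ^ ε * adjacent n 1 ε (k + 1) * adjacent n 1 ε j) i := by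
    -- Up to degree k + 1 + ε the term with P_0 = 1 suffices. Above that, j is chosen so that i is
    -- the top degree of the product, which needs j ≤ k.
    rcases le_or_gt i (k + 1 + ε) with h | h
    · refine ⟨0, by simp, ?_⟩
      have : adjacent n 1 ε 0 = 1 := by rw [adjacent_eq, jacobi_zero]
      rw [this, mul_one]
      exact (w (k + 1) i).2 h
    · refine ⟨i - (k + 1 + ε), Finset.mem_range.mpr (by omega), ?_⟩
      obtain ⟨j, rfl⟩ : ∃ j, i = k + 1 + ε + j := ⟨i - (k + 1 + ε), by omega⟩
      rw [Nat.add_sub_cancel_left]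
      refine gegenbauerCoeff_top_mul_pos hn ?_ (adjacent_degree hn 1 ε j)
        ((w (k + 1) _).2 le_rfl) (gegenbauerCoeff_adjacent hn hε j).2
      have hX : (X + 1 : ℝ[X]).degree = 1 := by simpa using degree_X_add_C (1 : ℝ)
      rw [degree_mul, degree_pow, hX, adjacent_degree hn]
      push_cast
      rw [nsmul_one, add_comm]
  simp only [gegenbauerCoeff_C_mul, gegenbauerCoeff_add]
  refine Finset.sum_pos' (fun j hj => ?_) ⟨j, hj, ?_⟩
  · exact mul_nonneg (hr j hj).le (add_nonneg (hterm j hj).1 (hterm j hj).2)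
  · exact mul_pos (hr j hj) (add_pos_of_pos_of_nonneg (mul_pos hP hpj) (hterm j hj).2)

end

section

/-! ### Positive definiteness of the Gegenbauer polynomials -/

section Fischer

/-! ### The Fischer inner product -/

lemma pderiv_comm {σ : Type*} (i j : σ) (p : MvPolynomial σ ℝ) :
    MvPolynomial.pderiv i (MvPolynomial.pderiv j p) =
      MvPolynomial.pderiv j (MvPolynomial.pderiv i p) := by
  classical
  ext d
  simp only [MvPolynomial.coeff_pderiv, Finsupp.add_apply, Finsupp.single_apply]
  rw [add_right_comm]
  rcases eq_or_ne i j with rfl | h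
  · ring
  · rw [if_neg h, if_neg h.symm]; push_cast; ring

variable {σ : Type*} [Fintype σ]

/-- The product of the factorials of the exponents. -/
def multiFactorial (d : σ →₀ ℕ) : ℝ := ∏ i, ((d i).factorial : ℝ)

lemma multiFactorial_pos (d : σ →₀ ℕ) : 0 < multiFactorial d :=
  Finset.prod_pos fun i _ => by positivity

lemma multiFactorial_add_single (d : σ →₀ ℕ) (i : σ) :
    multiFactorial (d + Finsupp.single i 1) = multiFactorial d * (d i + 1) := by
  classical
  unfold multiFactorial
  rw [← Finset.mul_prod_erase _ _ (Finset.mem_univ i),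
    ← Finset.mul_prod_erase (a := i) _ (fun j => ((d j).factorial : ℝ)) (Finset.mem_univ i)]
  have h : ∏ j ∈ Finset.univ.erase i, (((d + Finsupp.single i 1 : σ →₀ ℕ) j).factorial : ℝ) =
      ∏ j ∈ Finset.univ.erase i, ((d j).factorial : ℝ) := by
    refine Finset.prod_congr rfl fun j hj => ?_
    have : i ≠ j := (Finset.ne_of_mem_erase hj).symm
    simp [this]
  rw [h]
  simp only [Finsupp.add_apply, Finsupp.single_eq_same, Nat.factorial_succ]
  push_cast
  ring

/-- The Fischer inner product on polynomials, `⟨p, q⟩ = (p(∂) q)(0)`. -/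
def fischer : MvPolynomial σ ℝ →ₗ[ℝ] MvPolynomial σ ℝ →ₗ[ℝ] ℝ :=
  (MvPolynomial.basisMonomials σ ℝ).constr ℝ
    fun d => multiFactorial d • MvPolynomial.lcoeff ℝ d

lemma fischer_monomial (d : σ →₀ ℕ) (q : MvPolynomial σ ℝ) :
    fischer (MvPolynomial.monomial d 1) q = multiFactorial d * MvPolynomial.coeff d q := by
  have h := (MvPolynomial.basisMonomials σ ℝ).constr_basis ℝ
    (fun d => multiFactorial d • MvPolynomial.lcoeff ℝ d) d
  rw [MvPolynomial.coe_basisMonomials] at h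
  rw [fischer, h]
  simp

lemma fischer_eq_sum (p q : MvPolynomial σ ℝ) :
    fischer p q = ∑ d ∈ p.support,
      MvPolynomial.coeff d p * (multiFactorial d * MvPolynomial.coeff d q) := by
  conv_lhs => rw [p.as_sum]
  rw [map_sum, LinearMap.sum_apply]
  refine Finset.sum_congr rfl fun d _ => ?_
  rw [← fischer_monomial, ← smul_eq_mul, ← LinearMap.smul_apply, ← map_smul,
    MvPolynomial.smul_monomial, smul_eq_mul, mul_one]

/-- The form is diagonal in the monomials, with positive entries. -/
lemma fischer_self_nonneg (p : MvPolynomial σ ℝ) : 0 ≤ fischer p p := by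
  rw [fischer_eq_sum]
  refine Finset.sum_nonneg fun d _ => ?_
  have := multiFactorial_pos d
  nlinarith [mul_nonneg this.le (mul_self_nonneg (MvPolynomial.coeff d p))]

/-- Multiplication by a variable is adjoint to the partial derivative. -/
lemma fischer_X_mul (i : σ) (p q : MvPolynomial σ ℝ) :
    fischer (MvPolynomial.X i * p) q = fischer p (MvPolynomial.pderiv i q) := by
  induction p using MvPolynomial.induction_on' with
  | monomial d a =>
    have e : ∀ d : σ →₀ ℕ, MvPolynomial.monomial d a = a • MvPolynomial.monomial d (1 : ℝ) := by
      intro d; rw [MvPolynomial.smul_monomial, smul_eq_mul, mul_one]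
    have e2 : MvPolynomial.X i * MvPolynomial.monomial d a =
        MvPolynomial.monomial (d + Finsupp.single i 1) a := by
      rw [mul_comm, MvPolynomial.X, MvPolynomial.monomial_mul, mul_one]
    rw [e2, e, e d, map_smul, map_smul, LinearMap.smul_apply, LinearMap.smul_apply,
      fischer_monomial, fischer_monomial, multiFactorial_add_single, MvPolynomial.coeff_pderiv]
    ring
  | add p₁ p₂ h₁ h₂ =>
    rw [mul_add, map_add, map_add, LinearMap.add_apply, LinearMap.add_apply, h₁, h₂]

/-- The linear form `x ↦ x ⬝ y`. -/
def linForm (y : σ → ℝ) : MvPolynomial σ ℝ := ∑ i, MvPolynomial.C (y i) * MvPolynomial.X i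

/-- The squared Euclidean norm. -/
def normSqPoly : MvPolynomial σ ℝ := ∑ i, MvPolynomial.X i * MvPolynomial.X i

/-- The derivative in the direction `y`. -/
def dirDeriv (y : σ → ℝ) (p : MvPolynomial σ ℝ) : MvPolynomial σ ℝ :=
  ∑ i, MvPolynomial.C (y i) * MvPolynomial.pderiv i p

/-- The Laplacian. -/
def laplacian (p : MvPolynomial σ ℝ) : MvPolynomial σ ℝ :=
  ∑ i, MvPolynomial.pderiv i (MvPolynomial.pderiv i p)

lemma pderiv_linForm (y : σ → ℝ) (i : σ) :
    MvPolynomial.pderiv i (linForm y) = MvPolynomial.C (y i) := by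
  classical
  rw [linForm, map_sum, Finset.sum_eq_single i]
  · rw [MvPolynomial.pderiv_C_mul, MvPolynomial.pderiv_X_self, mul_one]
  · intro j _ hj
    rw [MvPolynomial.pderiv_C_mul, MvPolynomial.pderiv_X_of_ne hj, mul_zero]
  · simp

lemma pderiv_normSqPoly (i : σ) :
    MvPolynomial.pderiv i (normSqPoly : MvPolynomial σ ℝ) = 2 * MvPolynomial.X i := by
  classical
  rw [normSqPoly, map_sum, Finset.sum_eq_single i]
  · rw [MvPolynomial.pderiv_mul, MvPolynomial.pderiv_X_self]; ring
  · intro j _ hj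
    rw [MvPolynomial.pderiv_mul, MvPolynomial.pderiv_X_of_ne hj]; ring
  · simp

lemma fischer_linForm_mul (y : σ → ℝ) (p q : MvPolynomial σ ℝ) :
    fischer (linForm y * p) q = fischer p (dirDeriv y q) := by
  rw [linForm, dirDeriv, Finset.sum_mul, map_sum, LinearMap.sum_apply, map_sum]
  refine Finset.sum_congr rfl fun i _ => ?_
  rw [mul_assoc, ← MvPolynomial.smul_eq_C_mul, ← MvPolynomial.smul_eq_C_mul, map_smul, map_smul,
    LinearMap.smul_apply, fischer_X_mul]

lemma fischer_normSqPoly_mul (p q : MvPolynomial σ ℝ) :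
    fischer (normSqPoly * p) q = fischer p (laplacian q) := by
  rw [normSqPoly, laplacian, Finset.sum_mul, map_sum, LinearMap.sum_apply, map_sum]
  refine Finset.sum_congr rfl fun i _ => ?_
  rw [mul_assoc, fischer_X_mul, fischer_X_mul]

lemma dirDeriv_mul (y : σ → ℝ) (p q : MvPolynomial σ ℝ) :
    dirDeriv y (p * q) = dirDeriv y p * q + p * dirDeriv y q := by
  simp only [dirDeriv, MvPolynomial.pderiv_mul, Finset.sum_mul, Finset.mul_sum,
    ← Finset.sum_add_distrib]
  exact Finset.sum_congr rfl fun i _ => by ring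

lemma dirDeriv_C_mul (y : σ → ℝ) (c : ℝ) (p : MvPolynomial σ ℝ) :
    dirDeriv y (MvPolynomial.C c * p) = MvPolynomial.C c * dirDeriv y p := by
  simp only [dirDeriv, MvPolynomial.pderiv_C_mul, Finset.mul_sum]
  exact Finset.sum_congr rfl fun i _ => by ring

lemma dirDeriv_sub (y : σ → ℝ) (p q : MvPolynomial σ ℝ) :
    dirDeriv y (p - q) = dirDeriv y p - dirDeriv y q := by
  simp only [dirDeriv, map_sub, mul_sub, Finset.sum_sub_distrib]

lemma dirDeriv_linForm {y : σ → ℝ} (hy : ∑ i, y i ^ 2 = 1) : dirDeriv y (linForm y) = 1 := by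
  simp only [dirDeriv, pderiv_linForm, ← MvPolynomial.C_mul, ← map_sum]
  rw [← MvPolynomial.C_1, ← hy]
  congr 1
  exact Finset.sum_congr rfl fun i _ => by ring

lemma dirDeriv_normSqPoly (y : σ → ℝ) : dirDeriv y normSqPoly = 2 * linForm y := by
  simp only [dirDeriv, pderiv_normSqPoly, linForm, Finset.mul_sum]
  exact Finset.sum_congr rfl fun i _ => by ring

lemma laplacian_C_mul (c : ℝ) (p : MvPolynomial σ ℝ) :
    laplacian (MvPolynomial.C c * p) = MvPolynomial.C c * laplacian p := by
  simp only [laplacian, MvPolynomial.pderiv_C_mul, Finset.mul_sum]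

lemma laplacian_sub (p q : MvPolynomial σ ℝ) :
    laplacian (p - q) = laplacian p - laplacian q := by
  simp only [laplacian, map_sub, Finset.sum_sub_distrib]

lemma laplacian_linForm_mul (y : σ → ℝ) (p : MvPolynomial σ ℝ) :
    laplacian (linForm y * p) = 2 * dirDeriv y p + linForm y * laplacian p := by
  simp only [laplacian, dirDeriv, MvPolynomial.pderiv_mul, pderiv_linForm, map_add,
    MvPolynomial.pderiv_C, Finset.mul_sum, ← Finset.sum_add_distrib]
  exact Finset.sum_congr rfl fun i _ => by ring

/-- The mixed terms of the product rule form 4 ∑ X_i ∂_i p, which Euler's identity evaluates. -/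
lemma laplacian_normSqPoly_mul {d : ℕ} {p : MvPolynomial σ ℝ} (hp : p.IsHomogeneous d) :
    laplacian (normSqPoly * p) = MvPolynomial.C (2 * Fintype.card σ + 4 * d : ℝ) * p +
      normSqPoly * laplacian p := by
  have h2 : (2 : MvPolynomial σ ℝ) = MvPolynomial.C 2 := (map_ofNat MvPolynomial.C 2).symm
  have e : laplacian (normSqPoly * p) = ∑ _i : σ, 2 * p +
      4 * ∑ i, MvPolynomial.X i * MvPolynomial.pderiv i p + normSqPoly * laplacian p := by
    simp only [laplacian, MvPolynomial.pderiv_mul, pderiv_normSqPoly, map_add, Finset.mul_sum,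
      ← Finset.sum_add_distrib]
    refine Finset.sum_congr rfl fun i _ => ?_
    rw [h2, MvPolynomial.pderiv_C, MvPolynomial.pderiv_X_self, ← h2]
    ring
  rw [e, hp.sum_X_mul_pderiv, Finset.sum_const, Finset.card_univ]
  simp only [nsmul_eq_mul, map_add, map_mul, map_natCast, map_ofNat]
  ring

lemma laplacian_dirDeriv (y : σ → ℝ) (p : MvPolynomial σ ℝ) :
    laplacian (dirDeriv y p) = dirDeriv y (laplacian p) := by
  simp only [laplacian, dirDeriv, map_sum, MvPolynomial.pderiv_C_mul, Finset.mul_sum]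
  rw [Finset.sum_comm]
  refine Finset.sum_congr rfl fun i _ => Finset.sum_congr rfl fun j _ => ?_
  rw [pderiv_comm j i, pderiv_comm j i]

lemma dirDeriv_isHomogeneous (y : σ → ℝ) {p : MvPolynomial σ ℝ} {d : ℕ}
    (hp : p.IsHomogeneous (d + 1)) : (dirDeriv y p).IsHomogeneous d := by
  refine MvPolynomial.IsHomogeneous.sum _ _ _ fun i _ => ?_
  exact (hp.pderiv (i := i)).C_mul _

lemma eval_dirDeriv_self (y : σ → ℝ) {p : MvPolynomial σ ℝ} {d : ℕ} (hp : p.IsHomogeneous d) :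
    MvPolynomial.eval y (dirDeriv y p) = d * MvPolynomial.eval y p := by
  have h := congrArg (MvPolynomial.eval y) hp.sum_X_mul_pderiv
  simpa [dirDeriv] using h

lemma dirDeriv_zero (y : σ → ℝ) : dirDeriv y (0 : MvPolynomial σ ℝ) = 0 := by simp [dirDeriv]

/-! ### Zonal harmonics and their reproducing property -/

lemma gegDown_mul {ν : ℝ} (hν : -1 / 2 ≤ ν) (k : ℕ) :
    gegDown ν k * (2 * k + 2 * ν + 1) = k := by
  rcases k with _ | k
  · simp [gegDown_zero]
  · have hk : (0 : ℝ) ≤ k := by positivity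
    unfold gegDown
    rw [div_mul_cancel₀]
    push_cast
    linarith

/-- The homogeneous extension of the zonal function `x ↦ P_k(x ⬝ y)`, where `P_k` is the
ultraspherical polynomial with parameter `ν`. -/
def zonal (ν : ℝ) (y : σ → ℝ) : ℕ → MvPolynomial σ ℝ
  | 0 => 1
  | 1 => linForm y
  | k + 2 => MvPolynomial.C (1 - gegDown ν (k + 1))⁻¹ * (linForm y * zonal ν y (k + 1) -
      MvPolynomial.C (gegDown ν (k + 1)) * (normSqPoly * zonal ν y k))

variable {ν : ℝ} {y : σ → ℝ}

lemma zonal_recurrence (hν : -1 / 2 ≤ ν) (y : σ → ℝ) (k : ℕ) :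
    MvPolynomial.C (1 - gegDown ν k) * zonal ν y (k + 1) = linForm y * zonal ν y k -
      MvPolynomial.C (gegDown ν k) * (normSqPoly * zonal ν y (k - 1)) := by
  rcases k with _ | k
  · simp [zonal, gegDown_zero]
  · have h : 1 - gegDown ν (k + 1) ≠ 0 := (sub_pos.mpr (gegDown_lt_one hν _)).ne'
    rw [zonal, ← mul_assoc, ← MvPolynomial.C_mul, mul_inv_cancel₀ h, MvPolynomial.C_1, one_mul,
      Nat.add_sub_cancel]

lemma zonal_eq (hν : -1 / 2 ≤ ν) (y : σ → ℝ) (k : ℕ) :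
    zonal ν y (k + 1) = MvPolynomial.C (1 - gegDown ν k)⁻¹ * (linForm y * zonal ν y k -
      MvPolynomial.C (gegDown ν k) * (normSqPoly * zonal ν y (k - 1))) := by
  have h : 1 - gegDown ν k ≠ 0 := (sub_pos.mpr (gegDown_lt_one hν _)).ne'
  rw [← zonal_recurrence hν, ← mul_assoc, ← MvPolynomial.C_mul, inv_mul_cancel₀ h,
    MvPolynomial.C_1, one_mul]

lemma linForm_isHomogeneous (y : σ → ℝ) : (linForm y).IsHomogeneous 1 := by
  refine MvPolynomial.IsHomogeneous.sum _ _ _ fun i _ => ?_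
  exact (MvPolynomial.isHomogeneous_X ℝ i).C_mul _

lemma normSqPoly_isHomogeneous : (normSqPoly : MvPolynomial σ ℝ).IsHomogeneous 2 := by
  refine MvPolynomial.IsHomogeneous.sum _ _ _ fun i _ => ?_
  exact (MvPolynomial.isHomogeneous_X ℝ i).mul (MvPolynomial.isHomogeneous_X ℝ i)

lemma zonal_isHomogeneous (hν : -1 / 2 ≤ ν) (y : σ → ℝ) (k : ℕ) :
    (zonal ν y k).IsHomogeneous k := by
  induction k using Nat.strong_induction_on with
  | _ k ih =>
    rcases k with _ | k
    · exact MvPolynomial.isHomogeneous_one _ _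
    rw [zonal_eq hν]
    refine MvPolynomial.IsHomogeneous.C_mul (MvPolynomial.IsHomogeneous.sub ?_ ?_) _
    · rw [add_comm k 1]
      exact (linForm_isHomogeneous y).mul (ih k (by omega))
    · rcases k with _ | k
      · rw [gegDown_zero, MvPolynomial.C_0, zero_mul]
        exact MvPolynomial.isHomogeneous_zero _ _ _
      · refine MvPolynomial.IsHomogeneous.C_mul ?_ _
        have e : k + 1 + 1 = 2 + (k + 1 - 1) := by omega
        rw [e]
        exact normSqPoly_isHomogeneous.mul (ih (k + 1 - 1) (by omega))

/-- On the unit sphere the norm polynomial is 1 and the linear form is the inner product, so the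
recurrence of `zonal` becomes that of the ultraspherical polynomials. -/
lemma eval_zonal (hν : -1 / 2 ≤ ν) (y : σ → ℝ) {x : σ → ℝ} (hx : ∑ i, x i ^ 2 = 1) (k : ℕ) :
    MvPolynomial.eval x (zonal ν y k) = (jacobi ν ν k).eval (∑ i, x i * y i) := by
  have hl : MvPolynomial.eval x (linForm y) = ∑ i, x i * y i := by
    simp [linForm, mul_comm]
  have hr : MvPolynomial.eval x (normSqPoly : MvPolynomial σ ℝ) = 1 := by
    rw [← hx]; simp [normSqPoly, sq]
  induction k using Nat.strong_induction_on with
  | _ k ih =>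
    rcases k with _ | k
    · simp [zonal, jacobi_zero]
    have h := congrArg (MvPolynomial.eval x) (zonal_recurrence hν y k)
    simp only [map_mul, map_sub, MvPolynomial.eval_C, hl, hr, one_mul] at h
    rw [ih k (by omega), ih (k - 1) (by omega), ultraspherical_recurrence_eval hν] at h
    apply mul_left_cancel₀ (sub_pos.mpr (gegDown_lt_one hν k)).ne'
    linarith

/-- Differentiating the recurrence leaves, for |y| = 1, a combination of terms that the recurrence
one index lower reduces to a multiple of the claimed polynomial. This evaluates the cross term in
the Laplacian of `zonal`. -/
lemma dirDeriv_zonal (hν : -1 / 2 ≤ ν) (hy : ∑ i, y i ^ 2 = 1) (k : ℕ) :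
    dirDeriv y (zonal ν y k) = MvPolynomial.C (k : ℝ) * zonal ν y (k - 1) := by
  induction k using Nat.strong_induction_on with
  | _ k ih =>
    rcases k with _ | k
    · simp [zonal, dirDeriv]
    have hga : 1 - gegDown ν k ≠ 0 := (sub_pos.mpr (gegDown_lt_one hν k)).ne'
    have hga' : (MvPolynomial.C (1 - gegDown ν k) : MvPolynomial σ ℝ) ≠ 0 :=
      (map_ne_zero_iff _ (MvPolynomial.C_injective σ ℝ)).mpr hga
    apply mul_left_cancel₀ hga'
    rw [← dirDeriv_C_mul, zonal_recurrence hν, dirDeriv_sub, dirDeriv_C_mul, dirDeriv_mul,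
      dirDeriv_mul, dirDeriv_linForm hy, dirDeriv_normSqPoly, ih k (by omega),
      ih (k - 1) (by omega)]
    rcases k with _ | k
    · simp [gegDown_zero]
    · have hk : (0 : ℝ) ≤ k := by positivity
      have h := zonal_recurrence hν y k
      simp only [Nat.add_sub_cancel]
      have c2 : (((k : ℝ) + 1) - 2 * gegDown ν (k + 1)) * gegDown ν k =
          gegDown ν (k + 1) * k := by
        have g1 := gegDown_mul hν k
        have g2 := gegDown_mul hν (k + 1)
        push_cast at g2
        linear_combination gegDown ν (k + 1) * g1 - gegDown ν k * g2
      have c1 : 1 + (((k : ℝ) + 1) - 2 * gegDown ν (k + 1)) * (1 - gegDown ν k) =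
          (1 - gegDown ν (k + 1)) * (k + 1 + 1) := by
        linear_combination -c2
      have C1 := congrArg (MvPolynomial.C (σ := σ)) c1
      have C2 := congrArg (MvPolynomial.C (σ := σ)) c2
      simp only [map_mul, map_sub, map_add, MvPolynomial.C_1, map_ofNat] at C1 C2 h
      push_cast
      simp only [map_sub, map_add, MvPolynomial.C_1]
      linear_combination (MvPolynomial.C (k : ℝ) + 1 - 2 * MvPolynomial.C (gegDown ν (k + 1))) *
        (-h) + zonal ν y (k + 1) * C1 + normSqPoly * zonal ν y (k - 1) * C2

/-- With d variables and step index k ≥ 1, the Laplacian of the recurrence leaves a multiple of 2k -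
`gegDown ν k` (2d + 4(k - 1)), and this is zero precisely because 2ν + 3 = d. Here the parameter is
tied to the dimension. -/
lemma laplacian_zonal (hν : ν = ((Fintype.card σ : ℝ) - 3) / 2) (hν' : -1 / 2 ≤ ν)
    (hy : ∑ i, y i ^ 2 = 1) (k : ℕ) : laplacian (zonal ν y k) = 0 := by
  induction k using Nat.strong_induction_on with
  | _ k ih =>
    rcases k with _ | k
    · simp [zonal, laplacian]
    rw [zonal_eq hν', laplacian_C_mul, laplacian_sub, laplacian_C_mul, laplacian_linForm_mul,
      laplacian_normSqPoly_mul (zonal_isHomogeneous hν' y (k - 1)), ih k (by omega),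
      ih (k - 1) (by omega), dirDeriv_zonal hν' hy]
    rcases k with _ | k
    · simp [gegDown_zero]
    · have hk : (0 : ℝ) ≤ k := by positivity
      have hc : (Fintype.card σ : ℝ) = 2 * ν + 3 := by rw [hν]; ring
      have c : 2 * ((k : ℝ) + 1) = gegDown ν (k + 1) * (2 * Fintype.card σ + 4 * k) := by
        have g := gegDown_mul hν' (k + 1)
        push_cast at g
        rw [hc]
        linear_combination -2 * g
      have Cc := congrArg (MvPolynomial.C (σ := σ)) c
      simp only [Nat.add_sub_cancel, mul_zero, add_zero]
      push_cast
      simp only [map_mul, map_add, MvPolynomial.C_1, map_ofNat] at Cc ⊢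
      linear_combination MvPolynomial.C (1 - gegDown ν (k + 1))⁻¹ * zonal ν y k * Cc

/-- The norming constants in the reproducing property of the zonal harmonics. -/
def zonalConst (ν : ℝ) : ℕ → ℝ
  | 0 => 1
  | k + 1 => zonalConst ν k * (k + 1) / (1 - gegDown ν k)

lemma zonalConst_pos (hν : -1 / 2 ≤ ν) (k : ℕ) : 0 < zonalConst ν k := by
  induction k with
  | zero => exact one_pos
  | succ k ih =>
    have := sub_pos.mpr (gegDown_lt_one hν k)
    rw [zonalConst]
    positivity

/-- The reproducing property of the zonal harmonics for the Fischer inner product. -/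
lemma fischer_zonal (hν : -1 / 2 ≤ ν) (y : σ → ℝ) (k : ℕ) : ∀ {q : MvPolynomial σ ℝ},
    q.IsHomogeneous k → laplacian q = 0 →
      fischer (zonal ν y k) q = zonalConst ν k * MvPolynomial.eval y q := by
  induction k with
  | zero =>
    intro q hq _
    obtain ⟨c, rfl⟩ : ∃ c, q = MvPolynomial.C c :=
      ⟨_, (MvPolynomial.totalDegree_eq_zero_iff_eq_C.mp (by simpa using hq.totalDegree_le))⟩
    have h := fischer_monomial (0 : σ →₀ ℕ) (MvPolynomial.C c)
    have h1 : (MvPolynomial.monomial (0 : σ →₀ ℕ) (1 : ℝ)) = zonal ν y 0 := rfl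
    rw [h1] at h
    rw [h]
    simp [multiFactorial, zonalConst]
  | succ k ih =>
    intro q hq hΔ
    have hga := (sub_pos.mpr (gegDown_lt_one hν k)).ne'
    -- Passing to adjoints, the linear form becomes ∂_y and the norm polynomial becomes the
    -- Laplacian, which kills q. Then ∂_y q is again harmonic, of degree one less, and Euler's
    -- identity gives its value at y as (k + 1) q(y).
    rw [zonal_eq hν, ← MvPolynomial.smul_eq_C_mul, ← MvPolynomial.smul_eq_C_mul, map_smul, map_sub,
      map_smul, LinearMap.smul_apply, LinearMap.sub_apply, LinearMap.smul_apply,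
      fischer_linForm_mul, fischer_normSqPoly_mul, hΔ, map_zero,
      ih (dirDeriv_isHomogeneous y hq) (by rw [laplacian_dirDeriv, hΔ, dirDeriv_zero]),
      eval_dirDeriv_self y hq, zonalConst]
    simp only [smul_eq_mul, mul_zero, sub_zero]
    push_cast
    field_simp

end Fischer

/-- Gegenbauer polynomials are positive definite on the sphere (Schoenberg). -/
lemma gegenbauer_posDef {n N : ℕ} (hn : 2 ≤ n)
    (x : Fin N → Metric.sphere (0 : EuclideanSpace ℝ (Fin n)) 1) (w : Fin N → ℝ) (k : ℕ) :
    0 ≤ ∑ i, ∑ j, w i * w j *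
      (gegenbauer n k).eval (inner ℝ (x i : EuclideanSpace ℝ (Fin n)) (x j)) := by
  have hν := gegParam_ge hn
  have hcard : gegParam n = ((Fintype.card (Fin n) : ℝ) - 3) / 2 := by
    rw [Fintype.card_fin, gegParam]
  let y : Fin N → Fin n → ℝ := fun i => ⇑(x i : EuclideanSpace ℝ (Fin n))
  have hy : ∀ i, ∑ l, y i l ^ 2 = 1 := by
    intro i
    have h := EuclideanSpace.norm_sq_eq (x i : EuclideanSpace ℝ (Fin n))
    rw [norm_eq_of_mem_sphere] at h
    simpa [y] using h.symm
  have hinner : ∀ i j, inner ℝ (x i : EuclideanSpace ℝ (Fin n)) (x j) = ∑ l, y j l * y i l := by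
    intro i j
    simp [y, PiLp.inner_apply]
  -- By the reproducing property, the Fischer square of F is a positive multiple of the double sum
  -- in question.
  set F : MvPolynomial (Fin n) ℝ := ∑ i, w i • zonal (gegParam n) (y i) k with hF
  have key : fischer F F = zonalConst (gegParam n) k * ∑ i, ∑ j, w i * w j *
      (gegenbauer n k).eval (inner ℝ (x i : EuclideanSpace ℝ (Fin n)) (x j)) := by
    rw [hF, LinearMap.map_sum₂, Finset.mul_sum]
    refine Finset.sum_congr rfl fun i _ => ?_
    rw [map_sum, Finset.mul_sum]
    refine Finset.sum_congr rfl fun j _ => ?_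
    rw [map_smul, map_smul, LinearMap.smul_apply,
      fischer_zonal hν _ _ (zonal_isHomogeneous hν _ _) (laplacian_zonal hcard hν (hy j) k),
      eval_zonal hν _ (hy i), hinner, gegenbauer_eq]
    simp only [smul_eq_mul]
    have : ∑ l, y i l * y j l = ∑ l, y j l * y i l :=
      Finset.sum_congr rfl fun l _ => mul_comm _ _
    rw [this]
    ring
  have h := fischer_self_nonneg F
  rw [key] at h
  exact nonneg_of_mul_nonneg_right h (zonalConst_pos hν k)

end

section

/-! ### The sign of the Hermite interpolation error -/

/-- Rolle's theorem for finitely many zeros. -/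
lemma exists_finset_zeros_deriv {φ φ' : ℝ → ℝ} {S : Set ℝ} (hS : S.OrdConnected)
    (hSI : S ⊆ Set.Ico (-1) 1) (hc : ContinuousOn φ S)
    (hd : ∀ x ∈ Set.Ioo (-1 : ℝ) 1, HasDerivAt φ (φ' x) x) (A : Finset ℝ) :
    (∀ a ∈ A, a ∈ S ∧ φ a = 0) → ∃ B : Finset ℝ, B.card = A.card - 1 ∧ Disjoint A B ∧
      (∀ x ∈ B, ∃ a ∈ A, x < a) ∧ ∀ x ∈ B, x ∈ Set.Ioo (-1 : ℝ) 1 ∧ φ' x = 0 := by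
  induction A using Finset.induction_on_max with
  | empty => exact fun _ => ⟨∅, by simp⟩
  | insert a A hlt ih =>
    intro hA
    have haA : a ∉ A := fun h => lt_irrefl _ (hlt a h)
    rcases A.eq_empty_or_nonempty with rfl | hne
    · exact ⟨∅, by simp⟩
    obtain ⟨B, hcard, hdis, hB, hB'⟩ := ih fun x hx => hA x (Finset.mem_insert_of_mem hx)
    set b := A.max' hne
    have hbA : b ∈ A := A.max'_mem hne
    obtain ⟨hbS, hb0⟩ := hA b (Finset.mem_insert_of_mem hbA)
    obtain ⟨haS, ha0⟩ := hA a (Finset.mem_insert_self _ _)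
    have hI : ∀ x ∈ Set.Ioo b a, x ∈ Set.Ioo (-1 : ℝ) 1 := fun x hx =>
      ⟨(hSI hbS).1.trans_lt hx.1, hx.2.trans (hSI haS).2⟩
    -- Only the gap between the old maximum b and the new one a contributes a new point. The earlier
    -- points lie below b, each being below some element of A, so c is new.
    obtain ⟨c, hcI, hc0⟩ := exists_hasDerivAt_eq_zero (hlt b hbA) (hc.mono (hS.out hbS haS))
      (hb0.trans ha0.symm) fun x hx => hd x (hI x hx)
    have hcA : ∀ x ∈ A, x < c := fun x hx => (A.le_max' x hx).trans_lt hcI.1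
    have hBa : ∀ x ∈ B, x < b := fun x hx => by
      obtain ⟨y, hy, hxy⟩ := hB x hx
      exact hxy.trans_le (A.le_max' y hy)
    have hcB : c ∉ B := fun h => lt_asymm (hBa c h) hcI.1
    refine ⟨insert c B, ?_, ?_, ?_, ?_⟩
    · rw [Finset.card_insert_of_notMem hcB, Finset.card_insert_of_notMem haA, hcard]
      have := hne.card_pos
      omega
    · rw [Finset.disjoint_left] at hdis ⊢
      intro x hx hx'
      rcases Finset.mem_insert.mp hx with rfl | hx <;>
        rcases Finset.mem_insert.mp hx' with h | hx'
      · exact hcI.2.ne h.symm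
      · exact lt_asymm (hBa x hx') (hlt b hbA)
      · exact (hcA x hx).ne h
      · exact hdis hx hx'
    · intro x hx
      rcases Finset.mem_insert.mp hx with rfl | hx
      · exact ⟨a, Finset.mem_insert_self _ _, hcI.2⟩
      · exact ⟨b, Finset.mem_insert_of_mem hbA, hBa x hx⟩
    · intro x hx
      rcases Finset.mem_insert.mp hx with rfl | hx
      · exact ⟨hI x hcI, hc0⟩
      · exact hB' x hx

/-- Rolle's theorem for a multiset of zeros, counted with multiplicity. -/
lemma exists_multiset_zeros_deriv {ψ : ℕ → ℝ → ℝ} {S : Set ℝ} (hS : S.OrdConnected)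
    (hSI : S ⊆ Set.Ico (-1) 1) (hc : ContinuousOn (ψ 0) S)
    (hd : ∀ x ∈ Set.Ioo (-1 : ℝ) 1, HasDerivAt (ψ 0) (ψ 1 x) x) {Z : Multiset ℝ}
    (hZS : ∀ a ∈ Z, a ∈ S) (hZ1 : Z.count (-1) ≤ 1)
    (hZ0 : ∀ a ∈ Z, ∀ j < Z.count a, ψ j a = 0) :
    ∃ Z' : Multiset ℝ, Z'.card = Z.card - 1 ∧ (∀ a ∈ Z', a ∈ Set.Ioo (-1 : ℝ) 1) ∧
      ∀ a ∈ Z', ∀ j < Z'.count a, ψ (j + 1) a = 0 := by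
  classical
  obtain ⟨B, hcard, hdis, -, hB⟩ := exists_finset_zeros_deriv hS hSI hc hd Z.toFinset fun a ha =>
    have ha := Multiset.mem_toFinset.mp ha
    ⟨hZS a ha, hZ0 a ha 0 (Multiset.count_pos.mpr ha)⟩
  have hcount : ∀ a, (Z - Z.toFinset.val + B.val).count a =
      Z.count a - (if a ∈ Z then 1 else 0) + (if a ∈ B then 1 else 0) := fun a => by
    rw [Multiset.count_add, Multiset.count_sub, Multiset.toFinset_val, Multiset.count_dedup,
      Multiset.count_eq_of_nodup B.nodup]
    rfl
  have key : ∀ a ∈ Z - Z.toFinset.val + B.val,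
      (a ∈ B ∧ (Z - Z.toFinset.val + B.val).count a = 1) ∨
      (a ∈ Z ∧ (Z - Z.toFinset.val + B.val).count a + 1 = Z.count a ∧ 2 ≤ Z.count a) := by
    intro a ha
    have h1 := Multiset.count_pos.mpr ha
    have h2 := hcount a
    by_cases haB : a ∈ B
    · have haZ : a ∉ Z := fun h =>
        Finset.disjoint_left.mp hdis (Multiset.mem_toFinset.mpr h) haB
      left
      rw [h2, Multiset.count_eq_zero_of_notMem haZ]
      simp [haB]
    · by_cases haZ : a ∈ Z
      · rw [if_neg haB, if_pos haZ] at h2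
        exact Or.inr ⟨haZ, by omega, by omega⟩
      · rw [if_neg haB, if_neg haZ, Multiset.count_eq_zero_of_notMem haZ] at h2
        omega
  -- Every multiplicity drops by one, and the Rolle points between the distinct zeros are added.
  refine ⟨Z - Z.toFinset.val + B.val, ?_, fun a ha => ?_, fun a ha j hj => ?_⟩
  · have hle : Z.toFinset.val ≤ Z := by
      rw [Multiset.toFinset_val]
      exact Multiset.dedup_le Z
    have h3 := Multiset.card_le_card hle
    have h4 : Z.toFinset.card = 0 → Z.card = 0 := fun h => by
      rw [Finset.card_eq_zero, Multiset.toFinset_eq_empty] at h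
      simp [h]
    rw [Multiset.card_add, Multiset.card_sub hle, Finset.card_val, Finset.card_val, hcard]
    rw [Finset.card_val] at h3
    omega
  · rcases key a ha with ⟨h, -⟩ | ⟨h, -, h2⟩
    · exact (hB a h).1
    -- An old zero that survives had multiplicity at least 2, so it is not -1.
    · refine ⟨lt_of_le_of_ne (hSI (hZS a h)).1 ?_, (hSI (hZS a h)).2⟩
      rintro rfl
      omega
  · rcases key a ha with ⟨h, h1⟩ | ⟨h, h1, -⟩
    · obtain rfl : j = 0 := by omega
      exact (hB a h).2
    · exact hZ0 a h (j + 1) (by omega)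

lemma exists_zero_of_multiset_Ioo (m : ℕ) : ∀ {ψ : ℕ → ℝ → ℝ} {Z : Multiset ℝ},
    (∀ i < m, ∀ x ∈ Set.Ioo (-1 : ℝ) 1, HasDerivAt (ψ i) (ψ (i + 1) x) x) →
    Z.card = m + 1 → (∀ a ∈ Z, a ∈ Set.Ioo (-1 : ℝ) 1) →
    (∀ a ∈ Z, ∀ j < Z.count a, ψ j a = 0) → ∃ ξ ∈ Set.Ioo (-1 : ℝ) 1, ψ m ξ = 0 := by
  induction m with
  | zero =>
    intro ψ Z _ hcard hZ hZ0
    obtain ⟨a, rfl⟩ := Multiset.card_eq_one.mp hcard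
    exact ⟨a, hZ a (by simp), hZ0 a (by simp) 0 (by simp)⟩
  | succ m ih =>
    intro ψ Z hd hcard hZ hZ0
    obtain ⟨Z', h1, h2, h3⟩ := exists_multiset_zeros_deriv (ψ := ψ) Set.ordConnected_Ioo
      Set.Ioo_subset_Ico_self
      (fun x hx => (hd 0 (Nat.succ_pos m) x hx).continuousAt.continuousWithinAt)
      (hd 0 (Nat.succ_pos m)) hZ
      (by rw [Multiset.count_eq_zero_of_notMem fun h => lt_irrefl _ (hZ _ h).1]; omega) hZ0
    exact ih (ψ := fun i => ψ (i + 1)) (fun i hi => hd (i + 1) (by omega)) (by omega) h2 h3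

/-- The first application of Rolle's theorem needs only continuity at -1, and it removes a simple
zero there. All remaining zeros are interior, so differentiability on the open interval suffices
afterwards. -/
lemma exists_zero_of_multiset {m : ℕ} (hm : 1 ≤ m) {ψ : ℕ → ℝ → ℝ} {Z : Multiset ℝ}
    (hc : ContinuousOn (ψ 0) (Set.Ico (-1) 1))
    (hd : ∀ i < m, ∀ x ∈ Set.Ioo (-1 : ℝ) 1, HasDerivAt (ψ i) (ψ (i + 1) x) x)
    (hcard : Z.card = m + 1) (hZ : ∀ a ∈ Z, a ∈ Set.Ico (-1 : ℝ) 1) (hZ1 : Z.count (-1) ≤ 1)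
    (hZ0 : ∀ a ∈ Z, ∀ j < Z.count a, ψ j a = 0) : ∃ ξ ∈ Set.Ioo (-1 : ℝ) 1, ψ m ξ = 0 := by
  obtain ⟨m, rfl⟩ : ∃ l, m = l + 1 := ⟨m - 1, by omega⟩
  obtain ⟨Z', h1, h2, h3⟩ := exists_multiset_zeros_deriv Set.ordConnected_Ico le_rfl hc
    (hd 0 (Nat.succ_pos m)) hZ hZ1 hZ0
  exact exists_zero_of_multiset_Ioo m (ψ := fun i => ψ (i + 1))
    (fun i hi => hd (i + 1) (by omega)) (by omega) h2 h3

lemma iterate_derivative_nodal_eval {T : Multiset ℝ} {a : ℝ} {j : ℕ} (hj : j < T.count a) :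
    (derivative^[j] (T.map fun b => X - C b).prod).eval a = 0 := by
  have hne : (T.map fun b => X - C b).prod ≠ 0 := (monic_multiset_prod_of_monic _ _
    fun b _ => monic_X_sub_C b).ne_zero
  rw [← roots_multiset_prod_X_sub_C T, count_roots] at hj
  exact (lt_rootMultiplicity_iff_isRoot_iterate_derivative hne).mp hj j le_rfl

/-- Where the nodal polynomial is nonpositive, the Hermite interpolant of a function with
nonnegative derivative of order the number of nodes is an upper bound of that function. -/
lemma IsHermiteInterpolant.le_eval {h : ℝ → ℝ} {T : Multiset ℝ} {g : ℝ[X]}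
    (hg : IsHermiteInterpolant h T g) (hT : 1 ≤ T.card)
    (hTI : ∀ a ∈ T, a ∈ Set.Ico (-1 : ℝ) 1) (hT1 : T.count (-1) ≤ 1)
    (hcont : ContinuousOn h (Set.Ico (-1) 1))
    (hdiff : ∀ i < T.card, DifferentiableOn ℝ (iteratedDeriv i h) (Set.Ioo (-1) 1))
    (hpos : ∀ t ∈ Set.Ioo (-1 : ℝ) 1, 0 ≤ iteratedDeriv T.card h t)
    {t : ℝ} (ht : t ∈ Set.Ico (-1 : ℝ) 1) (hω : ((T.map fun a => X - C a).prod).eval t ≤ 0) :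
    h t ≤ g.eval t := by
  by_cases htT : t ∈ T
  · have := hg.2 t htT 0 (Multiset.count_pos.mpr htT)
    simp only [Function.iterate_zero, id, iteratedDeriv_zero] at this
    exact this.ge
  set ω := (T.map fun a => X - C a).prod with hωdef
  have hmonic : ω.Monic := monic_multiset_prod_of_monic _ _ fun b _ => monic_X_sub_C b
  have hdeg : ω.natDegree = T.card := natDegree_multiset_prod_X_sub_C_eq_card T
  have hω0 : ω.eval t ≠ 0 := fun h0 => htT <| by
    rw [← roots_multiset_prod_X_sub_C T]
    exact (mem_roots hmonic.ne_zero).mpr h0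
  -- With this c the function h - g - c ω vanishes at t as well as on T, one zero more than the
  -- number m of nodes. Its m-th derivative therefore has a zero ξ, so h^(m)(ξ) = c m!, whence c ≥ 0
  -- and h(t) - g(t) = c ω(t) ≤ 0.
  set c := (h t - g.eval t) / ω.eval t with hcdef
  have hct : c * ω.eval t = h t - g.eval t := div_mul_cancel₀ _ hω0
  obtain ⟨ξ, hξ, hξ0⟩ := exists_zero_of_multiset (m := T.card) (Z := t ::ₘ T) hT
    (ψ := fun i x => iteratedDeriv i h x - (derivative^[i] (g + C c * ω)).eval x)
    (hcont.sub (Polynomial.continuous _).continuousOn)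
    (fun i hi x hx => by
      refine HasDerivAt.sub ?_ ?_
      · rw [iteratedDeriv_succ]
        exact ((hdiff i hi).differentiableAt (isOpen_Ioo.mem_nhds hx)).hasDerivAt
      · rw [Function.iterate_succ_apply']
        exact Polynomial.hasDerivAt _ x)
    (by simp)
    (by
      intro a ha
      rcases Multiset.mem_cons.mp ha with rfl | ha
      exacts [ht, hTI a ha])
    (by
      by_cases h1 : t = -1
      · rw [← h1, Multiset.count_cons_self, Multiset.count_eq_zero_of_notMem htT]
      · rw [Multiset.count_cons_of_ne (Ne.symm h1)]
        exact hT1)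
    (by
      intro a ha j hj
      by_cases h1 : a = t
      · subst h1
        rw [Multiset.count_cons_self, Multiset.count_eq_zero_of_notMem htT] at hj
        obtain rfl : j = 0 := by omega
        simp [hct]
      · have haT : a ∈ T := (Multiset.mem_cons.mp ha).resolve_left h1
        rw [Multiset.count_cons_of_ne h1] at hj
        simp only [iterate_map_add, iterate_derivative_C_mul, eval_add, eval_mul, eval_C,
          hωdef, iterate_derivative_nodal_eval hj, hg.2 a haT j hj]
        ring)
  have hgz : derivative^[T.card] g = 0 := iterate_derivative_eq_zero_of_degree_lt hg.1
  have hωz : derivative^[T.card] ω = C (T.card.factorial : ℝ) := by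
    have hz : (derivative^[T.card] ω).natDegree = 0 := by
      have := natDegree_iterate_derivative ω T.card
      omega
    have hlead : ω.coeff T.card = 1 := by rw [← hdeg]; exact hmonic
    rw [eq_C_of_natDegree_eq_zero hz, coeff_iterate_derivative, zero_add, hlead,
      Nat.descFactorial_self, nsmul_one]
  simp only [iterate_map_add, iterate_derivative_C_mul, eval_mul, eval_C, hgz, hωz, zero_add] at hξ0
  have hfac : (0 : ℝ) < T.card.factorial := by positivity
  have hc0 : 0 ≤ c := by
    have := hpos ξ hξ
    by_contra! hneg
    nlinarith
  nlinarith

end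

section

/-! ### The Levenshtein polynomial -/

variable {n ε k : ℕ} {s : ℝ}

lemma roots_levenshtein (hn : 2 ≤ n) (hε : ε ≤ 1) (hs : s ∈ Set.Ico (-1 : ℝ) 1)
    (hl : largestZero n 1 (1 - ε) (k + ε) ≤ s) :
    ((X - C s) * (X + 1) ^ ε * levenshteinKernel n ε (k + 1) s ^ 2).roots =
      {s} + ε • {-1} + 2 • (levenshteinKernel n ε (k + 1) s).roots := by
  refine roots_X_sub_C_mul _ (fun h0 => ?_) s ε
  have := levenshteinKernel_pos hn hs.2 (adjacent_pos_of_mem hn hε hs hl).1 le_rfl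
  rw [h0, eval_zero] at this
  exact this.false

lemma card_roots_levenshtein (hn : 2 ≤ n) (hε : ε ≤ 1) (hs : s ∈ Set.Ico (-1 : ℝ) 1)
    (hl : largestZero n 1 (1 - ε) (k + ε) ≤ s) :
    ((X - C s) * (X + 1) ^ ε * levenshteinKernel n ε (k + 1) s ^ 2).roots.card =
      2 * k + 1 + ε := by
  have hpos := (adjacent_pos_of_mem hn hε hs hl).1 s le_rfl
  have h1 := (levenshteinKernel_splits hn hpos).natDegree_eq_card_roots
  rw [natDegree_eq_of_degree_eq_some (levenshteinKernel_degree hn hpos)] at h1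
  rw [roots_levenshtein hn hε hs hl]
  simp only [Multiset.card_add, Multiset.card_nsmul, Multiset.card_singleton, ← h1]
  ring

lemma mem_roots_levenshtein (hn : 2 ≤ n) (hε : ε ≤ 1) (hs : s ∈ Set.Ico (-1 : ℝ) 1)
    (hl : largestZero n 1 (1 - ε) (k + ε) ≤ s) {a : ℝ}
    (ha : a ∈ ((X - C s) * (X + 1) ^ ε * levenshteinKernel n ε (k + 1) s ^ 2).roots) :
    a ∈ Set.Icc (-1 : ℝ) s := by
  rw [roots_levenshtein hn hε hs hl, Multiset.mem_add, Multiset.mem_add] at ha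
  rcases ha with (ha | ha) | ha
  · rw [Multiset.mem_singleton.mp ha]
    exact ⟨hs.1, le_rfl⟩
  · rw [Multiset.mem_singleton.mp (Multiset.mem_of_mem_nsmul ha)]
    exact ⟨le_rfl, hs.1⟩
  · have := mem_roots_levenshteinKernel hn hε hs hl (Multiset.mem_of_mem_nsmul ha)
    exact ⟨this.1, this.2.le⟩

/-- A multiple node at -1 would prescribe a derivative where h is only assumed continuous. As T does
not vanish at -1, the only sources are the factor X - s and, for ε = 1, the factor X + 1, in which
case s > -1. -/
lemma count_roots_levenshtein (hn : 2 ≤ n) (hε : ε ≤ 1) (hs : s ∈ Set.Ico (-1 : ℝ) 1)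
    (hl : largestZero n 1 (1 - ε) (k + ε) ≤ s)
    (hne : ε = 0 → (adjacent n 1 1 k).eval s ≠ 0) :
    ((X - C s) * (X + 1) ^ ε * levenshteinKernel n ε (k + 1) s ^ 2).roots.count (-1) ≤ 1 := by
  have h0 : (levenshteinKernel n ε (k + 1) s).roots.count (-1) = 0 :=
    Multiset.count_eq_zero_of_notMem fun h =>
      levenshteinKernel_ne_zero hn hε hs hl le_rfl (Or.inr hne) (isRoot_of_mem_roots h)
  have h1 := (adjacent_pos_of_mem hn hε hs hl).2
  rw [roots_levenshtein hn hε hs hl, Multiset.count_add, Multiset.count_add,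
    Multiset.count_nsmul, Multiset.count_nsmul, h0, Multiset.count_singleton,
    Multiset.count_singleton_self]
  rcases Nat.le_one_iff_eq_zero_or_eq_one.mp hε with rfl | rfl
  · split_ifs <;> simp
  · rw [if_neg (h1 rfl).ne]

lemma levenshtein_eval_nonpos {T : ℝ[X]} {t : ℝ} (ht : t ∈ Set.Icc (-1 : ℝ) s) :
    ((X - C s) * (X + 1) ^ ε * T ^ 2).eval t ≤ 0 := by
  simp only [eval_mul, eval_sub, eval_X, eval_C, eval_pow, eval_add, eval_one]
  exact mul_nonpos_of_nonpos_of_nonneg (mul_nonpos_of_nonpos_of_nonneg (by linarith [ht.2])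
    (pow_nonneg (by linarith [ht.1]) _)) (sq_nonneg _)

/-- Since the zeros of T occur doubled, the nodal polynomial is again (X - s)(X + 1)^ε times a
square. -/
lemma nodal_levenshtein_nonpos (hn : 2 ≤ n) (hε : ε ≤ 1) (hs : s ∈ Set.Ico (-1 : ℝ) 1)
    (hl : largestZero n 1 (1 - ε) (k + ε) ≤ s) {t : ℝ} (ht : t ∈ Set.Icc (-1 : ℝ) s) :
    ((((X - C s) * (X + 1) ^ ε * levenshteinKernel n ε (k + 1) s ^ 2).roots.map
      fun a => X - C a).prod).eval t ≤ 0 := by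
  have e : ((((X - C s) * (X + 1) ^ ε * levenshteinKernel n ε (k + 1) s ^ 2).roots.map
      fun a => X - C a).prod) = (X - C s) * (X + 1) ^ ε *
        (((levenshteinKernel n ε (k + 1) s).roots.map fun a => X - C a).prod) ^ 2 := by
    rw [roots_levenshtein hn hε hs hl, Multiset.map_add, Multiset.map_add, Multiset.prod_add,
      Multiset.prod_add, Multiset.map_nsmul, Multiset.map_nsmul, Multiset.prod_nsmul,
      Multiset.prod_nsmul]
    simp
  rw [e]
  exact levenshtein_eval_nonpos ht

/-- Christoffel-Darboux at t = 1, where all adjacent polynomials equal 1, evaluates (1 - s) T(1);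
the orthogonality formula for f_0 has the same factor T(1) times `kernelFactor`, and the remaining
identity is `levenshteinValue_zero_mul` or `levenshteinValue_one_mul`. -/
lemma levenshtein_eval_one (n : ℕ) (hn : 2 ≤ n + 2) (hε : ε ≤ 1) (hs : s < 1)
    (hs' : ε = 1 → -1 < s) (hpos : 0 < (adjacent (n + 2) 1 ε k).eval s)
    (hnp : (adjacent (n + 2) 1 ε (k + 1)).eval s ≤ 0) :
    ((X - C s) * (X + 1) ^ ε * levenshteinKernel (n + 2) ε (k + 1) s ^ 2).eval 1 =
      gegenbauerCoeff hn ((X - C s) * (X + 1) ^ ε * levenshteinKernel (n + 2) ε (k + 1) s ^ 2) 0 *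
        levenshteinValue n ε k s := by
  have hcd := congrArg (eval 1) (X_sub_C_mul_levenshteinKernel hn ε k s)
  simp only [eval_mul, eval_sub, eval_X, eval_C] at hcd
  have h1 : ∀ i, (adjacent (n + 2) 1 ε i).eval 1 = 1 := fun i => by
    rw [adjacent_eq, jacobi_eval_one]
  rw [h1, h1, mul_one, mul_one] at hcd
  rw [gegenbauerCoeff_zero_levenshtein hn hε hpos]
  simp only [eval_mul, eval_sub, eval_X, eval_C, eval_pow, eval_add, eval_one]
  rcases Nat.le_one_iff_eq_zero_or_eq_one.mp hε with rfl | rfl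
  · have hv := levenshteinValue_zero_mul n hn hs hpos hnp
    linear_combination (levenshteinKernel (n + 2) 0 (k + 1) s).eval 1 * hcd -
      (levenshteinKernel (n + 2) 0 (k + 1) s).eval 1 * kernelFactor (n + 2) 0 k * hv
  · have hv := levenshteinValue_one_mul n hn hs (hs' rfl) hpos hnp
    linear_combination 2 * (levenshteinKernel (n + 2) 1 (k + 1) s).eval 1 * hcd -
      (levenshteinKernel (n + 2) 1 (k + 1) s).eval 1 * kernelFactor (n + 2) 1 k * hv

/-- At the left end of the Levenshtein interval for `ε = 0` the Levenshtein bound is the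
Delsarte-Goethals-Seidel bound. -/
lemma levenshteinValue_of_adjacent_eq_zero (n : ℕ) (hn : 2 ≤ n + 2) (hs : s < 1)
    (hpos : 0 < (adjacent (n + 2) 1 0 k).eval s)
    (hnp : (adjacent (n + 2) 1 0 (k + 1)).eval s ≤ 0)
    (h0 : (adjacent (n + 2) 1 1 k).eval s = 0) :
    levenshteinValue n 0 k s = 2 * ((n + k + 1).choose (n + 1) : ℝ) := by
  have hG := gegenbauer_neg_of_even hn hpos hnp
  have hrec := ultraspherical_recurrence_eval (gegParam_ge hn) (k + 1) s
  obtain ⟨d, hd⟩ := exists_weight_mul_adjacent hn le_rfl k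
  have hd0 : d ≠ 0 := by
    rintro rfl
    rw [C_0, zero_mul, pow_one] at hd
    have hX : (1 - X : ℝ[X]) ≠ 0 := by
      rw [← neg_ne_zero, neg_sub]
      simpa using X_sub_C_ne_zero (1 : ℝ)
    have hX' : (X + 1 : ℝ[X]) ≠ 0 := by simpa using X_add_C_ne_zero (1 : ℝ)
    have hA : adjacent (n + 2) 1 1 k ≠ 0 := fun h => by
      have := adjacent_degree hn 1 1 k
      rw [h, degree_zero] at this
      exact WithBot.bot_ne_natCast _ this
    exact mul_ne_zero (mul_ne_zero hX hX') hA hd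
  -- A zero of P_k^{1,1} is a point where the Gegenbauer polynomials of degree k and k + 2 agree.
  -- The recurrence then makes their common value s times that of degree k + 1, and the fraction in
  -- the bound becomes -1.
  have he := congrArg (eval s) hd
  rw [eval_mul, h0, mul_zero, eval_mul, eval_C, eval_sub] at he
  have he' := (mul_eq_zero.mp he.symm).resolve_left hd0
  simp only [← gegenbauer_eq, Nat.add_sub_cancel] at hrec
  have hGk : (gegenbauer (n + 2) k).eval s = s * (gegenbauer (n + 2) (k + 1)).eval s := by
    linear_combination (1 - gegDown (gegParam (n + 2)) (k + 1)) * he' - hrec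
  have hch := Nat.add_one_mul_choose_eq (n + k) n
  have hch' : ((n : ℝ) + k + 1) * (n + k).choose n = (n + k + 1).choose (n + 1) * (n + 1) := by
    exact_mod_cast hch
  have h1s : 1 - s ≠ 0 := by linarith
  have hn1 : (n : ℝ) + 1 ≠ 0 := by positivity
  have hG0 := hG.ne
  simp only [levenshteinValue, Nat.cast_zero, add_zero, zero_mul, zero_add, pow_zero, one_mul]
  rw [hGk]
  have e : (s * (gegenbauer (n + 2) (k + 1)).eval s - (gegenbauer (n + 2) (k + 1)).eval s) /
      ((1 - s) * (gegenbauer (n + 2) (k + 1)).eval s) = -1 := by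
    rw [div_eq_iff (mul_ne_zero h1s hG0)]
    ring
  rw [e]
  apply mul_right_cancel₀ hn1
  field_simp
  linear_combination 2 * hch'

/-! ### The linear programming bound -/

/-- Replace h by F on the off-diagonal pairs and complete the sum by the diagonal. In the Gegenbauer
expansion of the full sum the terms of index l ≥ 1 are nonpositive by positive definiteness, and the
term l = 0 is F_0 since the weights sum to one. -/
lemma energy_le_of_gegenbauerCoeff_nonpos (hn : 2 ≤ n) {N : ℕ} {w : Fin N → ℝ} (hw : IsWeight w)
    {x : Fin N → Metric.sphere (0 : EuclideanSpace ℝ (Fin n)) 1} (hx : IsMaxInner x s)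
    {h : ℝ → ℝ} {F : ℝ[X]} (hF : ∀ i, 1 ≤ i → gegenbauerCoeff hn F i ≤ 0)
    (hhF : ∀ t ∈ Set.Icc (-1 : ℝ) s, h t ≤ F.eval t) :
    energy h x w ≤ gegenbauerCoeff hn F 0 - F.eval 1 * ∑ i, w i ^ 2 := by
  have hnorm : ∀ i, ‖(x i : EuclideanSpace ℝ (Fin n))‖ = 1 := fun i => by simp
  have h1 : energy h x w ≤ energy (fun t => F.eval t) x w := by
    refine Finset.sum_le_sum fun i _ => Finset.sum_le_sum fun j hj => ?_
    refine mul_le_mul_of_nonneg_left (hhF _ ⟨?_, ?_⟩) (mul_pos (hw.1 i) (hw.1 j)).le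
    · have := abs_le.mp (abs_real_inner_le_norm (x i : EuclideanSpace ℝ (Fin n)) (x j))
      rw [hnorm, hnorm, mul_one] at this
      exact this.1
    · exact hx.2 ⟨i, j, (Finset.ne_of_mem_erase hj).symm, rfl⟩
  have h2 : energy (fun t => F.eval t) x w = (∑ i, ∑ j, w i * w j *
      F.eval (inner ℝ (x i : EuclideanSpace ℝ (Fin n)) (x j))) - F.eval 1 * ∑ i, w i ^ 2 := by
    rw [energy, Finset.mul_sum, ← Finset.sum_sub_distrib]
    refine Finset.sum_congr rfl fun i _ => ?_
    rw [← Finset.add_sum_erase _ _ (Finset.mem_univ i), real_inner_self_eq_norm_sq, hnorm]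
    ring_nf
  have h3 : (∑ i, ∑ j, w i * w j *
      F.eval (inner ℝ (x i : EuclideanSpace ℝ (Fin n)) (x j))) ≤ gegenbauerCoeff hn F 0 := by
    have e : ∀ t, F.eval t = ∑ l ∈ ((gegenbauerBasis hn).repr F).support,
        gegenbauerCoeff hn F l * (gegenbauer n l).eval t := fun t => by
      conv_lhs => rw [sum_gegenbauerCoeff_mul hn F]
      simp [eval_finsetSum]
    have hswap : (∑ i, ∑ j, w i * w j *
        F.eval (inner ℝ (x i : EuclideanSpace ℝ (Fin n)) (x j))) =
        ∑ l ∈ ((gegenbauerBasis hn).repr F).support, gegenbauerCoeff hn F l *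
          ∑ i, ∑ j, w i * w j *
            (gegenbauer n l).eval (inner ℝ (x i : EuclideanSpace ℝ (Fin n)) (x j)) := by
      simp only [e, Finset.mul_sum]
      rw [eq_comm, Finset.sum_comm]
      refine Finset.sum_congr rfl fun i _ => ?_
      rw [Finset.sum_comm]
      refine Finset.sum_congr rfl fun j _ => Finset.sum_congr rfl fun l _ => ?_
      ring
    have h0 : ∑ i, ∑ j, w i * w j *
        (gegenbauer n 0).eval (inner ℝ (x i : EuclideanSpace ℝ (Fin n)) (x j)) = 1 := by
      simp only [gegenbauer_eq, jacobi_zero, eval_one, mul_one]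
      rw [← Finset.sum_mul_sum, hw.2, mul_one]
    rw [hswap]
    have hle : ∀ l ∈ ((gegenbauerBasis hn).repr F).support, gegenbauerCoeff hn F l *
          ∑ i, ∑ j, w i * w j *
            (gegenbauer n l).eval (inner ℝ (x i : EuclideanSpace ℝ (Fin n)) (x j)) ≤
        if l = 0 then gegenbauerCoeff hn F 0 else 0 := by
      intro l _
      split_ifs with hl
      · rw [hl, h0, mul_one]
      · exact mul_nonpos_of_nonpos_of_nonneg (hF l (Nat.one_le_iff_ne_zero.mpr hl))
          (gegenbauer_posDef hn x w l)
    refine (Finset.sum_le_sum hle).trans ?_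
    rw [Finset.sum_ite_eq']
    split_ifs with hl
    · exact le_rfl
    · exact (Finsupp.notMem_support_iff.mp hl).ge
  linarith

lemma lambdaStar_nonneg (hn : 2 ≤ n) {m : ℕ} (h : ℝ → ℝ)
    (hf : ∀ i ≤ m, 0 < gegenbauerCoeff hn (levenshteinPoly n m s) i) :
    0 ≤ lambdaStar hn m s h := by
  rw [lambdaStar]
  split_ifs with hI
  · obtain ⟨i, hi⟩ := hI
    have hi' := Finset.mem_filter.mp hi
    exact (div_pos hi'.2 (hf i (Finset.mem_Icc.mp hi'.1).2)).le.trans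
      (Finset.le_sup' (fun i => gegenbauerCoeff hn (gT n m s h) i /
        gegenbauerCoeff hn (levenshteinPoly n m s) i) hi)
  · exact le_rfl

/-- This is the purpose of λ*: it makes the coefficients of g_T - λ* f nonpositive. Indices with
nonpositive coefficient of g_T are covered by λ* ≥ 0 and f_i > 0. -/
lemma gegenbauerCoeff_gT_le (hn : 2 ≤ n) {m : ℕ} (h : ℝ → ℝ)
    (hf : ∀ i ≤ m, 0 < gegenbauerCoeff hn (levenshteinPoly n m s) i) {i : ℕ} (h1 : 1 ≤ i)
    (hi : i ≤ m) : gegenbauerCoeff hn (gT n m s h) i ≤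
      lambdaStar hn m s h * gegenbauerCoeff hn (levenshteinPoly n m s) i := by
  rcases le_or_gt (gegenbauerCoeff hn (gT n m s h) i) 0 with h0 | h0
  · exact h0.trans (mul_nonneg (lambdaStar_nonneg hn h hf) (hf i hi).le)
  · have hmem : i ∈ posIndices hn m (gT n m s h) :=
      Finset.mem_filter.mpr ⟨Finset.mem_Icc.mpr ⟨h1, hi⟩, h0⟩
    rw [← div_le_iff₀ (hf i hi), lambdaStar, dif_pos ⟨i, hmem⟩]
    exact Finset.le_sup' (fun i => gegenbauerCoeff hn (gT n m s h) i /
      gegenbauerCoeff hn (levenshteinPoly n m s) i) hmem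

end

end

end WeightedCodes

/-! ### Assembly of the bound -/

theorem theorem4p2 {n : ℕ} (hn : 2 ≤ n) {m : ℕ} (hm : 1 ≤ m)
    {N : ℕ} (w : Fin N → ℝ) (hw : IsWeight w)
    (s : ℝ) (hs : s ∈ Set.Ico (-1 : ℝ) 1) (hsm : s ∈ levenshteinInterval n m)
    (hN₁ : (dgs n m : ℝ) < levenshteinBound n m s ∧
      levenshteinBound n m s ≤ (dgs n (m + 1) : ℝ))
    (h : ℝ → ℝ) (hcont : ContinuousOn h (Set.Ico (-1) 1))
    (hdiff : ∀ i < m, DifferentiableOn ℝ (iteratedDeriv i h) (Set.Ioo (-1) 1))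
    (hpos : ∀ t ∈ Set.Ioo (-1 : ℝ) 1, 0 ≤ iteratedDeriv m h t) :
    (levenshteinPoly n m s).roots.card = m ∧
    (∀ a ∈ (levenshteinPoly n m s).roots, a ∈ Set.Icc (-1 : ℝ) s) ∧
    maxEnergy n h s w ≤
      ((-lambdaStar hn m s h * gegenbauerCoeff hn (levenshteinPoly n m s) 0 *
            (1 - levenshteinBound n m s / effSize w) +
          gegenbauerCoeff hn (gT n m s h) 0 - (gT n m s h).eval 1 / effSize w : ℝ) : EReal) := by
  -- Shifting the dimension by 2 and `halfIdx m` by 1 removes the truncated subtractions from the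
  -- binomial coefficients and indices.
  obtain ⟨n, rfl⟩ : ∃ l, n = l + 2 := ⟨n - 2, by omega⟩
  have hmk := halfIdx_parity m
  obtain ⟨k, hk⟩ : ∃ k, halfIdx m = k + 1 := ⟨halfIdx m - 1, by omega⟩
  obtain ⟨hl, hu⟩ := hsm
  rw [hk, Nat.add_sub_cancel] at hl
  rw [hk] at hu
  have hε := hmk.2
  have hmε : 2 * k + 1 + parity m = m := by omega
  obtain ⟨hP, hs'⟩ := adjacent_pos_of_mem hn hε hs hl
  have hnp := adjacent_succ_nonpos hn hs.2 hP hu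
  -- This is where D(n, m) < N_1 enters: for ε = 0 a zero of P_k^{1,1} at s would give L_m(n, s) =
  -- D(n, m), with k here equal to `halfIdx m - 1`.
  have hne : parity m = 0 → (adjacent (n + 2) 1 1 k).eval s ≠ 0 := by
    intro h0 hz
    have hlt := hN₁.1
    rw [levenshteinBound_eq hk, dgs, h0, hk,
      levenshteinValue_of_adjacent_eq_zero n hn hs.2 (h0 ▸ hP s le_rfl) (h0 ▸ hnp) hz] at hlt
    have e1 : n + 2 + (k + 1) - 2 = n + k + 1 := by omega
    rw [add_zero, e1, show n + 2 - 1 = n + 1 by omega] at hlt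
    push_cast at hlt
    linarith
  have hf : levenshteinPoly (n + 2) m s = (X - C s) * (X + 1) ^ parity m *
      levenshteinKernel (n + 2) (parity m) (k + 1) s ^ 2 := by rw [levenshteinPoly, hk]
  have hcard : (levenshteinPoly (n + 2) m s).roots.card = m := by
    rw [hf, card_roots_levenshtein hn hε hs hl, hmε]
  have hroots : ∀ a ∈ (levenshteinPoly (n + 2) m s).roots, a ∈ Set.Icc (-1 : ℝ) s := fun a ha =>
    mem_roots_levenshtein hn hε hs hl (hf ▸ ha)
  have hfpos : ∀ i ≤ m, 0 < gegenbauerCoeff hn (levenshteinPoly (n + 2) m s) i := fun i hi => by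
    rw [hf]
    exact gegenbauerCoeff_levenshtein_pos hn hε hs.2 hP hnp (hmε.symm ▸ hi)
  have hf1 : (levenshteinPoly (n + 2) m s).eval 1 =
      gegenbauerCoeff hn (levenshteinPoly (n + 2) m s) 0 * levenshteinBound (n + 2) m s := by
    rw [levenshteinBound_eq hk, hf, levenshtein_eval_one n hn hε hs.2 hs' (hP s le_rfl) hnp]
  have hdeg : (levenshteinPoly (n + 2) m s).degree < (m + 1 : ℕ) := by
    have hX : (X + 1 : ℝ[X]).degree = 1 := by simpa using degree_X_add_C (1 : ℝ)
    rw [hf, degree_mul, degree_mul, degree_pow, degree_pow, degree_X_sub_C, hX,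
      levenshteinKernel_degree hn (hP s le_rfl),
      show m + 1 = 2 * k + 1 + parity m + 1 by omega, nsmul_one, nsmul_eq_mul]
    norm_cast
    omega
  have hg := hermiteInterp_spec h (levenshteinPoly (n + 2) m s).roots
  have hgle : ∀ t ∈ Set.Icc (-1 : ℝ) s, h t ≤ (gT (n + 2) m s h).eval t := fun t ht =>
    hg.le_eval (hcard.symm ▸ hm : 1 ≤ (levenshteinPoly (n + 2) m s).roots.card) (fun a ha => ⟨(hroots a ha).1, (hroots a ha).2.trans_lt hs.2⟩)
      (hf ▸ count_roots_levenshtein hn hε hs hl hne) hcont (hcard.symm ▸ hdiff)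
      (hcard.symm ▸ hpos) ⟨ht.1, ht.2.trans_lt hs.2⟩
      (hf ▸ nodal_levenshtein_nonpos hn hε hs hl ht)
  have hgdeg : (gT (n + 2) m s h).degree < (m + 1 : ℕ) := by
    refine hg.1.trans ?_
    rw [hcard]
    exact_mod_cast Nat.lt_succ_self m
  have hlam := lambdaStar_nonneg hn h hfpos
  refine ⟨hcard, hroots, sSup_le ?_⟩
  rintro _ ⟨x, -, hx, rfl⟩
  rw [EReal.coe_le_coe_iff]
  -- The test polynomial is g_T - λ* f. Its coefficients of index above m vanish by degree.
  have hE := energy_le_of_gegenbauerCoeff_nonpos hn hw hx (h := h)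
    (F := gT (n + 2) m s h - C (lambdaStar hn m s h) * levenshteinPoly (n + 2) m s)
    (fun i hi => by
      rw [gegenbauerCoeff_sub, gegenbauerCoeff_C_mul]
      rcases le_or_gt i m with him | him
      · linarith [gegenbauerCoeff_gT_le hn h hfpos hi him]
      · rw [gegenbauerCoeff_eq_zero hn _ hgdeg i him, gegenbauerCoeff_eq_zero hn _ hdeg i him]
        simp)
    (fun t ht => by
      rw [eval_sub, eval_mul, eval_C]
      have h0 : (levenshteinPoly (n + 2) m s).eval t ≤ 0 := by
        rw [hf]
        exact levenshtein_eval_nonpos ht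
      linarith [hgle t ht, mul_nonpos_of_nonneg_of_nonpos hlam h0])
  -- What remains is f(1) = f_0 N_1 and ∑ w_i² = 1 / N_W.
  refine hE.trans (le_of_eq ?_)
  rw [gegenbauerCoeff_sub, gegenbauerCoeff_C_mul, eval_sub, eval_mul, eval_C, hf1, effSize,
    div_div_eq_mul_div, div_div_eq_mul_div, div_one, div_one]
  ring
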